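/- **Setting.** A weighted $k$-Median instance $\mathcal I=((V,d),C,\mathbb F,k,w)$ consists of a finite metric space $(V,d)$ with $n$ points, a set of clients $C\subseteq V$ with weights $w_j\ge 0$ ($j\in C$), a set of facility locations $\mathbb F\subseteq V$, and an integer $1\le k\le|\mathbb F|$. A solution is a set $F\subseteq\mathbb F$ with $|F|=k$; its cost is $\mathrm{cost}(C,F)=\sum_{j\in C}w_j\,d(j,F)$ with $d(j,F)=\min_{f\in F}d(j,f)$, and $\mathrm{OPT}$ is the minimum cost of a solution. Algorithms are programs for a deterministic real RAM: arithmetic and comparisons on real numbers, addition, truncated subtraction and comparisons on natural numbers, and memory accesses take one step each; the only constants are rational; the input, including the matrix of distances and $\varepsilon$, is given in memory. **Theorem.** (a) There are an algorithm, a constant $c$ and an exponent $m$ such that for every $A$ there is a function $f$ with the following property. For every $\varepsilon>0$ and every weighted $k$-Median instance with $|C|\le A\,\varepsilon^{-2}k\log n$, the algorithm, started on the instance and $\varepsilon$, halts after at most $f(k,\varepsilon)\cdot n^{m}$ steps and outputs a solution of cost at most $(1+\tfrac2e+c\,\varepsilon)\cdot\mathrm{OPT}$. In short, it is a $(1+2/e+O(\varepsilon))$-approximation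 algorithm with running time $f(k,\varepsilon)\,n^{O(1)}$. For $\varepsilon>0$ and $a>0$ let $\lceil\!\lceil a\rceil\!\rceil$ be the smallest integral power of $1+\varepsilon$ that is at least $a$, and let $\lceil\!\lceil 0\rceil\!\rceil=0$. Given points $\ell_1,\dots,\ell_k\in V$ and reals $R_1,\dots,R_k$, put $F_i=\{f\in\mathbb F:\lceil\!\lceil d(f,\ell_i)\rceil\!\rceil=R_i\}$. If all $F_i$ are nonempty, add fictitious facilities $F'=\{f_1',\dots,f_k'\}$ one after the other: set $d(f_i',f)=2R_i$ for $f\in F_i$, and $d(f_i',v)=\min_{f\in F_i}\bigl(2R_i+d(f,v)\bigr)$ for all other points $v$ of $V\cup\{f_1',\dots,f_{i-1}'\}$. Let $\mathrm{improv}(S)=\mathrm{cost}(C,F')-\mathrm{cost}(C,S\cup F')$ for $S\subseteq\mathbb F$. (b) For every $\varepsilon>0$, every weighted $k$-Median instance and all $\ell_i,R_i$ for which all $F_i$ are nonempty, the extended distance function on $V\cup F'$ is a pseudometric, and it is a metric if all $R_i$ are positive. Moreover $\mathrm{improv}(\emptyset)=0$, and $\mathrm{improv}$ is monotone and submodular on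 the subsets of $\mathbb F$. (c) Let $F^\star=\{f_1^\star,\dots,f_k^\star\}$ be an optimal solution, let $\ell_i$ be a client closest to $f_i^\star$ among the clients for which $f_i^\star$ is a closest center in $F^\star$ (an arbitrary point of $V$ if there is no such client), and let $R_i=\lceil\!\lceil d(\ell_i,f_i^\star)\rceil\!\rceil$. Then $f_i^\star\in F_i$ for every $i$, and $\mathrm{cost}(C,F')\le(3+2\varepsilon)\cdot\mathrm{OPT}$. -/

import Mathlib

universe u

namespace KMedian

/-! ## Weighted k-Median -/

/-- The distance `d(x, S) = min_{y ∈ S} d(x, y)` of a point to a nonempty finite set, for a distance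
function `d`. -/
noncomputable def distTo {X : Type u} (d : X → X → ℝ) (x : X) (S : Finset X) : ℝ :=
  ⨅ y : {y // y ∈ S}, d x y.1

/-- A weighted k-Median instance `((V,d), C, 𝔽, k, w)` on the metric space `V`.  The values of `weight`
outside of `clients` are irrelevant.  There are at least `k` facility locations, so that a set of
`k` facilities exists. -/
structure Instance (V : Type u) where
  clients : Finset V
  facilities : Finset V
  k : ℕ
  weight : V → ℝ
  k_pos : 0 < k
  k_le : k ≤ facilities.card
  weight_nonneg : ∀ j ∈ clients, 0 ≤ weight j

namespace Instance

variable {V : Type u} [MetricSpace V] (I : Instance V)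

/-- `cost(C, S) = ∑_{j ∈ C} w_j d(j, S)`. -/
noncomputable def cost (S : Finset V) : ℝ :=
  ∑ j ∈ I.clients, I.weight j * distTo dist j S

/-- A feasible solution: a set of exactly `k` facility locations. -/
def IsSolution {V : Type u} (I : Instance V) (S : Finset V) : Prop :=
  S ⊆ I.facilities ∧ S.card = I.k

def IsOptimal (S : Finset V) : Prop :=
  I.IsSolution S ∧ ∀ T, I.IsSolution T → I.cost S ≤ I.cost T

/-- `S` is a feasible solution whose cost is at most `β` times the optimum. -/
def IsApprox (β : ℝ) (S : Finset V) : Prop :=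
  I.IsSolution S ∧ ∀ T, I.IsSolution T → I.cost S ≤ β * I.cost T

end Instance

/-! ## Fictitious facilities -/

/-- The smallest integral power of `1 + ε` that is at least `a`, for `a > 0`; by convention `0` is
rounded to `0`. -/
noncomputable def roundUp (ε a : ℝ) : ℝ :=
  if a = 0 then 0 else (1 + ε) ^ ⌈Real.logb (1 + ε) a⌉

namespace Instance

variable {V : Type u} [MetricSpace V] (I : Instance V)

open Classical in
/-- `F_i`: the facilities at rounded distance `R_i` from `ℓ_i`. -/
noncomputable def candidates (ε : ℝ) (ℓ : Fin I.k → V) (R : Fin I.k → ℝ) (i : Fin I.k) : Finset V :=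
  I.facilities.filter fun f => roundUp ε (dist f (ℓ i)) = R i

open Classical in
/-- The distance of the fictitious facility `f'_i` to a point `v` of `V`. -/
noncomputable def fictDist (ε : ℝ) (ℓ : Fin I.k → V) (R : Fin I.k → ℝ) (i : Fin I.k) (v : V) : ℝ :=
  if v ∈ I.candidates ε ℓ R i then 2 * R i
  else ⨅ f : {f // f ∈ I.candidates ε ℓ R i}, (2 * R i + dist f.1 v)

/-- The distance function on `V ∪ F'`, where `F' = {f'_1, …, f'_k}` and `f'_i` is `Sum.inr i`.  The
facilities `f'_i` are added one after the other, and the distance of `f'_i` to an earlier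
`f'_j` is determined in the same way as its distance to a point of `V`. -/
noncomputable def extDist (ε : ℝ) (ℓ : Fin I.k → V) (R : Fin I.k → ℝ) :
    V ⊕ Fin I.k → V ⊕ Fin I.k → ℝ
  | Sum.inl u, Sum.inl v => dist u v
  | Sum.inl u, Sum.inr i => I.fictDist ε ℓ R i u
  | Sum.inr i, Sum.inl v => I.fictDist ε ℓ R i v
  | Sum.inr i, Sum.inr j =>
      if i = j then 0
      else if j < i then
        ⨅ f : {f // f ∈ I.candidates ε ℓ R i}, (2 * R i + I.fictDist ε ℓ R j f.1)
      else
        ⨅ f : {f // f ∈ I.candidates ε ℓ R j}, (2 * R j + I.fictDist ε ℓ R i f.1)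

/-- `cost(C, S ∪ F')` with respect to the distance function on `V ∪ F'`. -/
noncomputable def extCost (ε : ℝ) (ℓ : Fin I.k → V) (R : Fin I.k → ℝ) (S : Finset V) : ℝ :=
  ∑ j ∈ I.clients, I.weight j *
    distTo (I.extDist ε ℓ R) (Sum.inl j) (S.disjSum (Finset.univ : Finset (Fin I.k)))

/-- `improv(S) = cost(C, F') - cost(C, S ∪ F')`. -/
noncomputable def improv (ε : ℝ) (ℓ : Fin I.k → V) (R : Fin I.k → ℝ) (S : Finset V) : ℝ :=
  I.extCost ε ℓ R ∅ - I.extCost ε ℓ R S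

open Classical in
/-- The cluster of the center `c i`: the clients for which `c i` is a closest center. -/
noncomputable def cluster (c : Fin I.k ↪ V) (i : Fin I.k) : Finset V :=
  I.clients.filter fun j => dist j (c i) = distTo dist j (Finset.univ.map c)

/-- `ℓ i` is a leader of the center `c i`: a client of its cluster that is closest to `c i`.  A center
with an empty cluster has no leader, and then `ℓ i` is not restricted. -/
def IsLeader (c : Fin I.k ↪ V) (ℓ : Fin I.k → V) (i : Fin I.k) : Prop :=
  (I.cluster c i).Nonempty →
    ℓ i ∈ I.cluster c i ∧ ∀ j ∈ I.cluster c i, dist (ℓ i) (c i) ≤ dist j (c i)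

end Instance

open Classical in
/-- Monotonicity of a set function on the subsets of `U`. -/
def MonotoneOnSubsets {V : Type u} (U : Finset V) (g : Finset V → ℝ) : Prop :=
  ∀ S T : Finset V, S ⊆ T → T ⊆ U → g S ≤ g T

open Classical in
/-- Submodularity (diminishing returns) of a set function on the subsets of `U`. -/
def SubmodularOnSubsets {V : Type u} (U : Finset V) (g : Finset V → ℝ) : Prop :=
  ∀ S T : Finset V, S ⊆ T → T ⊆ U → ∀ f ∈ U, g (insert f T) - g T ≤ g (insert f S) - g S

/-! ## A real RAM

Programs are finite pieces of text in a small imperative language.  The memory consists of cells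
that hold natural numbers and cells that hold real numbers.  A cell has an address `(a, i, j)`, where
the name `a` of the array is written in the program and the indices `i`, `j` are computed.  Only
rational constants are available, and every operation, memory access and comparison
takes one step. -/

/-- The memory. -/
structure Mem where
  nat : ℕ → ℕ → ℕ → ℕ
  real : ℕ → ℕ → ℕ → ℝ

def Mem.setNat (s : Mem) (a i j x : ℕ) : Mem :=
  { s with nat := fun a' i' j' => if a' = a ∧ i' = i ∧ j' = j then x else s.nat a' i' j' }

noncomputable def Mem.setReal (s : Mem) (a i j : ℕ) (x : ℝ) : Mem :=
  { s with real := fun a' i' j' => if a' = a ∧ i' = i ∧ j' = j then x else s.real a' i' j' }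

/-- Expressions with values in the natural numbers; subtraction is truncated. -/
inductive NatExp where
  | lit (m : ℕ)
  | get (a : ℕ) (i j : NatExp)
  | add (x y : NatExp)
  | sub (x y : NatExp)

def NatExp.eval (s : Mem) : NatExp → ℕ
  | lit m => m
  | get a i j => s.nat a (i.eval s) (j.eval s)
  | add x y => x.eval s + y.eval s
  | sub x y => x.eval s - y.eval s

def NatExp.steps : NatExp → ℕ
  | lit _ => 1
  | get _ i j => i.steps + j.steps + 1
  | add x y => x.steps + y.steps + 1
  | sub x y => x.steps + y.steps + 1

/-- Expressions with values in the real numbers; a division by zero yields zero. -/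
inductive RealExp where
  | lit (q : ℚ)
  | ofNat (x : NatExp)
  | get (a : ℕ) (i j : NatExp)
  | add (x y : RealExp)
  | sub (x y : RealExp)
  | mul (x y : RealExp)
  | div (x y : RealExp)

noncomputable def RealExp.eval (s : Mem) : RealExp → ℝ
  | lit q => (q : ℝ)
  | ofNat x => (x.eval s : ℝ)
  | get a i j => s.real a (i.eval s) (j.eval s)
  | add x y => x.eval s + y.eval s
  | sub x y => x.eval s - y.eval s
  | mul x y => x.eval s * y.eval s
  | div x y => x.eval s / y.eval s

def RealExp.steps : RealExp → ℕ
  | lit _ => 1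
  | ofNat x => x.steps + 1
  | get _ i j => i.steps + j.steps + 1
  | add x y => x.steps + y.steps + 1
  | sub x y => x.steps + y.steps + 1
  | mul x y => x.steps + y.steps + 1
  | div x y => x.steps + y.steps + 1

/-- Boolean tests. -/
inductive Test where
  | natLe (x y : NatExp)
  | realLe (x y : RealExp)
  | not (b : Test)
  | and (b c : Test)

def Test.holds (s : Mem) : Test → Prop
  | natLe x y => x.eval s ≤ y.eval s
  | realLe x y => x.eval s ≤ y.eval s
  | not b => ¬ b.holds s
  | and b c => b.holds s ∧ c.holds s

def Test.steps : Test → ℕ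
  | natLe x y => x.steps + y.steps + 1
  | realLe x y => x.steps + y.steps + 1
  | not b => b.steps + 1
  | and b c => b.steps + c.steps + 1

inductive Prog where
  | skip
  | setNat (a : ℕ) (i j x : NatExp)
  | setReal (a : ℕ) (i j : NatExp) (x : RealExp)
  | seq (p q : Prog)
  | ite (b : Test) (p q : Prog)
  | loop (b : Test) (p : Prog)

/-- `Run p s s' t`: started in the memory `s`, the program `p` halts in the memory `s'` after exactly
`t` steps.  Here `loop b p` is the while loop with condition `b` and body `p`. -/
inductive Run : Prog → Mem → Mem → ℕ → Prop where
  | skip (s : Mem) : Run Prog.skip s s 1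
  | setNat (s : Mem) (a : ℕ) (i j x : NatExp) :
      Run (Prog.setNat a i j x) s (s.setNat a (i.eval s) (j.eval s) (x.eval s))
        (i.steps + j.steps + x.steps + 1)
  | setReal (s : Mem) (a : ℕ) (i j : NatExp) (x : RealExp) :
      Run (Prog.setReal a i j x) s (s.setReal a (i.eval s) (j.eval s) (x.eval s))
        (i.steps + j.steps + x.steps + 1)
  | seq {p q : Prog} {s s' s'' : Mem} {t t' : ℕ} :
      Run p s s' t → Run q s' s'' t' → Run (Prog.seq p q) s s'' (t + t')
  | ite_true {b : Test} {p q : Prog} {s s' : Mem} {t : ℕ} :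
      b.holds s → Run p s s' t → Run (Prog.ite b p q) s s' (b.steps + t)
  | ite_false {b : Test} {p q : Prog} {s s' : Mem} {t : ℕ} :
      ¬ b.holds s → Run q s s' t → Run (Prog.ite b p q) s s' (b.steps + t)
  | loop_done {b : Test} {p : Prog} {s : Mem} :
      ¬ b.holds s → Run (Prog.loop b p) s s b.steps
  | loop_step {b : Test} {p : Prog} {s s' s'' : Mem} {t t' : ℕ} :
      b.holds s → Run p s s' t → Run (Prog.loop b p) s' s'' t' →
        Run (Prog.loop b p) s s'' (b.steps + t + t')

/-- A program has at most one halting computation from a given memory. -/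
theorem Run.deterministic {p : Prog} {s s₁ s₂ : Mem} {t₁ t₂ : ℕ}
    (h₁ : Run p s s₁ t₁) (h₂ : Run p s s₂ t₂) : s₁ = s₂ ∧ t₁ = t₂ := by
  induction h₁ generalizing s₂ t₂ with
  | skip s => cases h₂; exact ⟨rfl, rfl⟩
  | setNat s a i j x => cases h₂; exact ⟨rfl, rfl⟩
  | setReal s a i j x => cases h₂; exact ⟨rfl, rfl⟩
  | seq _ _ ih ih' =>
    cases h₂ with
    | seq h h' =>
      obtain ⟨rfl, rfl⟩ := ih h
      obtain ⟨rfl, rfl⟩ := ih' h'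
      exact ⟨rfl, rfl⟩
  | ite_true hb _ ih =>
    cases h₂ with
    | ite_true _ h => obtain ⟨rfl, rfl⟩ := ih h; exact ⟨rfl, rfl⟩
    | ite_false hb' _ => exact absurd hb hb'
  | ite_false hb _ ih =>
    cases h₂ with
    | ite_true hb' _ => exact absurd hb' hb
    | ite_false _ h => obtain ⟨rfl, rfl⟩ := ih h; exact ⟨rfl, rfl⟩
  | loop_done hb =>
    cases h₂ with
    | loop_done _ => exact ⟨rfl, rfl⟩
    | loop_step hb' _ _ => exact absurd hb' hb
  | loop_step hb _ _ ih ih' =>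
    cases h₂ with
    | loop_done hb' => exact absurd hb hb'
    | loop_step _ h h' =>
      obtain ⟨rfl, rfl⟩ := ih h
      obtain ⟨rfl, rfl⟩ := ih' h'
      exact ⟨rfl, rfl⟩

/-! ## Input and output -/

namespace Instance

variable {V : Type u} [MetricSpace V] (I : Instance V)

open Classical in
/-- The memory that holds the input `(I, ε)`, where the points of `V` are numbered `0, …, n - 1` by `e`.
Natural cells: `(0,0,0)` holds `n` and `(0,0,1)` holds `k`; `(1,i,0)` and `(2,i,0)` hold the flags
of the clients and of the facility locations.  Real cells: `(0,0,0)` holds `ε`, `(1,i,j)` holds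
the distance of the points `i` and `j`, and `(2,i,0)` holds the weight of the client `i`.  All other
cells hold zero. -/
noncomputable def input {n : ℕ} (e : Fin n ≃ V) (ε : ℝ) : Mem where
  nat := fun a i j =>
    if a = 0 ∧ i = 0 ∧ j = 0 then n
    else if a = 0 ∧ i = 0 ∧ j = 1 then I.k
    else if h : i < n ∧ j = 0 then
      if a = 1 ∧ e ⟨i, h.1⟩ ∈ I.clients then 1
      else if a = 2 ∧ e ⟨i, h.1⟩ ∈ I.facilities then 1
      else 0
    else 0
  real := fun a i j =>
    if a = 0 ∧ i = 0 ∧ j = 0 then ε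
    else if h : a = 1 ∧ i < n ∧ j < n then dist (e ⟨i, h.2.1⟩) (e ⟨j, h.2.2⟩)
    else if h : a = 2 ∧ i < n ∧ j = 0 then
      if e ⟨i, h.2.1⟩ ∈ I.clients then I.weight (e ⟨i, h.2.1⟩) else 0
    else 0

end Instance

/-- The set of points that a program outputs: those whose natural cell `(3,i,0)` holds `1`. -/
def output {V : Type u} {n : ℕ} (e : Fin n ≃ V) (s : Mem) : Finset V :=
  (Finset.univ.filter fun i : Fin n => s.nat 3 i 0 = 1).map e.toEmbedding

end KMedian

/-!
**The algorithm.** Fix a solution `T`; among the clients of positive weight in the cluster of a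
center, call one that is closest to the center its leader. If the leader `L i` and a radius `R i ≥
d(L i, o i)` are known for every center `o i` of `T`, then the facilities in the ball around `L i`
of radius `R i` are the admissible choices for the `i`-th center. Whatever admissible choices are
made, a client `j` pays at most `b j = min_i (d(j, L i) + R i)`, which is about `3 d(j, T)` when
`R i` is close to `d(L i, o i)`.

It remains to choose one admissible facility per column `i`, so as to minimize `∑ w_j min (b j,
d(j, S))`, a supermodular function of `S`. This is a continuous greedy algorithm made discrete and
deterministic. A table with `B` rows and `k` columns is filled row by row; a choice function `τ`
picks from column `i` the entry in row `τ i`, and an entry is chosen so as to minimize the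
potential, the sum of the costs over all `τ`. A step gains at least `1 / B` of what `o i` would
still bring after it (`residual_le_of_step`): the functions `τ` with `τ i = t`, which feel the
step, see an undecided entry in column `i`, so they see fewer decided entries than the others, and
submodularity compares the two. Hence one round reduces the distance of the potential to its goal
by the factor `1 + 1 / B` (`GreedyInv.next`), and after `B` rounds the average over all `τ` is at
most `cost T + (1 + 1 / B) ^ (-B) (∑ w_j b j - cost T)`, which is at most `(1 + 2 / e + 2 ε) cost
T` (`ratio_le`). Some `τ` is at least as good as the average.

The leaders are guessed among the clients. The radii are guessed as multiples `y Q / (B w)` with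
`1 ≤ y ≤ B`, where `Q` is the largest weighted distance `w_j d(j, T)` and `w` is the weight of the
heaviest client of the cluster; the rounding costs `Q / B` per client, hence `ε Q` in total,
because `B` is at least the number of clients divided by `ε` (`Instance.exists_guess`). There are
`n ^ 2` guesses for `Q` and `B ^ (3 k)` guesses for everything else. As `B` is `O(log n)` for
fixed `k` and `ε`, and powers of `log n` are `O(n)` (`one_add_log_pow_le`), the running time is as
required.

**The program.** `Exec` is total correctness for a program together with the time bound `coeff * β
^ depth`, where `β` bounds the number of rounds of each loop; so time is accounted for by bounding
the number of rounds only. `Run.frame` says that arrays to which a program does not assign are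
unchanged.

**The extended metric.** Give every point `x` of `V ∪ F'` a gate, `{x}` or the candidates of `x`,
and a height, `0` or twice the radius of `x`. The distance of two different points is the sum of
their heights plus the distance of their gates (`Instance.extDist_spec`), and the triangle
inequality holds because the diameter of a gate is at most the height. The distance of a client to
`S ∪ F'` is a minimum over `S ∪ F'`, which makes the improvement monotone and submodular.
-/

namespace KMedian

/-! ### Reasoning about programs -/

section Memory

variable (s : Mem) (a a' i j i' j' x : ℕ) (r : ℝ)

@[simp] theorem Mem.setNat_real : (s.setNat a i j x).real = s.real := rfl

@[simp] theorem Mem.setReal_nat : (s.setReal a i j r).nat = s.nat := rfl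

@[simp] theorem Mem.setNat_nat_self :
    (s.setNat a i j x).nat a = fun i' j' => if i' = i ∧ j' = j then x else s.nat a i' j' := by
  funext i' j'; simp [Mem.setNat]

@[simp] theorem Mem.setReal_real_self :
    (s.setReal a i j r).real a = fun i' j' => if i' = i ∧ j' = j then r else s.real a i' j' := by
  funext i' j'; simp [Mem.setReal]

variable {a a'}

@[simp] theorem Mem.setNat_nat_of_ne (h : a' ≠ a) : (s.setNat a i j x).nat a' = s.nat a' := by
  funext i' j'; simp [Mem.setNat, h]

@[simp] theorem Mem.setReal_real_of_ne (h : a' ≠ a) :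
    (s.setReal a i j r).real a' = s.real a' := by
  funext i' j'; simp [Mem.setReal, h]

end Memory

/-- The program `p` contains no assignment to the arrays with name `a`. -/
def Prog.keeps (a : ℕ) : Prog → Bool
  | skip => true
  | setNat b _ _ _ => a != b
  | setReal b _ _ _ => a != b
  | seq p q => p.keeps a && q.keeps a
  | ite _ p q => p.keeps a && q.keeps a
  | loop _ p => p.keeps a

/-- The coefficient in the bound `p.coeff * β ^ p.depth` for the number of steps of a program whose
loops all make at most `β ≥ 1` rounds. -/
def Prog.coeff : Prog → ℕ
  | skip => 1
  | setNat _ i j x => i.steps + j.steps + x.steps + 1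
  | setReal _ i j x => i.steps + j.steps + x.steps + 1
  | seq p q => p.coeff + q.coeff
  | ite b p q => b.steps + p.coeff + q.coeff
  | loop b p => 2 * b.steps + p.coeff

/-- The nesting depth of the loops of a program. -/
def Prog.depth : Prog → ℕ
  | skip => 0
  | setNat _ _ _ _ => 0
  | setReal _ _ _ _ => 0
  | seq p q => max p.depth q.depth
  | ite _ p q => max p.depth q.depth
  | loop _ p => p.depth + 1

/-- The memory `s'` agrees with `s` on all arrays to which `p` does not assign. -/
def Frame (p : Prog) (s s' : Mem) : Prop :=
  ∀ a, p.keeps a = true → s'.nat a = s.nat a ∧ s'.real a = s.real a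

theorem Frame.refl (p : Prog) (s : Mem) : Frame p s s := fun _ _ => ⟨rfl, rfl⟩

theorem Frame.nat {p : Prog} {s s' : Mem} (h : Frame p s s') (a : ℕ) (ha : p.keeps a = true) :
    s'.nat a = s.nat a := (h a ha).1

theorem Frame.real {p : Prog} {s s' : Mem} (h : Frame p s s') (a : ℕ) (ha : p.keeps a = true) :
    s'.real a = s.real a := (h a ha).2

theorem Run.frame {p : Prog} {s s' : Mem} {t : ℕ} (h : Run p s s' t) : Frame p s s' := by
  induction h with
  | skip s => exact Frame.refl _ _
  | setNat s a i j x =>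
    intro b hb
    have hb : b ≠ a := by simpa [Prog.keeps] using hb
    simp [hb]
  | setReal s a i j x =>
    intro b hb
    have hb : b ≠ a := by simpa [Prog.keeps] using hb
    simp [hb]
  | seq _ _ ih ih' =>
    intro b hb
    simp only [Prog.keeps, Bool.and_eq_true] at hb
    exact ⟨((ih' b hb.2).1).trans (ih b hb.1).1, ((ih' b hb.2).2).trans (ih b hb.1).2⟩
  | ite_true _ _ ih =>
    intro b hb
    simp only [Prog.keeps, Bool.and_eq_true] at hb
    exact ih b hb.1
  | ite_false _ _ ih =>
    intro b hb
    simp only [Prog.keeps, Bool.and_eq_true] at hb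
    exact ih b hb.2
  | loop_done _ => exact Frame.refl _ _
  | loop_step _ _ _ ih ih' =>
    intro b hb
    exact ⟨((ih' b hb).1).trans (ih b hb).1, ((ih' b hb).2).trans (ih b hb).2⟩

/-- Total correctness with a time bound: from `s`, the program `p` halts in a memory that satisfies
`Q`, after at most `p.coeff * β ^ p.depth` steps. -/
def Exec (β : ℕ) (p : Prog) (s : Mem) (Q : Mem → Prop) : Prop :=
  ∃ s' t, Run p s s' t ∧ t ≤ p.coeff * β ^ p.depth ∧ Q s'

/-- Sequential composition of a list of programs. -/
def Prog.block : List Prog → Prog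
  | [] => Prog.skip
  | p :: l => Prog.seq p (Prog.block l)

/-- `for c = 0, …, N - 1 do p`, with the counter in the natural cell `(c,0,0)`. -/
def Prog.forLoop (c : ℕ) (N : NatExp) (p : Prog) : Prog :=
  Prog.seq (Prog.setNat c (.lit 0) (.lit 0) (.lit 0))
    (Prog.loop (.natLe (.add (.get c (.lit 0) (.lit 0)) (.lit 1)) N)
      (Prog.seq p
        (Prog.setNat c (.lit 0) (.lit 0) (.add (.get c (.lit 0) (.lit 0)) (.lit 1)))))

/-- `if b then p`. -/
def Prog.when (b : Test) (p : Prog) : Prog := Prog.ite b p Prog.skip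

namespace Exec

variable {β : ℕ} {p q : Prog} {s : Mem} {Q Q' : Mem → Prop}

theorem mono (h : Exec β p s Q) (hQ : ∀ s', Frame p s s' → Q s' → Q' s') : Exec β p s Q' := by
  obtain ⟨s', t, h, ht, hs⟩ := h
  exact ⟨s', t, h, ht, hQ s' h.frame hs⟩

theorem skip (h : Q s) : Exec β Prog.skip s Q :=
  ⟨s, 1, Run.skip s, by simp [Prog.coeff, Prog.depth], h⟩

theorem setNat {a : ℕ} {i j x : NatExp}
    (h : Q (s.setNat a (i.eval s) (j.eval s) (x.eval s))) : Exec β (Prog.setNat a i j x) s Q :=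
  ⟨_, _, Run.setNat s a i j x, by simp [Prog.coeff, Prog.depth], h⟩

theorem setReal {a : ℕ} {i j : NatExp} {x : RealExp}
    (h : Q (s.setReal a (i.eval s) (j.eval s) (x.eval s))) : Exec β (Prog.setReal a i j x) s Q :=
  ⟨_, _, Run.setReal s a i j x, by simp [Prog.coeff, Prog.depth], h⟩

theorem seq (hβ : 1 ≤ β) (h : Exec β p s fun s' => Exec β q s' Q) :
    Exec β (Prog.seq p q) s Q := by
  obtain ⟨s', t, h, ht, s'', t', h', ht', hQ⟩ := h
  refine ⟨s'', t + t', Run.seq h h', ?_, hQ⟩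
  have h₁ : β ^ p.depth ≤ β ^ max p.depth q.depth := Nat.pow_le_pow_right hβ (le_max_left _ _)
  have h₂ : β ^ q.depth ≤ β ^ max p.depth q.depth := Nat.pow_le_pow_right hβ (le_max_right _ _)
  calc t + t' ≤ p.coeff * β ^ p.depth + q.coeff * β ^ q.depth := add_le_add ht ht'
    _ ≤ p.coeff * β ^ max p.depth q.depth + q.coeff * β ^ max p.depth q.depth := by gcongr
    _ = _ := by simp only [Prog.coeff, Prog.depth]; ring

theorem ite (hβ : 1 ≤ β) {b : Test} (hp : b.holds s → Exec β p s Q)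
    (hq : ¬ b.holds s → Exec β q s Q) : Exec β (Prog.ite b p q) s Q := by
  have h₁ : β ^ p.depth ≤ β ^ max p.depth q.depth := Nat.pow_le_pow_right hβ (le_max_left _ _)
  have h₂ : β ^ q.depth ≤ β ^ max p.depth q.depth := Nat.pow_le_pow_right hβ (le_max_right _ _)
  have h₀ : 1 ≤ β ^ max p.depth q.depth := Nat.one_le_pow _ _ hβ
  by_cases hb : b.holds s
  · obtain ⟨s', t, h, ht, hQ⟩ := hp hb
    refine ⟨s', _, Run.ite_true hb h, ?_, hQ⟩
    simp only [Prog.coeff, Prog.depth]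
    nlinarith [Nat.mul_le_mul_left p.coeff h₁, Nat.mul_le_mul_left b.steps h₀]
  · obtain ⟨s', t, h, ht, hQ⟩ := hq hb
    refine ⟨s', _, Run.ite_false hb h, ?_, hQ⟩
    simp only [Prog.coeff, Prog.depth]
    nlinarith [Nat.mul_le_mul_left q.coeff h₂, Nat.mul_le_mul_left b.steps h₀]

theorem when (hβ : 1 ≤ β) {b : Test} (hp : b.holds s → Exec β p s Q)
    (hq : ¬ b.holds s → Q s) : Exec β (Prog.when b p) s Q :=
  ite hβ hp fun h => skip (hq h)

theorem block_nil (h : Q s) : Exec β (Prog.block []) s Q := skip h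

theorem block_cons (hβ : 1 ≤ β) {l : List Prog}
    (h : Exec β p s fun s' => Exec β (Prog.block l) s' Q) : Exec β (Prog.block (p :: l)) s Q :=
  seq hβ h

/-- A while loop that makes exactly `n ≤ β` rounds; `Inv i` holds after `i` rounds. -/
theorem loop (hβ : 1 ≤ β) {b : Test} {n : ℕ} (hn : n ≤ β) (Inv : ℕ → Mem → Prop)
    (hb : ∀ i ≤ n, ∀ s', Frame (Prog.loop b p) s s' → Inv i s' → (b.holds s' ↔ i < n))
    (h₀ : Inv 0 s)
    (hstep : ∀ i < n, ∀ s', Frame (Prog.loop b p) s s' → Inv i s' → Exec β p s' (Inv (i + 1)))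
    (hQ : ∀ s', Frame (Prog.loop b p) s s' → Inv n s' → Q s') :
    Exec β (Prog.loop b p) s Q := by
  have key : ∀ r i : ℕ, i + r = n → ∀ s', Frame (Prog.loop b p) s s' → Inv i s' →
      ∃ s'' t, Run (Prog.loop b p) s' s'' t ∧
        t ≤ r * (b.steps + p.coeff * β ^ p.depth) + b.steps ∧ Inv n s'' := by
    intro r
    induction r with
    | zero =>
      intro i hi s' hF hI
      obtain rfl : i = n := by omega
      refine ⟨s', _, Run.loop_done (fun h => ?_), by simp, hI⟩
      exact lt_irrefl _ ((hb i le_rfl s' hF hI).1 h)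
    | succ r ih =>
      intro i hi s' hF hI
      have hin : i < n := by omega
      obtain ⟨s₁, t₁, h₁, ht₁, hI₁⟩ := hstep i hin s' hF hI
      have hF₁ : Frame (Prog.loop b p) s s₁ := fun a ha =>
        ⟨((h₁.frame a ha).1).trans (hF a ha).1, ((h₁.frame a ha).2).trans (hF a ha).2⟩
      obtain ⟨s₂, t₂, h₂, ht₂, hI₂⟩ := ih (i + 1) (by omega) s₁ hF₁ hI₁
      refine ⟨s₂, _, Run.loop_step ((hb i hin.le s' hF hI).2 hin) h₁ h₂, ?_, hI₂⟩
      rw [Nat.succ_mul]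
      omega
  obtain ⟨s', t, h, ht, hI⟩ := key n 0 (by simp) s (Frame.refl _ _) h₀
  refine ⟨s', t, h, ht.trans ?_, hQ s' h.frame hI⟩
  have h₀ : 1 ≤ β ^ p.depth := Nat.one_le_pow _ _ hβ
  calc n * (b.steps + p.coeff * β ^ p.depth) + b.steps
      ≤ β * (b.steps * β ^ p.depth + p.coeff * β ^ p.depth) + b.steps * (β * β ^ p.depth) := by
        refine add_le_add (Nat.mul_le_mul hn (add_le_add ?_ le_rfl)) ?_
        · exact Nat.le_mul_of_pos_right _ h₀
        · exact Nat.le_mul_of_pos_right _ (Nat.mul_pos hβ h₀)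
    _ = _ := by simp only [Prog.coeff, Prog.depth]; ring

/-- A for loop with `n ≤ β` rounds; `Inv i` holds before the round with counter value `i`. -/
theorem forLoop (hβ : 1 ≤ β) {c n : ℕ} {N : NatExp} (hn : n ≤ β) (Inv : ℕ → Mem → Prop)
    (hc : p.keeps c = true)
    (hN : ∀ s', Frame (Prog.forLoop c N p) s s' → N.eval s' = n)
    (h₀ : Inv 0 (s.setNat c 0 0 0))
    (hstep : ∀ i < n, ∀ s', Frame (Prog.forLoop c N p) s s' → s'.nat c 0 0 = i → Inv i s' →
      Exec β p s' fun s'' => Inv (i + 1) (s''.setNat c 0 0 (i + 1)))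
    (hQ : ∀ s', Frame (Prog.forLoop c N p) s s' → Inv n s' → Q s') :
    Exec β (Prog.forLoop c N p) s Q := by
  have hk : ∀ a, (Prog.forLoop c N p).keeps a = true → a ≠ c ∧ p.keeps a = true := by
    intro a ha
    simp only [Prog.forLoop, Prog.keeps, Bool.and_eq_true, bne_iff_ne] at ha
    tauto
  have hF : ∀ {r : Mem} {x : ℕ}, (∀ a, (Prog.forLoop c N p).keeps a = true →
      r.nat a = s.nat a ∧ r.real a = s.real a) →
      Frame (Prog.forLoop c N p) s (r.setNat c 0 0 x) := by
    intro r x h a ha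
    have := (hk a ha).1
    exact ⟨by rw [Mem.setNat_nat_of_ne _ _ _ _ this]; exact (h a ha).1, (h a ha).2⟩
  have hF' : ∀ {s'}, Frame (Prog.loop (.natLe (.add (.get c (.lit 0) (.lit 0)) (.lit 1)) N)
      (Prog.seq p (Prog.setNat c (.lit 0) (.lit 0) (.add (.get c (.lit 0) (.lit 0)) (.lit 1)))))
      (s.setNat c 0 0 0) s' → Frame (Prog.forLoop c N p) s s' := by
    intro s' h a ha
    have h₁ := hk a ha
    have h₂ := h a (by simp [Prog.keeps, h₁])
    exact ⟨by rw [h₂.1, Mem.setNat_nat_of_ne _ _ _ _ h₁.1], h₂.2⟩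
  refine seq hβ (setNat ?_)
  refine loop hβ hn (fun i s' => s'.nat c 0 0 = i ∧ Inv i s') ?_ ?_ ?_ ?_
  · intro i _ s' h hI
    change s'.nat c 0 0 + 1 ≤ N.eval s' ↔ i < n
    rw [hN s' (hF' h), hI.1]
    exact Iff.rfl
  · exact ⟨by simp [NatExp.eval], h₀⟩
  · intro i hi s' h hI
    refine seq hβ ((hstep i hi s' (hF' h) hI.1 hI.2).mono fun s'' h'' hI'' => setNat ?_)
    have hc' : s''.nat c 0 0 = i := by rw [h''.nat c hc, hI.1]
    simp only [NatExp.eval, hc']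
    exact ⟨by simp, hI''⟩
  · intro s' h hI
    exact hQ s' (hF' h) hI.2

end Exec

/-! ### Cost of a partially decided table -/

/-- The minimum of `x` and of the distances `δ` to the facilities chosen by `τ` among the first `i`
columns of `tab`.  An entry `f + 1` stands for the facility `f`, and `0` for an undecided
entry. -/
def clamp (x : ℝ) (δ : ℕ → ℝ) (tab : ℕ → ℕ → ℕ) (τ : ℕ → ℕ) : ℕ → ℝ
  | 0 => x
  | i + 1 =>
    if 1 ≤ tab (τ i) i then min (clamp x δ tab τ i) (δ (tab (τ i) i - 1))
    else clamp x δ tab τ i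

/-- The cost of the facilities that `τ` chooses in `tab`, where client `j` pays at most `b j`.  The
second index of `w` and of `b` is a dummy. -/
def rowCost (n k : ℕ) (d w b : ℕ → ℕ → ℝ) (tab : ℕ → ℕ → ℕ) (τ : ℕ → ℕ) : ℝ :=
  ∑ j ∈ Finset.range n, w j 0 * clamp (b j 0) (d j) tab τ k

/-- The sum of the costs over the choice functions in the first `Z` rows of `D`. -/
def potential (n k Z : ℕ) (d w b : ℕ → ℕ → ℝ) (D tab : ℕ → ℕ → ℕ) : ℝ :=
  ∑ N ∈ Finset.range Z, rowCost n k d w b tab (D N)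

/-! ### Evaluating a table

Cells of the memory in use besides the input and the output, `(a,0,0)` where no indices are given.
Natural: `(4,x,0)` the clients, listed; `5` their number; `6` the base `B`; `7` the number of rows of
the table `(8,N,i)` of digit vectors; `9` a carry; `(10,t,i)` the table of choices, with `f + 1` for
the facility `f` and `0` for undecided; `11` the best choice for an entry; `12` a flag that every
entry has found an admissible facility; `(13,i,0)` the best solution so far, encoded like `10`, and
`14` a flag that there is one; `15` the size of the output; `(16,i,0)` the leaders; `20` to `28`
loop counters.  Real: `(50,i,0)` the radii; `(51,j,0)` the bound for what point `j` pays; `52` what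
it pays; `53` the cost of a row; `54` and `55` the current and the least potential; `56` the cost
of the best solution; `57` the scale `Q`. -/

/-- The natural cell `(a,0,0)`. -/
abbrev natVar (a : ℕ) : NatExp := .get a (.lit 0) (.lit 0)

/-- The real cell `(a,0,0)`. -/
abbrev realVar (a : ℕ) : RealExp := .get a (.lit 0) (.lit 0)

/-- The cell with the number `n` of points. -/
abbrev nExp : NatExp := natVar 0

/-- The cell with the number `k` of centers. -/
abbrev kExp : NatExp := .get 0 (.lit 0) (.lit 1)

/-- The entry of the table `10` that the current row (counter `24`) of `8` chooses in the column given
by the counter `21`. -/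
abbrev entryExp : NatExp := .get 10 (.get 8 (natVar 24) (natVar 21)) (natVar 21)

/-- Stores in the real cell `53` the cost `rowCost` of the current row. -/
def rowProg : Prog := .block [
  .setReal 53 (.lit 0) (.lit 0) (.lit 0),
  .forLoop 20 nExp (.block [
    .setReal 52 (.lit 0) (.lit 0) (.get 51 (natVar 20) (.lit 0)),
    .forLoop 21 kExp
      (.when (.natLe (.lit 1) entryExp)
        (.when (.realLe (.get 1 (natVar 20) (.sub entryExp (.lit 1))) (realVar 52))
          (.setReal 52 (.lit 0) (.lit 0) (.get 1 (natVar 20) (.sub entryExp (.lit 1)))))),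
    .setReal 53 (.lit 0) (.lit 0)
      (.add (realVar 53) (.mul (.get 2 (natVar 20) (.lit 0)) (realVar 52)))])]

/-- Stores in the real cell `54` the potential of the table `10`. -/
def potentialProg : Prog := .block [
  .setReal 54 (.lit 0) (.lit 0) (.lit 0),
  .forLoop 24 (natVar 7) (.block [
    rowProg,
    .setReal 54 (.lit 0) (.lit 0) (.add (realVar 54) (realVar 53))])]

theorem rowProg_spec {β n k : ℕ} {s : Mem} (hβ : 1 ≤ β) (hn : s.nat 0 0 0 = n)
    (hk : s.nat 0 0 1 = k) (hnβ : n ≤ β) (hkβ : k ≤ β) :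
    Exec β rowProg s fun s' => s'.real 53 0 0 =
      rowCost n k (s.real 1) (s.real 2) (s.real 51) (s.nat 10) (s.nat 8 (s.nat 24 0 0)) := by
  refine Exec.block_cons hβ (Exec.setReal ?_)
  refine Exec.block_cons hβ (Exec.forLoop hβ hnβ (fun i s' => s'.real 53 0 0 =
      rowCost i k (s.real 1) (s.real 2) (s.real 51) (s.nat 10) (s.nat 8 (s.nat 24 0 0)))
      rfl ?_ ?_ ?_ ?_)
  · intro s' h; simp [NatExp.eval, h.nat 0 rfl, hn]
  · simp [RealExp.eval, NatExp.eval, rowCost]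
  · intro j hj s₁ h₁ hj₁ hI
    refine Exec.block_cons hβ (Exec.setReal ?_)
    refine Exec.block_cons hβ (Exec.forLoop hβ hkβ (fun i s' => s'.real 52 0 0 =
      clamp (s.real 51 j 0) (s.real 1 j) (s.nat 10) (s.nat 8 (s.nat 24 0 0)) i) rfl ?_ ?_ ?_ ?_)
    · intro s' h; simp [NatExp.eval, h.nat 0 rfl, h₁.nat 0 rfl, hk]
    · simp [RealExp.eval, NatExp.eval, h₁.real 51 rfl, hj₁, clamp]
    · intro i hi s₂ h₂ hi₂ hI₂
      have e8 : s₂.nat 8 = s.nat 8 := by simp [h₂.nat 8 rfl, h₁.nat 8 rfl]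
      have e10 : s₂.nat 10 = s.nat 10 := by simp [h₂.nat 10 rfl, h₁.nat 10 rfl]
      have e24 : s₂.nat 24 = s.nat 24 := by simp [h₂.nat 24 rfl, h₁.nat 24 rfl]
      have e20 : s₂.nat 20 0 0 = j := by simp [h₂.nat 20 rfl, hj₁]
      have e1 : s₂.real 1 = s.real 1 := by simp [h₂.real 1 rfl, h₁.real 1 rfl]
      refine Exec.when hβ (fun hb => Exec.when hβ (fun hb' => Exec.setReal ?_) fun hb' => ?_)
        fun hb => ?_ <;>
      simp only [Test.holds, NatExp.eval, e8, e10, e24, hi₂, not_le] at hb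
      · simp only [Test.holds, NatExp.eval, RealExp.eval, e8, e10, e24, e20, e1, hi₂, hI₂] at hb'
        simp [NatExp.eval, RealExp.eval, e8, e10, e24, e20, e1, hi₂, clamp, hb, hb']
      · simp only [Test.holds, NatExp.eval, RealExp.eval, e8, e10, e24, e20, e1, hi₂, hI₂,
          not_le] at hb'
        simp [clamp, hb, hb'.le, hI₂]
      · have : ¬ 1 ≤ s.nat 10 (s.nat 8 (s.nat 24 0 0) i) i := not_le.2 hb
        simp [clamp, this, hI₂]
    · intro s₂ h₂ hI₂
      refine Exec.block_cons hβ (Exec.setReal (Exec.block_nil ?_))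
      have e20 : s₂.nat 20 0 0 = j := by simp [h₂.nat 20 rfl, hj₁]
      have e2 : s₂.real 2 = s.real 2 := by simp [h₂.real 2 rfl, h₁.real 2 rfl]
      have e53 : s₂.real 53 = s₁.real 53 := by simp [h₂.real 53 rfl]
      simp [NatExp.eval, RealExp.eval, e20, e2, e53, hI, hI₂, rowCost, Finset.sum_range_succ]
  · intro s' h hI
    exact Exec.block_nil hI

theorem potentialProg_spec {β n k Z : ℕ} {s : Mem} (hβ : 1 ≤ β) (hn : s.nat 0 0 0 = n)
    (hk : s.nat 0 0 1 = k) (hZ : s.nat 7 0 0 = Z) (hnβ : n ≤ β) (hkβ : k ≤ β) (hZβ : Z ≤ β) :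
    Exec β potentialProg s fun s' => s'.real 54 0 0 =
      potential n k Z (s.real 1) (s.real 2) (s.real 51) (s.nat 8) (s.nat 10) := by
  refine Exec.block_cons hβ (Exec.setReal ?_)
  refine Exec.block_cons hβ (Exec.forLoop hβ hZβ (fun i s' => s'.real 54 0 0 =
      potential n k i (s.real 1) (s.real 2) (s.real 51) (s.nat 8) (s.nat 10))
      rfl ?_ ?_ ?_ ?_)
  · intro s' h; simp [NatExp.eval, h.nat 7 rfl, hZ]
  · simp [RealExp.eval, NatExp.eval, potential]
  · intro i hi s₁ h₁ hi₁ hI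
    refine Exec.block_cons hβ ((rowProg_spec hβ (by simp [h₁.nat 0 rfl, hn])
      (by simp [h₁.nat 0 rfl, hk]) hnβ hkβ).mono fun s₂ h₂ hI₂ => ?_)
    refine Exec.block_cons hβ (Exec.setReal (Exec.block_nil ?_))
    simp only [hi₁, h₁.real 1 rfl, h₁.real 2 rfl, h₁.real 51 rfl, h₁.nat 10 rfl, h₁.nat 8 rfl,
      NatExp.eval] at hI₂
    simp [NatExp.eval, RealExp.eval, h₂.real 54 rfl, hI, hI₂, potential, Finset.sum_range_succ]
  · intro s' h hI
    exact Exec.block_nil hI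

/-! ### The greedy choice of a table -/

theorem le_clamp_iff {x y : ℝ} {δ : ℕ → ℝ} {tab : ℕ → ℕ → ℕ} {τ : ℕ → ℕ} {k : ℕ} :
    y ≤ clamp x δ tab τ k ↔
      y ≤ x ∧ ∀ i < k, 1 ≤ tab (τ i) i → y ≤ δ (tab (τ i) i - 1) := by
  induction k with
  | zero => simp [clamp]
  | succ k ih =>
    rw [Nat.forall_lt_succ_right, ← and_assoc, ← ih, clamp]
    split_ifs with h
    · rw [le_min_iff]; tauto
    · tauto

theorem clamp_congr {x : ℝ} {δ : ℕ → ℝ} {tab tab' : ℕ → ℕ → ℕ} {τ τ' : ℕ → ℕ} {k : ℕ}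
    (h : ∀ i < k, tab (τ i) i = tab' (τ' i) i) :
    clamp x δ tab τ k = clamp x δ tab' τ' k := by
  induction k with
  | zero => rfl
  | succ k ih =>
    rw [clamp, clamp, ih fun i hi => h i (hi.trans (Nat.lt_succ_self k)), h k (Nat.lt_succ_self k)]

/-- The table `tab` with the entry in row `t` and column `i` replaced by `x`. -/
def setEntry (tab : ℕ → ℕ → ℕ) (t i x : ℕ) : ℕ → ℕ → ℕ :=
  fun t' i' => if t' = t ∧ i' = i then x else tab t' i'

theorem clamp_setEntry_of_ne {x : ℝ} {δ : ℕ → ℝ} {tab : ℕ → ℕ → ℕ} {τ : ℕ → ℕ} {k t i y : ℕ}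
    (h : τ i ≠ t) : clamp x δ (setEntry tab t i y) τ k = clamp x δ tab τ k := by
  refine clamp_congr fun i' _ => ?_
  rw [setEntry, if_neg]
  rintro ⟨h', rfl⟩
  exact h h'

theorem clamp_setEntry_of_eq {x : ℝ} {δ : ℕ → ℝ} {tab : ℕ → ℕ → ℕ} {τ : ℕ → ℕ} {k t i f : ℕ}
    (hi : i < k) (h : τ i = t) (h₀ : tab t i = 0) :
    clamp x δ (setEntry tab t i (f + 1)) τ k = min (clamp x δ tab τ k) (δ f) := by
  refine eq_of_forall_le_iff fun y => ?_
  rw [le_min_iff, le_clamp_iff, le_clamp_iff, and_assoc]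
  refine and_congr_right fun _ => ⟨fun H => ⟨fun i' hi' h₁ => ?_, ?_⟩, fun H i' hi' h₁ => ?_⟩
  · have hne : ¬ (τ i' = t ∧ i' = i) := by
      rintro ⟨h', rfl⟩
      rw [h', h₀] at h₁
      omega
    have := H i' hi'
    rw [setEntry, if_neg hne] at this
    exact this h₁
  · have := H i hi
    simpa [setEntry, h] using this
  · by_cases hne : τ i' = t ∧ i' = i
    · rw [setEntry, if_pos hne]
      simpa using H.2
    · rw [setEntry, if_neg hne] at h₁ ⊢
      exact H.1 i' hi' h₁

/-- Deciding further entries lowers the cost, also when the choice `τ i = t` of an entry that was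
undecided before is given up. -/
theorem clamp_setEntry_le {x : ℝ} {δ : ℕ → ℝ} {tab : ℕ → ℕ → ℕ} {τ τ' : ℕ → ℕ} {k t i y : ℕ}
    (h : ∀ i' < k, i' ≠ i → τ' i' = τ i') (h' : τ' i = τ i ∨ τ' i = t) (h₀ : tab t i = 0) :
    clamp x δ (setEntry tab t i y) τ k ≤ clamp x δ tab τ' k := by
  have H := (le_clamp_iff (x := x) (δ := δ) (tab := setEntry tab t i y) (τ := τ) (k := k)).1 le_rfl
  refine le_clamp_iff.2 ⟨H.1, fun i' hi' h₁ => ?_⟩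
  have hne : ¬ (τ' i' = t ∧ i' = i) := by
    rintro ⟨ht, rfl⟩
    rw [ht, h₀] at h₁
    omega
  have hτ : τ' i' = τ i' := by
    by_cases hi : i' = i
    · subst hi
      rcases h' with h' | h'
      · exact h'
      · exact absurd ⟨h', rfl⟩ hne
    · exact h i' hi' hi
  have := H.2 i' hi'
  rw [setEntry, ← hτ, if_neg hne] at this
  exact this h₁

/-- The digits of the number `N` in base `B`. -/
def digit (B N i : ℕ) : ℕ := N / B ^ i % B

theorem digit_lt {B : ℕ} (hB : 0 < B) (N i : ℕ) : digit B N i < B := Nat.mod_lt _ hB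

/-- A choice function `Fin K → Fin B` as a function on all natural numbers. -/
def extend {K B : ℕ} (τ : Fin K → Fin B) (i : ℕ) : ℕ := if h : i < K then (τ ⟨i, h⟩ : ℕ) else 0

/-- Summing over the numbers below `B ^ K` amounts to summing over all digit vectors of length `K`. -/
theorem sum_digit {K B : ℕ} (g : (ℕ → ℕ) → ℝ)
    (hg : ∀ τ τ' : ℕ → ℕ, (∀ i < K, τ i = τ' i) → g τ = g τ') :
    ∑ N ∈ Finset.range (B ^ K), g (digit B N) = ∑ τ : Fin K → Fin B, g (extend τ) := by
  rw [Finset.sum_range, ← finFunctionFinEquiv.symm.sum_comp]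
  refine Finset.sum_congr rfl fun N _ => hg _ _ fun i hi => ?_
  simp [digit, extend, hi, finFunctionFinEquiv]

/-- Averaging over all choice functions after resetting the choice in column `i` to `t` is the same
as averaging over the choice functions with value `t` in column `i`. -/
theorem sum_update {K B : ℕ} (i : Fin K) (t : Fin B) (g : (Fin K → Fin B) → ℝ) :
    ∑ τ, g (Function.update τ i t) = B * ∑ τ, if τ i = t then g τ else 0 := by
  classical
  rw [← (Equiv.funSplitAt i (Fin B)).symm.sum_comp, ← (Equiv.funSplitAt i (Fin B)).symm.sum_comp,
    Fintype.sum_prod_type, Fintype.sum_prod_type]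
  have h₁ : ∀ (c : Fin B) (ρ : {j // j ≠ i} → Fin B),
      Function.update ((Equiv.funSplitAt i (Fin B)).symm (c, ρ)) i t =
        (Equiv.funSplitAt i (Fin B)).symm (t, ρ) := by
    intro c ρ
    funext j
    by_cases hj : j = i
    · subst hj; simp [Equiv.funSplitAt, Equiv.piSplitAt]
    · simp [Equiv.funSplitAt, Equiv.piSplitAt, hj]
  have h₂ : ∀ (c : Fin B) (ρ : {j // j ≠ i} → Fin B),
      (Equiv.funSplitAt i (Fin B)).symm (c, ρ) i = c := by
    intro c ρ; simp [Equiv.funSplitAt, Equiv.piSplitAt]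
  simp only [h₁, h₂]
  rw [Finset.sum_const, Finset.card_univ, Fintype.card_fin, nsmul_eq_mul]
  congr 1
  rw [Finset.sum_comm]
  simp

section Potential

variable {n k K B : ℕ} {d w b : ℕ → ℕ → ℝ} {D : ℕ → ℕ → ℕ}

theorem potential_eq_sum (hkK : k ≤ K) (hD : ∀ N < B ^ K, ∀ i < K, D N i = digit B N i)
    (tab : ℕ → ℕ → ℕ) : potential n k (B ^ K) d w b D tab =
      ∑ τ : Fin K → Fin B, rowCost n k d w b tab (extend τ) := by
  rw [← sum_digit (rowCost n k d w b tab)]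
  · refine Finset.sum_congr rfl fun N hN => ?_
    refine Finset.sum_congr rfl fun j _ => ?_
    rw [clamp_congr (tab' := tab) (τ' := digit B N) fun i hi => ?_]
    rw [hD N (Finset.mem_range.1 hN) i (hi.trans_le hkK)]
  · intro τ τ' h
    refine Finset.sum_congr rfl fun j _ => ?_
    rw [clamp_congr (tab' := tab) (τ' := τ') fun i hi => ?_]
    rw [h i (hi.trans_le hkK)]

/-- The total decrease of the cost that the facility `o` would still bring. -/
def residual (n k K B : ℕ) (d w b : ℕ → ℕ → ℝ) (tab : ℕ → ℕ → ℕ) (o : ℕ) : ℝ :=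
  ∑ τ : Fin K → Fin B, ∑ j ∈ Finset.range n,
    w j 0 * max 0 (clamp (b j 0) (d j) tab (extend τ) k - d j o)

theorem residual_setEntry_le (hw : ∀ j < n, 0 ≤ w j 0) {tab : ℕ → ℕ → ℕ} {t i x o : ℕ}
    (h₀ : tab t i = 0) :
    residual n k K B d w b (setEntry tab t i x) o ≤ residual n k K B d w b tab o := by
  refine Finset.sum_le_sum fun τ _ => Finset.sum_le_sum fun j hj => ?_
  refine mul_le_mul_of_nonneg_left ?_ (hw j (Finset.mem_range.1 hj))
  exact max_le_max le_rfl (sub_le_sub_right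
    (clamp_setEntry_le (fun _ _ _ => rfl) (Or.inl rfl) h₀) _)

/-- A greedy step lowers the potential by at least a fraction `1 / B` of what the facility `o`, an
admissible choice, would still bring after the step.  Indeed, putting `o` into row `t` and column
`i` helps the choice functions `τ` with `τ i = t`, and these see fewer decided entries
than all the others. -/
theorem residual_le_of_step (hB : 0 < B) (hkK : k ≤ K)
    (hD : ∀ N < B ^ K, ∀ i < K, D N i = digit B N i) (hw : ∀ j < n, 0 ≤ w j 0)
    {tab : ℕ → ℕ → ℕ} {t i f o : ℕ} (ht : t < B) (hi : i < k) (h₀ : tab t i = 0)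
    (hf : potential n k (B ^ K) d w b D (setEntry tab t i (f + 1)) ≤
      potential n k (B ^ K) d w b D (setEntry tab t i (o + 1))) :
    residual n k K B d w b (setEntry tab t i (f + 1)) o / B ≤
      potential n k (B ^ K) d w b D tab -
        potential n k (B ^ K) d w b D (setEntry tab t i (f + 1)) := by
  set i₀ : Fin K := ⟨i, hi.trans_le hkK⟩
  set t₀ : Fin B := ⟨t, ht⟩
  set g : (Fin K → Fin B) → ℝ := fun τ => ∑ j ∈ Finset.range n,
    w j 0 * max 0 (clamp (b j 0) (d j) tab (extend τ) k - d j o) with hg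
  have hext : ∀ τ : Fin K → Fin B, extend τ i = τ i₀ := by
    intro τ; simp [extend, i₀, hi.trans_le hkK]
  have h₁ : potential n k (B ^ K) d w b D tab -
      potential n k (B ^ K) d w b D (setEntry tab t i (o + 1)) =
      ∑ τ, if τ i₀ = t₀ then g τ else 0 := by
    rw [potential_eq_sum hkK hD, potential_eq_sum hkK hD, ← Finset.sum_sub_distrib]
    refine Finset.sum_congr rfl fun τ _ => ?_
    rw [rowCost, rowCost, ← Finset.sum_sub_distrib]
    split_ifs with h
    · refine Finset.sum_congr rfl fun j _ => ?_
      rw [clamp_setEntry_of_eq hi (by rw [hext, h]) h₀, ← mul_sub]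
      congr 1
      rcases le_total (clamp (b j 0) (d j) tab (extend τ) k) (d j o) with h' | h'
      · rw [min_eq_left h', max_eq_left (by linarith), sub_self]
      · rw [min_eq_right h', max_eq_right (by linarith)]
    · refine Finset.sum_eq_zero fun j _ => ?_
      rw [clamp_setEntry_of_ne (fun h' => h (Fin.ext (by rw [← hext, h']))), sub_self]
  have h₂ : residual n k K B d w b (setEntry tab t i (f + 1)) o ≤
      ∑ τ, g (Function.update τ i₀ t₀) := by
    refine Finset.sum_le_sum fun τ _ => Finset.sum_le_sum fun j hj => ?_
    refine mul_le_mul_of_nonneg_left ?_ (hw j (Finset.mem_range.1 hj))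
    refine max_le_max le_rfl (sub_le_sub_right (clamp_setEntry_le (fun i' hi' hne => ?_)
      (Or.inr ?_) h₀) _)
    · have : (⟨i', hi'.trans_le hkK⟩ : Fin K) ≠ i₀ := fun h => hne (congrArg Fin.val h)
      simp [extend, hi'.trans_le hkK, Function.update_of_ne this]
    · rw [hext]; simp [t₀]
  rw [sum_update, ← h₁] at h₂
  have hB' : (0 : ℝ) < B := by exact_mod_cast hB
  rw [div_le_iff₀' hB']
  refine h₂.trans (mul_le_mul_of_nonneg_left ?_ hB'.le)
  linarith

/-- If every client `j` has a facility at distance at most `h j` among `o 0, …, o (k - 1)`, then these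
facilities together would lower the cost to at most `∑ w_j h_j`. -/
theorem potential_le_residual (hkK : k ≤ K)
    (hD : ∀ N < B ^ K, ∀ i < K, D N i = digit B N i) (hw : ∀ j < n, 0 ≤ w j 0)
    {tab : ℕ → ℕ → ℕ} {o : ℕ → ℕ} {h : ℕ → ℝ} (hh : ∀ j < n, ∃ i < k, d j (o i) ≤ h j) :
    potential n k (B ^ K) d w b D tab - (B ^ K : ℕ) * ∑ j ∈ Finset.range n, w j 0 * h j ≤
      ∑ i ∈ Finset.range k, residual n k K B d w b tab (o i) := by
  have hc : ((B ^ K : ℕ) : ℝ) * ∑ j ∈ Finset.range n, w j 0 * h j =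
      ∑ _τ : Fin K → Fin B, ∑ j ∈ Finset.range n, w j 0 * h j := by
    simp
  rw [potential_eq_sum hkK hD, hc, ← Finset.sum_sub_distrib]
  unfold residual
  rw [Finset.sum_comm]
  refine Finset.sum_le_sum fun τ _ => ?_
  rw [rowCost, ← Finset.sum_sub_distrib, Finset.sum_comm]
  refine Finset.sum_le_sum fun j hj => ?_
  have hwj := hw j (Finset.mem_range.1 hj)
  obtain ⟨i, hi, hij⟩ := hh j (Finset.mem_range.1 hj)
  rw [← mul_sub, ← Finset.mul_sum]
  refine mul_le_mul_of_nonneg_left ?_ hwj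
  calc clamp (b j 0) (d j) tab (extend τ) k - h j
      ≤ max 0 (clamp (b j 0) (d j) tab (extend τ) k - d j (o i)) :=
        le_max_of_le_right (by linarith)
    _ ≤ _ := Finset.single_le_sum
        (f := fun i => max 0 (clamp (b j 0) (d j) tab (extend τ) k - d j (o i)))
        (fun _ _ => le_max_left _ _) (Finset.mem_range.2 hi)

end Potential

/-- The facility `f` is admissible for column `i`: it lies in the ball with center `L i` and radius
`R i`.  The second index of `F`, `L` and `R` is a dummy. -/
def Admissible (n : ℕ) (F : ℕ → ℕ → ℕ) (d : ℕ → ℕ → ℝ) (L : ℕ → ℕ → ℕ) (R : ℕ → ℕ → ℝ)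
    (i f : ℕ) : Prop :=
  f < n ∧ 1 ≤ F f 0 ∧ d f (L i 0) ≤ R i 0

/-- Puts into the entry of the table `10` given by the counters `23` (row) and `22` (column) an admissible
facility for which the potential is smallest; resets the flag `12` if there is none. -/
def stepProg : Prog := .block [
  .setNat 11 (.lit 0) (.lit 0) (.lit 0),
  .forLoop 25 nExp
    (.when (.and (.natLe (.lit 1) (.get 2 (natVar 25) (.lit 0)))
        (.realLe (.get 1 (natVar 25) (.get 16 (natVar 22) (.lit 0)))
          (.get 50 (natVar 22) (.lit 0))))
      (.block [
        .setNat 10 (natVar 23) (natVar 22) (.add (natVar 25) (.lit 1)),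
        potentialProg,
        .when (.not (.and (.natLe (.lit 1) (natVar 11)) (.realLe (realVar 55) (realVar 54))))
          (.block [
            .setReal 55 (.lit 0) (.lit 0) (realVar 54),
            .setNat 11 (.lit 0) (.lit 0) (.add (natVar 25) (.lit 1))])])),
  .setNat 10 (natVar 23) (natVar 22) (natVar 11),
  .when (.natLe (natVar 11) (.lit 0)) (.setNat 12 (.lit 0) (.lit 0) (.lit 0))]

theorem setEntry_setEntry (tab : ℕ → ℕ → ℕ) (t i x y : ℕ) :
    setEntry (setEntry tab t i x) t i y = setEntry tab t i y := by
  funext t' i'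
  simp only [setEntry]
  split_ifs <;> rfl

theorem setEntry_self (tab : ℕ → ℕ → ℕ) (t i : ℕ) : setEntry tab t i (tab t i) = tab := by
  funext t' i'
  simp only [setEntry]
  split_ifs with h
  · rw [h.1, h.2]
  · rfl

theorem Mem.setNat_nat_eq_setEntry (s : Mem) (a i j x : ℕ) :
    (s.setNat a i j x).nat a = setEntry (s.nat a) i j x := by
  rw [Mem.setNat_nat_self]; rfl

theorem stepProg_spec {β n k Z t i : ℕ} {s : Mem} (hβ : 1 ≤ β) (hn : s.nat 0 0 0 = n)
    (hk : s.nat 0 0 1 = k) (hZ : s.nat 7 0 0 = Z) (hnβ : n ≤ β) (hkβ : k ≤ β) (hZβ : Z ≤ β)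
    (ht : s.nat 23 0 0 = t) (hi : s.nat 22 0 0 = i) :
    Exec β stepProg s fun s' =>
      ((∀ f, ¬ Admissible n (s.nat 2) (s.real 1) (s.nat 16) (s.real 50) i f) ∧
        s'.nat 10 = setEntry (s.nat 10) t i 0 ∧ s'.nat 12 0 0 = 0) ∨
      ∃ f, Admissible n (s.nat 2) (s.real 1) (s.nat 16) (s.real 50) i f ∧
        s'.nat 10 = setEntry (s.nat 10) t i (f + 1) ∧ s'.nat 12 0 0 = s.nat 12 0 0 ∧
        ∀ g, Admissible n (s.nat 2) (s.real 1) (s.nat 16) (s.real 50) i g →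
          potential n k Z (s.real 1) (s.real 2) (s.real 51) (s.nat 8)
              (setEntry (s.nat 10) t i (f + 1)) ≤
            potential n k Z (s.real 1) (s.real 2) (s.real 51) (s.nat 8)
              (setEntry (s.nat 10) t i (g + 1)) := by
  set adm := Admissible n (s.nat 2) (s.real 1) (s.nat 16) (s.real 50) i with hadm
  set pot : ℕ → ℝ := fun x => potential n k Z (s.real 1) (s.real 2) (s.real 51) (s.nat 8)
    (setEntry (s.nat 10) t i x) with hpot
  refine Exec.block_cons hβ (Exec.setNat ?_)
  refine Exec.block_cons hβ (Exec.forLoop hβ hnβ (fun c s' =>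
    (∃ x, s'.nat 10 = setEntry (s.nat 10) t i x) ∧
    ((s'.nat 11 0 0 = 0 ∧ ∀ f < c, ¬ adm f) ∨
      ∃ f, adm f ∧ s'.nat 11 0 0 = f + 1 ∧ s'.real 55 0 0 = pot (f + 1) ∧
        ∀ g < c, adm g → pot (f + 1) ≤ pot (g + 1))) rfl ?_ ?_ ?_ ?_)
  · intro s' h; simp [NatExp.eval, h.nat 0 rfl, hn]
  · exact ⟨⟨s.nat 10 t i, by simp [setEntry_self]⟩, Or.inl (by simp [NatExp.eval])⟩
  · intro c hc s₁ h₁ hc₁ hI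
    obtain ⟨⟨x, hx⟩, hI⟩ := hI
    have e22 : s₁.nat 22 0 0 = i := by simp [h₁.nat 22 rfl, hi]
    have e23 : s₁.nat 23 0 0 = t := by simp [h₁.nat 23 rfl, ht]
    have hb : (Test.and (.natLe (.lit 1) (.get 2 (natVar 25) (.lit 0)))
        (.realLe (.get 1 (natVar 25) (.get 16 (natVar 22) (.lit 0)))
          (.get 50 (natVar 22) (.lit 0)))).holds s₁ ↔ adm c := by
      simp [Test.holds, NatExp.eval, RealExp.eval, hc₁, e22, h₁.nat 2 rfl, h₁.nat 16 rfl,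
        h₁.real 1 rfl, h₁.real 50 rfl, hadm, Admissible, hc]
    refine Exec.when hβ (fun hb₁ => ?_) (fun hb₁ => ?_) <;> rw [hb] at hb₁
    · refine Exec.block_cons hβ (Exec.setNat (Exec.block_cons hβ
        ((potentialProg_spec (n := n) (k := k) (Z := Z) hβ (by simp [h₁.nat 0 rfl, hn])
          (by simp [h₁.nat 0 rfl, hk]) (by simp [h₁.nat 7 rfl, hZ]) hnβ hkβ hZβ).mono ?_)))
      intro s₂ h₂ hI₂
      have e54 : s₂.real 54 0 0 = pot (c + 1) := by
        rw [hI₂, Mem.setNat_nat_eq_setEntry]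
        simp [NatExp.eval, e22, e23, hc₁, h₁.nat 8 rfl, h₁.real 1 rfl, h₁.real 2 rfl,
          h₁.real 51 rfl, hx, hpot, setEntry_setEntry]
      have e10 : s₂.nat 10 = setEntry (s.nat 10) t i (c + 1) := by
        rw [h₂.nat 10 rfl, Mem.setNat_nat_eq_setEntry]
        simp [NatExp.eval, e22, e23, hc₁, hx, setEntry_setEntry]
      have e11 : s₂.nat 11 0 0 = s₁.nat 11 0 0 := by simp [h₂.nat 11 rfl]
      have e55 : s₂.real 55 0 0 = s₁.real 55 0 0 := by simp [h₂.real 55 rfl]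
      have e25 : s₂.nat 25 0 0 = c := by simp [h₂.nat 25 rfl, hc₁]
      refine Exec.block_cons hβ (Exec.when hβ (fun hb₂ => ?_) (fun hb₂ => ?_))
      · refine Exec.block_cons hβ (Exec.setReal (Exec.block_cons hβ (Exec.setNat
          (Exec.block_nil (Exec.block_nil ⟨⟨c + 1, by simp [e10]⟩, Or.inr ⟨c, hb₁, ?_, ?_, ?_⟩⟩)))))
        · simp [NatExp.eval, e25]
        · simp [NatExp.eval, RealExp.eval, e54]
        · intro g hg hg'
          rcases Nat.lt_succ_iff_lt_or_eq.1 hg with hg | rfl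
          · rcases hI with ⟨_, hI⟩ | ⟨f, hf, hf₁, hf₂, hf₃⟩
            · exact absurd hg' (hI g hg)
            · refine le_trans ?_ (hf₃ g hg hg')
              simp only [Test.holds, NatExp.eval, RealExp.eval, e54, e11, e55, hf₁, hf₂,
                not_and, not_le] at hb₂
              exact (hb₂ (by omega)).le
          · exact le_rfl
      · refine Exec.block_nil ⟨⟨c + 1, by simp [e10]⟩, Or.inr ?_⟩
        simp only [Test.holds, NatExp.eval, RealExp.eval, e54, e11, e55, not_not] at hb₂
        rcases hI with ⟨hI, _⟩ | ⟨f, hf, hf₁, hf₂, hf₃⟩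
        · omega
        · refine ⟨f, hf, by simp [e11, hf₁], by simp [e55, hf₂], fun g hg hg' => ?_⟩
          rcases Nat.lt_succ_iff_lt_or_eq.1 hg with hg | rfl
          · exact hf₃ g hg hg'
          · rw [← hf₂]; exact hb₂.2
    · refine ⟨⟨x, by simp [hx]⟩, ?_⟩
      rcases hI with ⟨hI, hI'⟩ | ⟨f, hf, hf₁, hf₂, hf₃⟩
      · refine Or.inl ⟨by simp [hI], fun f hf => ?_⟩
        rcases Nat.lt_succ_iff_lt_or_eq.1 hf with hf | rfl
        · exact hI' f hf
        · exact hb₁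
      · refine Or.inr ⟨f, hf, by simp [hf₁], by simp [hf₂], fun g hg hg' => ?_⟩
        rcases Nat.lt_succ_iff_lt_or_eq.1 hg with hg | rfl
        · exact hf₃ g hg hg'
        · exact absurd hg' hb₁
  · intro s₁ h₁ hI
    obtain ⟨⟨x, hx⟩, hI⟩ := hI
    have e22 : s₁.nat 22 0 0 = i := by simp [h₁.nat 22 rfl, hi]
    have e23 : s₁.nat 23 0 0 = t := by simp [h₁.nat 23 rfl, ht]
    have e12 : s₁.nat 12 0 0 = s.nat 12 0 0 := by simp [h₁.nat 12 rfl]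
    refine Exec.block_cons hβ (Exec.setNat (Exec.block_cons hβ (Exec.when hβ
      (fun hb => Exec.setNat (Exec.block_nil ?_)) (fun hb => Exec.block_nil ?_)))) <;>
    rcases hI with ⟨hI, hI'⟩ | ⟨f, hf, hf₁, hf₂, hf₃⟩
    · refine Or.inl ⟨fun f hf => hI' f hf.1 hf, ?_, ?_⟩
      · rw [Mem.setNat_nat_of_ne _ _ _ _ (by decide), Mem.setNat_nat_eq_setEntry]
        simp [NatExp.eval, e22, e23, hx, setEntry_setEntry, hI]
      · simp [NatExp.eval]
    · simp [Test.holds, NatExp.eval, hf₁] at hb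
    · simp [Test.holds, NatExp.eval, hI] at hb
    · refine Or.inr ⟨f, hf, ?_, ?_, fun g hg => hf₃ g hg.1 hg⟩
      · rw [Mem.setNat_nat_eq_setEntry]
        simp [NatExp.eval, e22, e23, hx, setEntry_setEntry, hf₁]
      · simp [e12]

/-- The invariant of the greedy procedure when the entries before row `t` and column `i` are decided.
The flag `ok` is `1` as long as every column considered has had an admissible facility.  For every
choice `o` of admissible facilities that serves client `j` at distance `h j`, the potential `P` at
the beginning of round `t` satisfies the geometric bound, and the decrease during the round is at
least a fraction `1 / B` of what `o 0, …, o (i - 1)` would still bring. -/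
def GreedyInv (n k K B : ℕ) (d w b : ℕ → ℕ → ℝ) (D : ℕ → ℕ → ℕ) (adm : ℕ → ℕ → Prop) (t i : ℕ)
    (tab : ℕ → ℕ → ℕ) (ok : ℕ) : Prop :=
  (1 ≤ ok → ∀ t' < B, ∀ i' < k, (t' < t ∨ t' = t ∧ i' < i) →
    ∃ f, adm i' f ∧ tab t' i' = f + 1) ∧
  (∀ t' < B, ∀ i' < k, ¬ (t' < t ∨ t' = t ∧ i' < i) → tab t' i' = 0) ∧
  ∀ (o : ℕ → ℕ) (h : ℕ → ℝ), (∀ i' < k, adm i' (o i')) →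
    (∀ j < n, ∃ i' < k, d j (o i') ≤ h j) →
    ok = 1 ∧ ∃ P : ℝ,
      (1 + 1 / (B : ℝ)) ^ t * (P - (B ^ K : ℕ) * ∑ j ∈ Finset.range n, w j 0 * h j) ≤
        (B ^ K : ℕ) * (∑ j ∈ Finset.range n, w j 0 * b j 0 -
          ∑ j ∈ Finset.range n, w j 0 * h j) ∧
      (∑ i' ∈ Finset.range i, residual n k K B d w b tab (o i')) / B ≤
        P - potential n k (B ^ K) d w b D tab

section GreedyInv

variable {n k K B : ℕ} {d w b : ℕ → ℕ → ℝ} {D : ℕ → ℕ → ℕ} {adm : ℕ → ℕ → Prop}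
  {tab : ℕ → ℕ → ℕ} {ok t i : ℕ}

theorem potential_of_undecided (hB : 0 < B) (hkK : k ≤ K)
    (hD : ∀ N < B ^ K, ∀ i < K, D N i = digit B N i) (h₀ : ∀ t < B, ∀ i < k, tab t i = 0) :
    potential n k (B ^ K) d w b D tab =
      (B ^ K : ℕ) * ∑ j ∈ Finset.range n, w j 0 * b j 0 := by
  rw [potential, Finset.sum_congr rfl fun N hN => ?_, Finset.sum_const, Finset.card_range,
    nsmul_eq_mul]
  refine Finset.sum_congr rfl fun j _ => ?_
  congr 1
  refine eq_of_forall_le_iff fun y => le_clamp_iff.trans (and_iff_left fun i hi h => ?_)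
  rw [hD N (Finset.mem_range.1 hN) i (hi.trans_le hkK), h₀ _ (digit_lt hB N i) i hi] at h
  omega

theorem GreedyInv.init (hB : 0 < B) (hkK : k ≤ K)
    (hD : ∀ N < B ^ K, ∀ i < K, D N i = digit B N i) (h₀ : ∀ t < B, ∀ i < k, tab t i = 0) :
    GreedyInv n k K B d w b D adm 0 0 tab 1 := by
  refine ⟨fun _ t' _ i' _ h => by omega, fun t' ht' i' hi' _ => h₀ t' ht' i' hi',
    fun o h _ _ => ⟨rfl, potential n k (B ^ K) d w b D tab, ?_, by simp⟩⟩
  rw [potential_of_undecided hB hkK hD h₀, pow_zero, one_mul, mul_sub]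

theorem GreedyInv.step (hB : 0 < B) (hkK : k ≤ K)
    (hD : ∀ N < B ^ K, ∀ i < K, D N i = digit B N i) (hw : ∀ j < n, 0 ≤ w j 0)
    (ht : t < B) (hi : i < k) (hI : GreedyInv n k K B d w b D adm t i tab ok) {f : ℕ}
    (hf : adm i f) (hmin : ∀ g, adm i g → potential n k (B ^ K) d w b D (setEntry tab t i (f + 1)) ≤
      potential n k (B ^ K) d w b D (setEntry tab t i (g + 1))) :
    GreedyInv n k K B d w b D adm t (i + 1) (setEntry tab t i (f + 1)) ok := by
  obtain ⟨h₁, h₂, h₃⟩ := hI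
  have h₀ : tab t i = 0 := h₂ t ht i hi (by omega)
  refine ⟨fun hok t' ht' i' hi' hlt => ?_, fun t' ht' i' hi' hlt => ?_, fun o h ho hh => ?_⟩
  · by_cases he : t' = t ∧ i' = i
    · exact ⟨f, by rw [he.2]; exact hf, by rw [setEntry, if_pos he]⟩
    · rw [setEntry, if_neg he]
      exact h₁ hok t' ht' i' hi' (by omega)
  · rw [setEntry, if_neg (by omega)]
    exact h₂ t' ht' i' hi' (by omega)
  · obtain ⟨hok, P, hP, hP'⟩ := h₃ o h ho hh
    refine ⟨hok, P, hP, ?_⟩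
    have hB' : (0 : ℝ) < B := by exact_mod_cast hB
    have hs := residual_le_of_step (b := b) (d := d) hB hkK hD hw ht hi h₀ (hmin (o i) (ho i hi))
    have hmono : (∑ i' ∈ Finset.range i,
        residual n k K B d w b (setEntry tab t i (f + 1)) (o i')) / B ≤
        (∑ i' ∈ Finset.range i, residual n k K B d w b tab (o i')) / B := by
      gcongr
      exact residual_setEntry_le hw h₀
    rw [Finset.sum_range_succ, add_div]
    linarith

theorem GreedyInv.fail (hi : i < k) (hI : GreedyInv n k K B d w b D adm t i tab ok)
    (hf : ∀ f, ¬ adm i f) :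
    GreedyInv n k K B d w b D adm t (i + 1) (setEntry tab t i 0) 0 := by
  refine ⟨fun hok => by omega, fun t' ht' i' hi' hlt => ?_,
    fun o h ho _ => absurd (ho i hi) (hf _)⟩
  rw [setEntry]
  split_ifs with he
  · rfl
  · exact hI.2.1 t' ht' i' hi' (by omega)

/-- In one round the distance of the potential to its goal shrinks by the factor `1 + 1 / B`. -/
theorem GreedyInv.next (hB : 0 < B) (hkK : k ≤ K)
    (hD : ∀ N < B ^ K, ∀ i < K, D N i = digit B N i) (hw : ∀ j < n, 0 ≤ w j 0)
    (hI : GreedyInv n k K B d w b D adm t k tab ok) :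
    GreedyInv n k K B d w b D adm (t + 1) 0 tab ok := by
  obtain ⟨h₁, h₂, h₃⟩ := hI
  refine ⟨fun hok t' ht' i' hi' hlt => h₁ hok t' ht' i' hi' (by omega),
    fun t' ht' i' hi' hlt => h₂ t' ht' i' hi' (by omega), fun o h ho hh => ?_⟩
  obtain ⟨hok, P, hP, hP'⟩ := h₃ o h ho hh
  refine ⟨hok, potential n k (B ^ K) d w b D tab, ?_, by simp⟩
  have hB' : (0 : ℝ) < B := by exact_mod_cast hB
  have hr := potential_le_residual (b := b) (tab := tab) hkK hD hw hh
  have hr' := (div_le_div_of_nonneg_right hr hB'.le).trans hP'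
  refine le_trans ?_ hP
  rw [pow_succ, mul_assoc]
  refine mul_le_mul_of_nonneg_left ?_ (by positivity)
  rw [add_mul, one_mul, one_div, inv_mul_eq_div]
  linarith

theorem GreedyInv.final (hI : GreedyInv n k K B d w b D adm B 0 tab ok) :
    (1 ≤ ok → ∀ t < B, ∀ i < k, ∃ f, adm i f ∧ tab t i = f + 1) ∧
    ∀ (o : ℕ → ℕ) (h : ℕ → ℝ), (∀ i < k, adm i (o i)) →
      (∀ j < n, ∃ i < k, d j (o i) ≤ h j) → ok = 1 ∧
      (1 + 1 / (B : ℝ)) ^ B * (potential n k (B ^ K) d w b D tab -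
        (B ^ K : ℕ) * ∑ j ∈ Finset.range n, w j 0 * h j) ≤
      (B ^ K : ℕ) * (∑ j ∈ Finset.range n, w j 0 * b j 0 -
          ∑ j ∈ Finset.range n, w j 0 * h j) := by
  refine ⟨fun hok t ht i hi => hI.1 hok t ht i hi (Or.inl ht), fun o h ho hh => ?_⟩
  obtain ⟨hok, P, hP, hP'⟩ := hI.2.2 o h ho hh
  refine ⟨hok, le_trans (mul_le_mul_of_nonneg_left ?_ (by positivity)) hP⟩
  simp only [Finset.range_zero, Finset.sum_empty, zero_div, sub_nonneg] at hP'
  linarith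

end GreedyInv

/-- Marks all entries of the table `10` as undecided and sets the flag `12`. -/
def clearProg : Prog := .block [
  .setNat 12 (.lit 0) (.lit 0) (.lit 1),
  .forLoop 23 (natVar 6) (.forLoop 22 kExp (.setNat 10 (natVar 23) (natVar 22) (.lit 0)))]

/-- Fills the table `10` greedily, row by row. -/
def greedyProg : Prog := .forLoop 23 (natVar 6) (.forLoop 22 kExp stepProg)

theorem clearProg_spec {β k B : ℕ} {s : Mem} (hβ : 1 ≤ β) (hk : s.nat 0 0 1 = k)
    (hB : s.nat 6 0 0 = B) (hkβ : k ≤ β) (hBβ : B ≤ β) :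
    Exec β clearProg s fun s' => s'.nat 12 0 0 = 1 ∧ ∀ t < B, ∀ i < k, s'.nat 10 t i = 0 := by
  refine Exec.block_cons hβ (Exec.setNat (Exec.block_cons hβ (Exec.forLoop hβ hBβ
    (fun c s' => ∀ t < c, ∀ i < k, s'.nat 10 t i = 0) rfl ?_ ?_ ?_ ?_)))
  · intro s' h; simp [NatExp.eval, h.nat 6 rfl, hB]
  · simp
  · intro t ht s₁ h₁ ht₁ hI
    refine Exec.forLoop hβ hkβ (fun c s' => (∀ t' < t, ∀ i < k, s'.nat 10 t' i = 0) ∧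
      ∀ i < c, s'.nat 10 t i = 0) rfl ?_ ?_ ?_ ?_
    · intro s' h; simp [NatExp.eval, h.nat 0 rfl, h₁.nat 0 rfl, hk]
    · simpa using hI
    · intro i hi s₂ h₂ hi₂ hI₂
      have e23 : s₂.nat 23 0 0 = t := by simp [h₂.nat 23 rfl, ht₁]
      refine Exec.setNat ⟨fun t' ht' i' hi' => ?_, fun i' hi' => ?_⟩
      · simp [NatExp.eval, hI₂.1 t' ht' i' hi']
      · rcases Nat.lt_succ_iff_lt_or_eq.1 hi' with h | h
        · simp [NatExp.eval, hI₂.2 i' h]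
        · simp [NatExp.eval, e23, hi₂, h]
    · intro s₂ h₂ hI₂ t' ht' i' hi'
      rw [Mem.setNat_nat_of_ne _ _ _ _ (by decide)]
      rcases Nat.lt_succ_iff_lt_or_eq.1 ht' with h | rfl
      · exact hI₂.1 t' h i' hi'
      · exact hI₂.2 i' hi'
  · intro s₁ h₁ hI
    refine Exec.block_nil ⟨?_, hI⟩
    simp [h₁.nat 12 rfl, NatExp.eval]

theorem greedyProg_spec {β n k K B : ℕ} {s : Mem} (hβ : 1 ≤ β) (hn : s.nat 0 0 0 = n)
    (hk : s.nat 0 0 1 = k) (hB : s.nat 6 0 0 = B) (hZ : s.nat 7 0 0 = B ^ K)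
    (hnβ : n ≤ β) (hkβ : k ≤ β) (hBβ : B ≤ β) (hZβ : B ^ K ≤ β) (hB₀ : 0 < B) (hkK : k ≤ K)
    (hD : ∀ N < B ^ K, ∀ i < K, s.nat 8 N i = digit B N i) (hw : ∀ j < n, 0 ≤ s.real 2 j 0)
    (hok : s.nat 12 0 0 = 1) (htab : ∀ t < B, ∀ i < k, s.nat 10 t i = 0) :
    Exec β greedyProg s fun s' => GreedyInv n k K B (s.real 1) (s.real 2) (s.real 51) (s.nat 8)
      (Admissible n (s.nat 2) (s.real 1) (s.nat 16) (s.real 50)) B 0 (s'.nat 10)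
      (s'.nat 12 0 0) := by
  refine Exec.forLoop hβ hBβ (fun t s' => GreedyInv n k K B (s.real 1) (s.real 2) (s.real 51)
    (s.nat 8) (Admissible n (s.nat 2) (s.real 1) (s.nat 16) (s.real 50)) t 0 (s'.nat 10)
      (s'.nat 12 0 0)) rfl ?_ ?_ ?_ fun _ _ h => h
  · intro s' h; simp [NatExp.eval, h.nat 6 rfl, hB]
  · simpa [hok] using GreedyInv.init hB₀ hkK hD htab
  · intro t ht s₁ h₁ ht₁ hI
    refine Exec.forLoop hβ hkβ (fun i s' => GreedyInv n k K B (s.real 1) (s.real 2) (s.real 51)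
      (s.nat 8) (Admissible n (s.nat 2) (s.real 1) (s.nat 16) (s.real 50)) t i (s'.nat 10)
      (s'.nat 12 0 0)) rfl ?_ ?_ ?_ ?_
    · intro s' h; simp [NatExp.eval, h.nat 0 rfl, h₁.nat 0 rfl, hk]
    · simpa using hI
    · intro i hi s₂ h₂ hi₂ hI₂
      refine (stepProg_spec (n := n) (k := k) (Z := B ^ K) (t := t) (i := i) hβ
        (by simp [h₂.nat 0 rfl, h₁.nat 0 rfl, hn]) (by simp [h₂.nat 0 rfl, h₁.nat 0 rfl, hk])
        (by simp [h₂.nat 7 rfl, h₁.nat 7 rfl, hZ]) hnβ hkβ hZβ (by simp [h₂.nat 23 rfl, ht₁])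
        hi₂).mono fun s₃ h₃ hI₃ => ?_
      have e : ∀ a, greedyProg.keeps a = true → s₂.nat a = s.nat a ∧ s₂.real a = s.real a := by
        intro a ha
        have h' : (Prog.forLoop 22 kExp stepProg).keeps a = true := by
          simp only [greedyProg, Prog.forLoop, Prog.keeps, Bool.and_eq_true] at ha ⊢
          exact ha.2.1
        exact ⟨(h₂.nat a h').trans (h₁.nat a ha), (h₂.real a h').trans (h₁.real a ha)⟩
      simp only [(e 2 rfl).1, (e 1 rfl).2, (e 16 rfl).1, (e 50 rfl).2, (e 2 rfl).2, (e 51 rfl).2,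
        (e 8 rfl).1] at hI₃
      rw [Mem.setNat_nat_of_ne _ _ _ _ (by decide : 10 ≠ 22),
        Mem.setNat_nat_of_ne _ _ _ _ (by decide : 12 ≠ 22)]
      rcases hI₃ with ⟨hf, h10, h12⟩ | ⟨f, hf, h10, h12, hmin⟩
      · rw [h10, h12]
        exact hI₂.fail hi hf
      · rw [h10, h12]
        exact hI₂.step hB₀ hkK hD hw ht hi hf hmin
    · intro s₂ h₂ hI₂
      simpa using hI₂.next hB₀ hkK hD hw

/-! ### Trying a guess and keeping the best solution -/

/-- The leaders that the row `G` of the table `D` encodes, for the list `cl` of clients. -/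
def guessLeader (cl D : ℕ → ℕ → ℕ) (G i : ℕ) : ℕ := cl (D G i) 0

/-- The radii that the row `G` of the table `D` encodes: multiples of `Q / (B w)`, where `w` is the weight
of a guessed client. -/
noncomputable def guessRadius (k B : ℕ) (w : ℕ → ℕ → ℝ) (Q : ℝ) (cl D : ℕ → ℕ → ℕ) (G i : ℕ) : ℝ :=
  ((D G (k + (k + i)) : ℝ) + 1) * Q / (B * w (cl (D G (k + i)) 0) 0)

/-- Decodes the guess in row `(28,0,0)` of the table `8`; the leaders go to `16`, the radii to
`50`. -/
def decodeProg : Prog := .forLoop 22 kExp (.block [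
  .setNat 16 (natVar 22) (.lit 0) (.get 4 (.get 8 (natVar 28) (natVar 22)) (.lit 0)),
  .setReal 50 (natVar 22) (.lit 0)
    (.div (.mul (.add (.ofNat (.get 8 (natVar 28) (.add kExp (.add kExp (natVar 22))))) (.lit 1))
        (realVar 57))
      (.mul (.ofNat (natVar 6))
        (.get 2 (.get 4 (.get 8 (natVar 28) (.add kExp (natVar 22))) (.lit 0)) (.lit 0))))])

/-- Stores in `51` the distance that every point pays at most. -/
def baseProg : Prog := .forLoop 20 nExp (.block [
  .setReal 51 (natVar 20) (.lit 0)
    (.add (.get 1 (natVar 20) (.get 16 (.lit 0) (.lit 0))) (.get 50 (.lit 0) (.lit 0))),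
  .forLoop 22 kExp
    (.when (.realLe
        (.add (.get 1 (natVar 20) (.get 16 (natVar 22) (.lit 0))) (.get 50 (natVar 22) (.lit 0)))
        (.get 51 (natVar 20) (.lit 0)))
      (.setReal 51 (natVar 20) (.lit 0)
        (.add (.get 1 (natVar 20) (.get 16 (natVar 22) (.lit 0)))
          (.get 50 (natVar 22) (.lit 0)))))])

/-- Compares the solutions in the rows of a complete table with the best solution known so far, which
is stored in `13`; its cost bound is stored in `56` and the flag `14` says whether there is
one. -/
def selectProg : Prog := .when (.natLe (.lit 1) (natVar 12)) (.forLoop 24 (natVar 7) (.block [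
  rowProg,
  .when (.not (.and (.natLe (.lit 1) (natVar 14)) (.realLe (realVar 56) (realVar 53))))
    (.block [
      .setNat 14 (.lit 0) (.lit 0) (.lit 1),
      .setReal 56 (.lit 0) (.lit 0) (realVar 53),
      .forLoop 22 kExp (.setNat 13 (natVar 22) (.lit 0)
        (.get 10 (.get 8 (natVar 24) (natVar 22)) (natVar 22)))])]))

/-- Runs the greedy procedure on one guess. -/
def tryProg : Prog := .block [decodeProg, baseProg, clearProg, greedyProg, selectProg]

/-- Tries all guesses of the scale `Q = w_j d(j, f)` and of the leaders and radii. -/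
def searchProg : Prog := .forLoop 26 nExp (.forLoop 27 nExp (.block [
  .setReal 57 (.lit 0) (.lit 0)
    (.mul (.get 2 (natVar 26) (.lit 0)) (.get 1 (natVar 26) (natVar 27))),
  .forLoop 28 (natVar 7) tryProg]))

theorem decodeProg_spec {β k B G : ℕ} {s : Mem} (hβ : 1 ≤ β) (hk : s.nat 0 0 1 = k)
    (hB : s.nat 6 0 0 = B) (hG : s.nat 28 0 0 = G) (hkβ : k ≤ β) :
    Exec β decodeProg s fun s' => ∀ i < k, s'.nat 16 i 0 = guessLeader (s.nat 4) (s.nat 8) G i ∧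
      s'.real 50 i 0 = guessRadius k B (s.real 2) (s.real 57 0 0) (s.nat 4) (s.nat 8) G i := by
  refine Exec.forLoop hβ hkβ (fun c s' => ∀ i < c,
    s'.nat 16 i 0 = guessLeader (s.nat 4) (s.nat 8) G i ∧
      s'.real 50 i 0 = guessRadius k B (s.real 2) (s.real 57 0 0) (s.nat 4) (s.nat 8) G i)
    rfl ?_ ?_ ?_ fun _ _ h => h
  · intro s' h; simp [NatExp.eval, h.nat 0 rfl, hk]
  · simp
  · intro i hi s₁ h₁ hi₁ hI
    refine Exec.block_cons hβ (Exec.setNat (Exec.block_cons hβ (Exec.setReal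
      (Exec.block_nil ?_))))
    intro i' hi'
    rcases Nat.lt_succ_iff_lt_or_eq.1 hi' with h | rfl
    · simp [NatExp.eval, hi₁, h.ne, hI i' h]
    · simp [NatExp.eval, RealExp.eval, hi₁, h₁.nat 4 rfl, h₁.nat 8 rfl, h₁.nat 28 rfl, hG,
        h₁.nat 0 rfl, hk, h₁.nat 6 rfl, hB, h₁.real 2 rfl, h₁.real 57 rfl, guessLeader, guessRadius]

theorem baseProg_spec {β n k : ℕ} {s : Mem} (hβ : 1 ≤ β) (hn : s.nat 0 0 0 = n)
    (hk : s.nat 0 0 1 = k) (hnβ : n ≤ β) (hkβ : k ≤ β) (hk₀ : 0 < k) :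
    Exec β baseProg s fun s' => ∀ j < n,
      (∀ i < k, s'.real 51 j 0 ≤ s.real 1 j (s.nat 16 i 0) + s.real 50 i 0) ∧
      ∃ i < k, s'.real 51 j 0 = s.real 1 j (s.nat 16 i 0) + s.real 50 i 0 := by
  refine Exec.forLoop hβ hnβ (fun c s' => ∀ j < c,
      (∀ i < k, s'.real 51 j 0 ≤ s.real 1 j (s.nat 16 i 0) + s.real 50 i 0) ∧
      ∃ i < k, s'.real 51 j 0 = s.real 1 j (s.nat 16 i 0) + s.real 50 i 0)
    rfl ?_ ?_ ?_ fun _ _ h => h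
  · intro s' h; simp [NatExp.eval, h.nat 0 rfl, hn]
  · simp
  · intro j hj s₁ h₁ hj₁ hI
    refine Exec.block_cons hβ (Exec.setReal (Exec.block_cons hβ (Exec.forLoop hβ hkβ
      (fun c s' => (∀ j' < j, s'.real 51 j' 0 = s₁.real 51 j' 0) ∧
        (∀ i < c, s'.real 51 j 0 ≤ s.real 1 j (s.nat 16 i 0) + s.real 50 i 0) ∧
        ∃ i < k, s'.real 51 j 0 = s.real 1 j (s.nat 16 i 0) + s.real 50 i 0)
      rfl ?_ ?_ ?_ ?_)))
    · intro s' h; simp [NatExp.eval, h.nat 0 rfl, h₁.nat 0 rfl, hk]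
    · refine ⟨fun j' hj' => ?_, by simp, 0, hk₀, ?_⟩
      · simp [NatExp.eval, hj₁, hj'.ne]
      · simp [NatExp.eval, RealExp.eval, hj₁, h₁.real 1 rfl, h₁.real 50 rfl, h₁.nat 16 rfl]
    · intro i hi s₂ h₂ hi₂ hI₂
      obtain ⟨hI₂, hI₃, i₀, hi₀, hI₄⟩ := hI₂
      have e20 : s₂.nat 20 0 0 = j := by simp [h₂.nat 20 rfl, hj₁]
      have e1 : s₂.real 1 = s.real 1 := by simp [h₂.real 1 rfl, h₁.real 1 rfl]
      have e50 : s₂.real 50 = s.real 50 := by simp [h₂.real 50 rfl, h₁.real 50 rfl]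
      have e16 : s₂.nat 16 = s.nat 16 := by simp [h₂.nat 16 rfl, h₁.nat 16 rfl]
      refine Exec.when hβ (fun hb => Exec.setReal ?_) (fun hb => ?_) <;>
      simp only [Test.holds, NatExp.eval, RealExp.eval, e20, e1, e50, e16, hi₂] at hb
      · refine ⟨fun j' hj' => ?_, fun i' hi' => ?_, i, hi, ?_⟩
        · simp [NatExp.eval, e20, hj'.ne, hI₂ j' hj']
        · rcases Nat.lt_succ_iff_lt_or_eq.1 hi' with h | rfl
          · simp only [Mem.setNat_real, NatExp.eval, RealExp.eval, e20, e1, e50, e16, hi₂,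
              Mem.setReal_real_self, and_self, if_true]
            exact hb.trans (hI₃ i' h)
          · simp [NatExp.eval, RealExp.eval, e20, e1, e50, e16, hi₂]
        · simp [NatExp.eval, RealExp.eval, e20, e1, e50, e16, hi₂]
      · refine ⟨hI₂, fun i' hi' => ?_, i₀, hi₀, hI₄⟩
        rcases Nat.lt_succ_iff_lt_or_eq.1 hi' with h | rfl
        · exact hI₃ i' h
        · exact (not_le.1 hb).le
    · intro s₂ h₂ hI₂
      refine Exec.block_nil fun j' hj' => ?_
      rcases Nat.lt_succ_iff_lt_or_eq.1 hj' with h | rfl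
      · simpa [hI₂.1 j' h] using hI j' h
      · simpa using hI₂.2

/-- The stored solution consists of facilities, and if there is one, its cost is at most the stored
value.  The cost is expressed by means of the lower bounds `c` for the distances. -/
def Sound (n k : ℕ) (F : ℕ → ℕ → ℕ) (d w : ℕ → ℕ → ℝ) (s : Mem) : Prop :=
  (∀ i < k, s.nat 13 i 0 = 0 ∨ ∃ f < n, 1 ≤ F f 0 ∧ s.nat 13 i 0 = f + 1) ∧
  (1 ≤ s.nat 14 0 0 → (∀ i < k, s.nat 13 i 0 ≠ 0) ∧
    ∀ c : ℕ → ℝ, (∀ j < n, ∀ i < k, c j ≤ d j (s.nat 13 i 0 - 1)) →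
      ∑ j ∈ Finset.range n, w j 0 * c j ≤ s.real 56 0 0)

/-- A solution of cost at most `x` is stored. -/
def Below (x : ℝ) (s : Mem) : Prop := 1 ≤ s.nat 14 0 0 ∧ s.real 56 0 0 ≤ x

theorem Sound.congr {n k : ℕ} {F : ℕ → ℕ → ℕ} {d w : ℕ → ℕ → ℝ} {s s' : Mem}
    (h : Sound n k F d w s) (h₁ : s'.nat 13 = s.nat 13) (h₂ : s'.nat 14 = s.nat 14)
    (h₃ : s'.real 56 = s.real 56) : Sound n k F d w s' := by
  unfold Sound at *
  rwa [h₁, h₂, h₃]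

theorem Below.congr {x : ℝ} {s s' : Mem} (h : Below x s) (h₂ : s'.nat 14 = s.nat 14)
    (h₃ : s'.real 56 = s.real 56) : Below x s' := by
  unfold Below at *
  rwa [h₂, h₃]

theorem selectProg_spec {β n k Z : ℕ} {F : ℕ → ℕ → ℕ} {s : Mem} (hβ : 1 ≤ β)
    (hn : s.nat 0 0 0 = n) (hk : s.nat 0 0 1 = k) (hZ : s.nat 7 0 0 = Z) (hnβ : n ≤ β)
    (hkβ : k ≤ β) (hZβ : Z ≤ β)
    (hrow : 1 ≤ s.nat 12 0 0 → ∀ N < Z,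
      (∀ i < k, ∃ f < n, 1 ≤ F f 0 ∧ s.nat 10 (s.nat 8 N i) i = f + 1) ∧
      ∀ c : ℕ → ℝ, (∀ j < n, ∀ i < k, c j ≤ s.real 1 j (s.nat 10 (s.nat 8 N i) i - 1)) →
        ∑ j ∈ Finset.range n, s.real 2 j 0 * c j ≤
          rowCost n k (s.real 1) (s.real 2) (s.real 51) (s.nat 10) (s.nat 8 N))
    (hs : Sound n k F (s.real 1) (s.real 2) s) :
    Exec β selectProg s fun s' => Sound n k F (s.real 1) (s.real 2) s' ∧
      (∀ x, Below x s → Below x s') ∧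
      (1 ≤ s.nat 12 0 0 → ∀ N < Z, Below
        (rowCost n k (s.real 1) (s.real 2) (s.real 51) (s.nat 10) (s.nat 8 N)) s') := by
  refine Exec.when hβ (fun hok => ?_) fun hok => ?_ <;> simp only [Test.holds, NatExp.eval] at hok
  swap
  · exact ⟨hs, fun _ h => h, fun h => absurd h hok⟩
  have hrow := hrow hok
  refine Exec.forLoop hβ hZβ (fun c s' => Sound n k F (s.real 1) (s.real 2) s' ∧
      (∀ x, Below x s → Below x s') ∧
      ∀ N < c, Below
        (rowCost n k (s.real 1) (s.real 2) (s.real 51) (s.nat 10) (s.nat 8 N)) s') rfl ?_ ?_ ?_ ?_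
  · intro s' h; simp [NatExp.eval, h.nat 7 rfl, hZ]
  · refine ⟨hs.congr ?_ ?_ ?_, fun x h => h.congr ?_ ?_, by simp⟩ <;> simp
  · intro N hN s₁ h₁ hN₁ hI
    obtain ⟨hI₁, hI₂, hI₃⟩ := hI
    refine Exec.block_cons hβ ((rowProg_spec (n := n) (k := k) hβ (by simp [h₁.nat 0 rfl, hn])
      (by simp [h₁.nat 0 rfl, hk]) hnβ hkβ).mono fun s₂ h₂ hc => ?_)
    simp only [h₁.real 1 rfl, h₁.real 2 rfl, h₁.real 51 rfl, h₁.nat 10 rfl, h₁.nat 8 rfl,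
      hN₁] at hc
    have e13 : s₂.nat 13 = s₁.nat 13 := h₂.nat 13 rfl
    have e14 : s₂.nat 14 = s₁.nat 14 := h₂.nat 14 rfl
    have e56 : s₂.real 56 = s₁.real 56 := h₂.real 56 rfl
    have e24 : s₂.nat 24 0 0 = N := by simp [h₂.nat 24 rfl, hN₁]
    have e8 : s₂.nat 8 = s.nat 8 := by simp [h₂.nat 8 rfl, h₁.nat 8 rfl]
    have e10 : s₂.nat 10 = s.nat 10 := by simp [h₂.nat 10 rfl, h₁.nat 10 rfl]
    have ek : s₂.nat 0 = s.nat 0 := by simp [h₂.nat 0 rfl, h₁.nat 0 rfl]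
    refine Exec.block_cons hβ (Exec.when hβ (fun hb => ?_) fun hb => ?_) <;>
    simp only [Test.holds, NatExp.eval, RealExp.eval, e14, e56, hc] at hb
    · refine Exec.block_cons hβ (Exec.setNat (Exec.block_cons hβ (Exec.setReal
        (Exec.block_cons hβ (Exec.forLoop hβ hkβ (fun c s' =>
          ∀ i < c, s'.nat 13 i 0 = s.nat 10 (s.nat 8 N i) i) rfl ?_ ?_ ?_ ?_)))))
      · intro s' h
        rw [NatExp.eval, h.nat 0 rfl]
        simp [NatExp.eval, ek, hk]
      · simp
      · intro i hi s₃ h₃ hi₃ hI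
        refine Exec.setNat fun i' hi' => ?_
        have e24' : s₃.nat 24 0 0 = N := by rw [h₃.nat 24 rfl]; simpa using e24
        have e8' : s₃.nat 8 = s.nat 8 := by rw [h₃.nat 8 rfl]; simpa using e8
        have e10' : s₃.nat 10 = s.nat 10 := by rw [h₃.nat 10 rfl]; simpa using e10
        rcases Nat.lt_succ_iff_lt_or_eq.1 hi' with h | rfl
        · simp [NatExp.eval, hi₃, h.ne, hI i' h]
        · simp [NatExp.eval, hi₃, e24', e8', e10']
      · intro s₃ h₃ hI
        have e14' : s₃.nat 14 0 0 = 1 := by rw [h₃.nat 14 rfl]; simp [NatExp.eval]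
        have e56' : s₃.real 56 0 0 =
            rowCost n k (s.real 1) (s.real 2) (s.real 51) (s.nat 10) (s.nat 8 N) := by
          rw [h₃.real 56 rfl]; simp [NatExp.eval, RealExp.eval, hc]
        have hlow : ∀ x, Below x s₁ → Below x s₃ := by
          intro x hx
          refine ⟨by rw [e14'], ?_⟩
          rw [e56']
          have : ¬ s₁.real 56 0 0 ≤
              rowCost n k (s.real 1) (s.real 2) (s.real 51) (s.nat 10) (s.nat 8 N) :=
            fun h => hb ⟨hx.1, h⟩
          exact (not_le.1 this).le.trans hx.2
        have hx : ∀ x, Below x s₃ → Below x (s₃.setNat 24 0 0 (N + 1)) := fun x h =>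
          h.congr (by simp) (by simp)
        refine Exec.block_nil (Exec.block_nil ⟨?_, fun x h => hx x (hlow x (hI₂ x h)),
          fun N' hN' => hx _ ?_⟩)
        · refine Sound.congr (s := s₃) ⟨fun i hi => ?_, fun _ => ⟨fun i hi => ?_, fun c hc => ?_⟩⟩
            (by simp) (by simp) (by simp)
          · rw [hI i hi]
            exact Or.inr ((hrow N hN).1 i hi)
          · rw [hI i hi]
            obtain ⟨f, _, _, hf⟩ := (hrow N hN).1 i hi
            omega
          · rw [e56']
            refine (hrow N hN).2 c fun j hj i hi => ?_
            rw [← hI i hi]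
            exact hc j hj i hi
        · rcases Nat.lt_succ_iff_lt_or_eq.1 hN' with h | rfl
          · exact hlow _ (hI₃ N' h)
          · exact ⟨by rw [e14'], by rw [e56']⟩
    · have hx : ∀ x, Below x s₁ → Below x (s₂.setNat 24 0 0 (N + 1)) := fun x h =>
        h.congr (by simp [e14]) (by simp [e56])
      refine Exec.block_nil ⟨hI₁.congr (by simp [e13]) (by simp [e14]) (by simp [e56]),
        fun x h => hx x (hI₂ x h), fun N' hN' => hx _ ?_⟩
      rcases Nat.lt_succ_iff_lt_or_eq.1 hN' with h | rfl
      · exact hI₃ N' h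
      · exact ⟨(not_not.1 hb).1, (not_not.1 hb).2⟩
  · intro s' h hI
    exact ⟨hI.1, hI.2.1, fun _ => hI.2.2⟩

/-- The memory during the search: the input, the list `4` of clients, the base `B` and the table `8` of
all digit vectors of length `K` are in place. -/
structure Ready (n k K B : ℕ) (s : Mem) : Prop where
  n_eq : s.nat 0 0 0 = n
  k_eq : s.nat 0 0 1 = k
  B_eq : s.nat 6 0 0 = B
  Z_eq : s.nat 7 0 0 = B ^ K
  k_pos : 0 < k
  B_pos : 0 < B
  k_le : k ≤ K
  table : ∀ N < B ^ K, ∀ i < K, s.nat 8 N i = digit B N i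
  weight_nonneg : ∀ j < n, 0 ≤ s.real 2 j 0
  triangle : ∀ j < n, ∀ f < n, ∀ l < n, s.real 1 j f ≤ s.real 1 j l + s.real 1 f l
  client_lt : ∀ x, s.nat 4 x 0 < n

theorem Ready.congr {n k K B : ℕ} {s s' : Mem} (h : Ready n k K B s)
    (h' : ∀ a ∈ [0, 1, 2, 4, 6, 7, 8], s'.nat a = s.nat a ∧ s'.real a = s.real a) :
    Ready n k K B s' := by
  have e0 := (h' 0 (by simp)).1
  have e6 := (h' 6 (by simp)).1
  have e7 := (h' 7 (by simp)).1
  have e8 := (h' 8 (by simp)).1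
  have e4 := (h' 4 (by simp)).1
  have r1 := (h' 1 (by simp)).2
  have r2 := (h' 2 (by simp)).2
  obtain ⟨h1, h2, h3, h4, h5, h6, h7, h8, h9, h10, h11⟩ := h
  constructor <;> first
    | assumption
    | simp only [e0, e6, e7, e8, e4, r1, r2]; assumption

theorem Ready.frame {n k K B : ℕ} {s s' : Mem} {p : Prog} (h : Ready n k K B s)
    (hF : Frame p s s') (hp : ([0, 1, 2, 4, 6, 7, 8].all fun a => p.keeps a) = true) :
    Ready n k K B s' :=
  h.congr fun a ha => hF a (List.all_eq_true.1 hp a ha)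

/-- The guess of leaders `L` and radii `R` leads to a solution of cost at most `x`: there are admissible
facilities `o` that serve client `j` at distance `h j`, and client `j` pays at most `u j`
at the beginning of the greedy procedure. -/
def Promising (n k B : ℕ) (F : ℕ → ℕ → ℕ) (d w : ℕ → ℕ → ℝ) (L : ℕ → ℕ) (R : ℕ → ℝ) (x : ℝ) :
    Prop :=
  ∃ (o : ℕ → ℕ) (h u : ℕ → ℝ), (∀ i < k, o i < n ∧ 1 ≤ F (o i) 0 ∧ d (o i) (L i) ≤ R i) ∧
    (∀ j < n, ∃ i < k, d j (o i) ≤ h j) ∧ (∀ j < n, ∃ i < k, d j (L i) + R i ≤ u j) ∧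
    ∑ j ∈ Finset.range n, w j 0 * h j +
      (∑ j ∈ Finset.range n, w j 0 * u j - ∑ j ∈ Finset.range n, w j 0 * h j) /
        (1 + 1 / (B : ℝ)) ^ B ≤ x

theorem tryProg_spec {β n k K B G : ℕ} {s : Mem} (hβ : 1 ≤ β) (hnβ : n ≤ β) (hkβ : k ≤ β)
    (hBβ : B ≤ β) (hZβ : B ^ K ≤ β) (hr : Ready n k K B s) (hG : s.nat 28 0 0 = G)
    (hs : Sound n k (s.nat 2) (s.real 1) (s.real 2) s) :
    Exec β tryProg s fun s' => Sound n k (s.nat 2) (s.real 1) (s.real 2) s' ∧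
      (∀ x, Below x s → Below x s') ∧
      ∀ x, Promising n k B (s.nat 2) (s.real 1) (s.real 2) (guessLeader (s.nat 4) (s.nat 8) G)
        (guessRadius k B (s.real 2) (s.real 57 0 0) (s.nat 4) (s.nat 8) G) x → Below x s' := by
  refine Exec.block_cons hβ ((decodeProg_spec (k := k) (B := B) (G := G) hβ hr.k_eq hr.B_eq hG
    hkβ).mono fun s₁ h₁ hdec => ?_)
  have hr₁ := hr.frame h₁ rfl
  refine Exec.block_cons hβ ((baseProg_spec (n := n) (k := k) hβ hr₁.n_eq hr₁.k_eq hnβ hkβ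
    hr.k_pos).mono fun s₂ h₂ hbase => ?_)
  have hr₂ := hr₁.frame h₂ rfl
  refine Exec.block_cons hβ ((clearProg_spec (k := k) (B := B) hβ hr₂.k_eq hr₂.B_eq hkβ
    hBβ).mono fun s₃ h₃ hclear => ?_)
  have hr₃ := hr₂.frame h₃ rfl
  refine Exec.block_cons hβ ((greedyProg_spec (n := n) (k := k) (K := K) (B := B) hβ hr₃.n_eq
    hr₃.k_eq hr₃.B_eq hr₃.Z_eq hnβ hkβ hBβ hZβ hr.B_pos hr.k_le hr₃.table hr₃.weight_nonneg
    hclear.1 hclear.2).mono fun s₄ h₄ hgreedy => ?_)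
  have hr₄ := hr₃.frame h₄ rfl
  have e2 : s₄.nat 2 = s.nat 2 := by
    rw [h₄.nat 2 rfl, h₃.nat 2 rfl, h₂.nat 2 rfl, h₁.nat 2 rfl]
  have e8 : s₄.nat 8 = s.nat 8 := by
    rw [h₄.nat 8 rfl, h₃.nat 8 rfl, h₂.nat 8 rfl, h₁.nat 8 rfl]
  have r1 : s₄.real 1 = s.real 1 := by
    rw [h₄.real 1 rfl, h₃.real 1 rfl, h₂.real 1 rfl, h₁.real 1 rfl]
  have r2 : s₄.real 2 = s.real 2 := by
    rw [h₄.real 2 rfl, h₃.real 2 rfl, h₂.real 2 rfl, h₁.real 2 rfl]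
  have e16 : s₄.nat 16 = s₁.nat 16 := by rw [h₄.nat 16 rfl, h₃.nat 16 rfl, h₂.nat 16 rfl]
  have r50 : s₄.real 50 = s₁.real 50 := by rw [h₄.real 50 rfl, h₃.real 50 rfl, h₂.real 50 rfl]
  have r51 : s₄.real 51 = s₂.real 51 := by rw [h₄.real 51 rfl, h₃.real 51 rfl]
  have e13 : s₄.nat 13 = s.nat 13 := by
    rw [h₄.nat 13 rfl, h₃.nat 13 rfl, h₂.nat 13 rfl, h₁.nat 13 rfl]
  have e14 : s₄.nat 14 = s.nat 14 := by
    rw [h₄.nat 14 rfl, h₃.nat 14 rfl, h₂.nat 14 rfl, h₁.nat 14 rfl]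
  have r56 : s₄.real 56 = s.real 56 := by
    rw [h₄.real 56 rfl, h₃.real 56 rfl, h₂.real 56 rfl, h₁.real 56 rfl]
  obtain ⟨hG₁, hG₂⟩ := hgreedy.final
  have r1' : s₁.real 1 = s.real 1 := h₁.real 1 rfl
  rw [← h₄.nat 2 rfl, ← h₄.real 1 rfl, ← h₄.nat 16 rfl, ← h₄.real 50 rfl, e2, r1, e16,
    r50] at hG₁ hG₂
  rw [← h₄.real 2 rfl, ← h₄.real 51 rfl, ← h₄.nat 8 rfl, r2, r51, e8] at hG₂
  rw [r1'] at hbase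
  have hrow : 1 ≤ s₄.nat 12 0 0 → ∀ N < B ^ K,
      (∀ i < k, ∃ f < n, 1 ≤ s.nat 2 f 0 ∧ s₄.nat 10 (s₄.nat 8 N i) i = f + 1) ∧
      ∀ c : ℕ → ℝ, (∀ j < n, ∀ i < k, c j ≤ s₄.real 1 j (s₄.nat 10 (s₄.nat 8 N i) i - 1)) →
        ∑ j ∈ Finset.range n, s₄.real 2 j 0 * c j ≤
          rowCost n k (s₄.real 1) (s₄.real 2) (s₄.real 51) (s₄.nat 10) (s₄.nat 8 N) := by
    intro h12 N hN
    have hlt : ∀ i < k, s.nat 8 N i < B := fun i hi => by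
      rw [hr.table N hN i (hi.trans_le hr.k_le)]
      exact digit_lt hr.B_pos N i
    rw [e8, r1, r2, r51]
    refine ⟨fun i hi => ?_, fun c hc => ?_⟩
    · obtain ⟨f, ⟨hf, hf', _⟩, h10⟩ := hG₁ h12 _ (hlt i hi) i hi
      exact ⟨f, hf, hf', h10⟩
    · refine Finset.sum_le_sum fun j hj => ?_
      have hj := Finset.mem_range.1 hj
      refine mul_le_mul_of_nonneg_left ?_ (hr.weight_nonneg j hj)
      refine le_clamp_iff.2 ⟨?_, fun i hi _ => hc j hj i hi⟩
      -- the bound `d(j, L i) + R i` is no less than the distance to the facility chosen for `i`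
      obtain ⟨i, hi, hb⟩ := (hbase j hj).2
      obtain ⟨f, ⟨hf, _, hf'⟩, h10⟩ := hG₁ h12 _ (hlt i hi) i hi
      have hl : s₁.nat 16 i 0 < n := by rw [(hdec i hi).1]; exact hr.client_lt _
      have := hc j hj i hi
      rw [h10, Nat.add_sub_cancel] at this
      rw [hb]
      linarith [hr.triangle j hj f hf _ hl]
  refine Exec.block_cons hβ ((selectProg_spec (n := n) (k := k) (Z := B ^ K) (F := s.nat 2) hβ
    hr₄.n_eq hr₄.k_eq hr₄.Z_eq hnβ hkβ hZβ hrow ?_).mono fun s₅ h₅ hsel => Exec.block_nil ?_)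
  · rw [r1, r2]
    exact hs.congr e13 e14 r56
  obtain ⟨hsel₁, hsel₂, hsel₃⟩ := hsel
  rw [r1, r2] at hsel₁ hsel₃
  rw [r51, e8] at hsel₃
  refine ⟨hsel₁, fun x hx => hsel₂ x (hx.congr e14 r56), fun x hx => ?_⟩
  obtain ⟨o, h, u, ho, hh, hu, hx⟩ := hx
  obtain ⟨h12, hpot⟩ := hG₂ o h (fun i hi => by
    refine ⟨(ho i hi).1, (ho i hi).2.1, ?_⟩
    rw [(hdec i hi).1, (hdec i hi).2]
    exact (ho i hi).2.2) hh
  have hq : 0 < (1 + 1 / (B : ℝ)) ^ B := by positivity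
  have hZ : (0 : ℝ) < (B ^ K : ℕ) := by exact_mod_cast pow_pos hr.B_pos K
  have hbu : ∑ j ∈ Finset.range n, s.real 2 j 0 * s₂.real 51 j 0 ≤
      ∑ j ∈ Finset.range n, s.real 2 j 0 * u j := by
    refine Finset.sum_le_sum fun j hj => ?_
    have hj := Finset.mem_range.1 hj
    refine mul_le_mul_of_nonneg_left ?_ (hr.weight_nonneg j hj)
    obtain ⟨i, hi, hij⟩ := hu j hj
    refine ((hbase j hj).1 i hi).trans ?_
    rw [(hdec i hi).1, (hdec i hi).2]
    exact hij
  set H := ∑ j ∈ Finset.range n, s.real 2 j 0 * h j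
  set U := ∑ j ∈ Finset.range n, s.real 2 j 0 * u j
  -- the average over all choice functions is at most `x`, so one of them costs at most `x`
  have hpot' : potential n k (B ^ K) (s.real 1) (s.real 2) (s₂.real 51) (s.nat 8) (s₄.nat 10) ≤
      ∑ _N ∈ Finset.range (B ^ K), x := by
    rw [Finset.sum_const, Finset.card_range, nsmul_eq_mul]
    have h1 : (1 + 1 / (B : ℝ)) ^ B * (potential n k (B ^ K) (s.real 1) (s.real 2) (s₂.real 51)
        (s.nat 8) (s₄.nat 10) - (B ^ K : ℕ) * H) ≤ (B ^ K : ℕ) * (U - H) :=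
      hpot.trans (mul_le_mul_of_nonneg_left (by linarith) hZ.le)
    rw [← le_div_iff₀' hq] at h1
    have h2 := mul_le_mul_of_nonneg_left hx hZ.le
    rw [mul_add, ← mul_div_assoc] at h2
    linarith
  obtain ⟨N, hN, hNx⟩ := Finset.exists_le_of_sum_le
    (Finset.nonempty_range_iff.2 (pow_pos hr.B_pos K).ne') hpot'
  have := hsel₃ (by rw [h12]) N (Finset.mem_range.1 hN)
  exact ⟨this.1, this.2.trans hNx⟩

theorem searchProg_spec {β n k K B : ℕ} {s : Mem} (hβ : 1 ≤ β) (hnβ : n ≤ β) (hkβ : k ≤ β)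
    (hBβ : B ≤ β) (hZβ : B ^ K ≤ β) (hr : Ready n k K B s)
    (hs : Sound n k (s.nat 2) (s.real 1) (s.real 2) s) :
    Exec β searchProg s fun s' => Sound n k (s.nat 2) (s.real 1) (s.real 2) s' ∧
      ∀ q < n, ∀ q' < n, ∀ G < B ^ K, ∀ x,
        Promising n k B (s.nat 2) (s.real 1) (s.real 2) (guessLeader (s.nat 4) (s.nat 8) G)
          (guessRadius k B (s.real 2) (s.real 2 q 0 * s.real 1 q q') (s.nat 4) (s.nat 8) G) x →
          Below x s' := by
  set good : ℕ → ℕ → ℕ → ℝ → Prop := fun q q' G x =>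
    Promising n k B (s.nat 2) (s.real 1) (s.real 2) (guessLeader (s.nat 4) (s.nat 8) G)
      (guessRadius k B (s.real 2) (s.real 2 q 0 * s.real 1 q q') (s.nat 4) (s.nat 8) G) x with hgood
  refine Exec.forLoop hβ hnβ (fun c s' => Sound n k (s.nat 2) (s.real 1) (s.real 2) s' ∧
    ∀ q < c, ∀ q' < n, ∀ G < B ^ K, ∀ x, good q q' G x → Below x s') rfl ?_ ?_ ?_ fun _ _ h => h
  · intro s' h; simp [NatExp.eval, h.nat 0 rfl, hr.n_eq]
  · exact ⟨hs.congr (by simp) (by simp) (by simp), by simp⟩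
  intro q hq s₁ h₁ hq₁ hI
  have hr₁ := hr.frame h₁ rfl
  refine Exec.forLoop hβ hnβ (fun c s' => Sound n k (s.nat 2) (s.real 1) (s.real 2) s' ∧
    (∀ x, Below x s₁ → Below x s') ∧
    ∀ q' < c, ∀ G < B ^ K, ∀ x, good q q' G x → Below x s') rfl ?_ ?_ ?_ ?_
  · intro s' h; simp [NatExp.eval, h.nat 0 rfl, hr₁.n_eq]
  · exact ⟨hI.1.congr (by simp) (by simp) (by simp), fun x h => h.congr (by simp) (by simp),
      by simp⟩
  · intro q' hq' s₂ h₂ hq₂ hI₂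
    have hr₂ := hr₁.frame h₂ rfl
    refine Exec.block_cons hβ (Exec.setReal ?_)
    refine Exec.block_cons hβ (Exec.forLoop hβ hZβ (fun c s' =>
      Sound n k (s.nat 2) (s.real 1) (s.real 2) s' ∧ (∀ x, Below x s₂ → Below x s') ∧
      ∀ G < c, ∀ x, good q q' G x → Below x s') rfl ?_ ?_ ?_ ?_)
    · intro s' h; simp [NatExp.eval, h.nat 7 rfl, hr₂.Z_eq]
    · exact ⟨hI₂.1.congr (by simp) (by simp) (by simp), fun x h => h.congr (by simp) (by simp),
        by simp⟩
    · intro G hG s₃ h₃ hG₃ hI₃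
      have hr₃ : Ready n k K B s₃ := Ready.frame (hr₂.congr (by simp)) h₃ rfl
      have e2 : s₃.nat 2 = s.nat 2 := by simp [h₃.nat 2 rfl, h₂.nat 2 rfl, h₁.nat 2 rfl]
      have e4 : s₃.nat 4 = s.nat 4 := by simp [h₃.nat 4 rfl, h₂.nat 4 rfl, h₁.nat 4 rfl]
      have e8 : s₃.nat 8 = s.nat 8 := by simp [h₃.nat 8 rfl, h₂.nat 8 rfl, h₁.nat 8 rfl]
      have r1 : s₃.real 1 = s.real 1 := by simp [h₃.real 1 rfl, h₂.real 1 rfl, h₁.real 1 rfl]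
      have r2 : s₃.real 2 = s.real 2 := by simp [h₃.real 2 rfl, h₂.real 2 rfl, h₁.real 2 rfl]
      have e26 : s₂.nat 26 0 0 = q := by rw [h₂.nat 26 rfl, hq₁]
      have r57 : s₃.real 57 0 0 = s.real 2 q 0 * s.real 1 q q' := by
        rw [h₃.real 57 rfl]
        simp [NatExp.eval, RealExp.eval, e26, hq₂, h₂.real 1 rfl, h₁.real 1 rfl,
          h₂.real 2 rfl, h₁.real 2 rfl]
      refine (tryProg_spec hβ hnβ hkβ hBβ hZβ hr₃ hG₃ ?_).mono fun s₄ h₄ hI₄ => ?_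
      · rw [e2, r1, r2]; exact hI₃.1
      rw [e2, e4, e8, r1, r2, r57] at hI₄
      obtain ⟨h₁', h₂', h₃'⟩ := hI₄
      refine ⟨h₁'.congr (by simp) (by simp) (by simp),
        fun x hx => (h₂' x (hI₃.2.1 x hx)).congr (by simp) (by simp), fun G' hG' x hx => ?_⟩
      refine Below.congr (s := s₄) ?_ (by simp) (by simp)
      rcases Nat.lt_succ_iff_lt_or_eq.1 hG' with h | rfl
      · exact h₂' x (hI₃.2.2 G' h x hx)
      · exact h₃' x hx
    · intro s₃ h₃ hI₃
      refine Exec.block_nil ⟨hI₃.1.congr (by simp) (by simp) (by simp),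
        fun x hx => (hI₃.2.1 x (hI₂.2.1 x hx)).congr (by simp) (by simp), fun c hc G hG x hx => ?_⟩
      refine Below.congr (s := s₃) ?_ (by simp) (by simp)
      rcases Nat.lt_succ_iff_lt_or_eq.1 hc with h | rfl
      · exact hI₃.2.1 x (hI₂.2.2 c h G hG x hx)
      · exact hI₃.2.2 G hG x hx
  · intro s₂ h₂ hI₂
    refine ⟨hI₂.1.congr (by simp) (by simp) (by simp), fun c hc q' hq' G hG x hx => ?_⟩
    refine Below.congr (s := s₂) ?_ (by simp) (by simp)
    rcases Nat.lt_succ_iff_lt_or_eq.1 hc with h | rfl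
    · exact hI₂.2.1 x (hI.2 c h q' hq' G hG x hx)
    · exact hI₂.2.2 q' hq' G hG x hx

/-! ### Preparation and output -/

/-- Lists the clients in `4` and counts them in `(5,0,0)`. -/
def clientsProg : Prog := .forLoop 20 nExp
  (.when (.natLe (.lit 1) (.get 1 (natVar 20) (.lit 0))) (.block [
    .setNat 4 (natVar 5) (.lit 0) (natVar 20),
    .setNat 5 (.lit 0) (.lit 0) (.add (natVar 5) (.lit 1))]))

/-- Computes in `(6,0,0)` a number `B` that exceeds the number of clients, and is so large that `B ε` is
at least the number of clients. -/
def baseSizeProg : Prog := .block [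
  .setNat 6 (.lit 0) (.lit 0) (.add (natVar 5) (.lit 1)),
  .loop (.not (.realLe (.ofNat (natVar 5)) (.mul (.ofNat (natVar 6)) (realVar 0))))
    (.setNat 6 (.lit 0) (.lit 0) (.add (natVar 6) (.lit 1)))]

/-- Counts in base `B`: row `N` of the table `8` receives the `3 k` digits of `N`, as long as there is
no overflow.  The cell `(9,0,0)` holds the carry, and `(7,0,0)` the number of rows.  A row serves as
a guess, with `k` digits for the leaders, `k` for the heaviest clients and `k` for the radii, and by
its first `k` digits also as a choice function. -/
def tableProg : Prog := .loop (.natLe (natVar 9) (.lit 0)) (.block [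
  .setNat 9 (.lit 0) (.lit 0) (.lit 1),
  .forLoop 22 (.add kExp (.add kExp kExp))
    (.ite (.natLe (.lit 1) (natVar 9))
      (.ite (.natLe (.add (.get 8 (natVar 7) (natVar 22)) (.lit 2)) (natVar 6))
        (.block [
          .setNat 8 (.add (natVar 7) (.lit 1)) (natVar 22)
            (.add (.get 8 (natVar 7) (natVar 22)) (.lit 1)),
          .setNat 9 (.lit 0) (.lit 0) (.lit 0)])
        (.setNat 8 (.add (natVar 7) (.lit 1)) (natVar 22) (.lit 0)))
      (.setNat 8 (.add (natVar 7) (.lit 1)) (natVar 22) (.get 8 (natVar 7) (natVar 22)))),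
  .setNat 7 (.lit 0) (.lit 0) (.add (natVar 7) (.lit 1))])

theorem clientsProg_spec {β n : ℕ} {s : Mem} (hβ : 1 ≤ β) (hn : s.nat 0 0 0 = n) (hnβ : n ≤ β)
    (hn₀ : 0 < n) (h4 : ∀ x, s.nat 4 x 0 = 0) (h5 : s.nat 5 0 0 = 0) :
    Exec β clientsProg s fun s' =>
      s'.nat 5 0 0 = ((Finset.range n).filter fun j => 1 ≤ s.nat 1 j 0).card ∧
      (∀ x, s'.nat 4 x 0 < n) ∧
      ∀ j < n, 1 ≤ s.nat 1 j 0 → ∃ x < s'.nat 5 0 0, s'.nat 4 x 0 = j := by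
  refine Exec.forLoop hβ hnβ (fun c s' =>
      s'.nat 5 0 0 = ((Finset.range c).filter fun j => 1 ≤ s.nat 1 j 0).card ∧
      (∀ x, s'.nat 4 x 0 < n) ∧
      ∀ j < c, 1 ≤ s.nat 1 j 0 → ∃ x < s'.nat 5 0 0, s'.nat 4 x 0 = j) rfl ?_ ?_ ?_
      fun _ _ h => h
  · intro s' h; simp [NatExp.eval, h.nat 0 rfl, hn]
  · simp [h4, h5, hn₀]
  · intro c hc s₁ h₁ hc₁ hI
    obtain ⟨hI₁, hI₂, hI₃⟩ := hI
    rw [Finset.range_add_one, Finset.filter_insert]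
    refine Exec.when hβ (fun hb => ?_) (fun hb => ?_) <;>
    simp only [Test.holds, NatExp.eval, hc₁, h₁.nat 1 rfl] at hb
    · rw [if_pos hb, Finset.card_insert_of_notMem (by simp), ← hI₁]
      refine Exec.block_cons hβ (Exec.setNat (Exec.block_cons hβ (Exec.setNat
        (Exec.block_nil ⟨?_, fun x => ?_, fun j hj hj' => ?_⟩))))
      · simp [NatExp.eval]
      · by_cases hx : x = s₁.nat 5 0 0
        · simp [NatExp.eval, hx, hc₁, hc]
        · simp [NatExp.eval, hx, hI₂ x]
      · rcases Nat.lt_succ_iff_lt_or_eq.1 hj with h | rfl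
        · obtain ⟨x, hx, hx'⟩ := hI₃ j h hj'
          refine ⟨x, ?_, ?_⟩
          · simp [NatExp.eval]; omega
          · simp [NatExp.eval, hx.ne, hx']
        · exact ⟨s₁.nat 5 0 0, by simp [NatExp.eval], by simp [NatExp.eval, hc₁]⟩
    · rw [if_neg hb]
      refine ⟨by simpa using hI₁, by simpa using hI₂, fun j hj hj' => ?_⟩
      rcases Nat.lt_succ_iff_lt_or_eq.1 hj with h | rfl
      · simpa using hI₃ j h hj'
      · exact absurd hj' hb

theorem baseSizeProg_spec {β m : ℕ} {s : Mem} (hβ : 1 ≤ β) (hm : s.nat 5 0 0 = m)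
    (hε : 0 < s.real 0 0 0) (hmβ : ⌈m / s.real 0 0 0⌉₊ ≤ β) :
    Exec β baseSizeProg s fun s' => m < s'.nat 6 0 0 ∧
      (m : ℝ) ≤ s'.nat 6 0 0 * s.real 0 0 0 ∧ s'.nat 6 0 0 ≤ m + 1 + ⌈m / s.real 0 0 0⌉₊ := by
  classical
  set ε := s.real 0 0 0
  have hex : ∃ r : ℕ, (m : ℝ) ≤ (m + 1 + r : ℕ) * ε := by
    refine ⟨⌈m / ε⌉₊, ?_⟩
    rw [← div_le_iff₀ hε]
    refine (Nat.le_ceil _).trans ?_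
    exact_mod_cast Nat.le_add_left _ _
  have hle : Nat.find hex ≤ ⌈m / ε⌉₊ := Nat.find_min' hex (by
    rw [← div_le_iff₀ hε]
    refine (Nat.le_ceil _).trans ?_
    exact_mod_cast Nat.le_add_left _ _)
  refine Exec.block_cons hβ (Exec.setNat (Exec.block_cons hβ (Exec.loop hβ (hle.trans hmβ)
    (fun r s' => s'.nat 6 0 0 = m + 1 + r) ?_ ?_ ?_ ?_)))
  · intro r hr s' h hI
    have h5 : s'.nat 5 0 0 = m := by rw [h.nat 5 rfl]; simpa using hm
    have h0 : s'.real 0 0 0 = ε := by rw [h.real 0 rfl]; simp [ε]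
    simp only [Test.holds, RealExp.eval, NatExp.eval, h5, h0, hI]
    refine ⟨fun hb => lt_of_le_of_ne hr ?_, fun hlt => Nat.find_min hex hlt⟩
    rintro rfl
    exact hb (Nat.find_spec hex)
  · simp [NatExp.eval, hm]
  · intro r hr s' h hI
    refine Exec.setNat ?_
    simp [NatExp.eval, hI, add_assoc]
  · intro s' h hI
    have := Nat.find_spec hex
    refine Exec.block_nil ⟨by omega, ?_, by omega⟩
    rwa [hI]

theorem digit_succ (B N i : ℕ) (hB : 0 < B) : digit B (N + 1) i =
    if B ^ i ∣ N + 1 then (if digit B N i + 2 ≤ B then digit B N i + 1 else 0)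
    else digit B N i := by
  unfold digit
  rw [Nat.succ_div]
  split_ifs with h₁ h₂
  · have := Nat.mod_lt (N / B ^ i) hB
    rw [Nat.add_mod, Nat.mod_eq_of_lt (a := 1) (by omega), Nat.mod_eq_of_lt (by omega)]
  · have := Nat.mod_lt (N / B ^ i) hB
    have h : N / B ^ i % B + 1 = B := by omega
    rw [← Nat.mod_add_mod, h, Nat.mod_self]
  · rfl

theorem pow_succ_dvd_iff (B N i : ℕ) (hB : 0 < B) : B ^ (i + 1) ∣ N + 1 ↔
    B ^ i ∣ N + 1 ∧ ¬ digit B N i + 2 ≤ B := by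
  refine ⟨fun h => ?_, fun ⟨h, h'⟩ => ?_⟩
  · have h₁ : B ^ i ∣ N + 1 := (pow_dvd_pow B (Nat.le_succ i)).trans h
    refine ⟨h₁, fun h' => ?_⟩
    have h₂ : digit B (N + 1) i = 0 := by
      unfold digit
      exact Nat.mod_eq_zero_of_dvd ((Nat.dvd_div_iff_mul_dvd h₁).2 (by rwa [pow_succ] at h))
    rw [digit_succ B N i hB, if_pos h₁, if_pos h'] at h₂
    omega
  · have h₂ : digit B (N + 1) i = 0 := by rw [digit_succ B N i hB, if_pos h, if_neg h']
    rw [pow_succ]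
    exact (Nat.dvd_div_iff_mul_dvd h).1 (Nat.dvd_of_mod_eq_zero h₂)

theorem tableProg_spec {β k B : ℕ} {s : Mem} (hβ : 1 ≤ β) (hk : s.nat 0 0 1 = k)
    (hB : s.nat 6 0 0 = B) (hB₀ : 0 < B) (hkβ : 3 * k ≤ β) (hZβ : B ^ (3 * k) ≤ β)
    (h7 : s.nat 7 0 0 = 0) (h8 : ∀ i, s.nat 8 0 i = 0) (h9 : s.nat 9 0 0 = 0) :
    Exec β tableProg s fun s' => s'.nat 7 0 0 = B ^ (3 * k) ∧
      ∀ N < B ^ (3 * k), ∀ i < 3 * k, s'.nat 8 N i = digit B N i := by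
  refine Exec.loop hβ hZβ (fun Z s' => s'.nat 7 0 0 = Z ∧
    (1 ≤ s'.nat 9 0 0 ↔ 0 < Z ∧ B ^ (3 * k) ∣ Z) ∧
    ∀ N ≤ Z, ∀ i < 3 * k, s'.nat 8 N i = digit B N i) ?_ ?_ ?_
    (fun s' _ hI => ⟨hI.1, fun N hN => hI.2.2 N hN.le⟩)
  · intro Z hZ s' h hI
    simp only [Test.holds, NatExp.eval]
    have := hI.2.1
    constructor
    · intro h0
      refine lt_of_le_of_ne hZ ?_
      rintro rfl
      have := this.2 ⟨pow_pos hB₀ _, dvd_rfl⟩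
      omega
    · intro hlt
      by_contra h0
      have := this.1 (by omega)
      exact absurd (Nat.le_of_dvd this.1 this.2) (by omega)
  · refine ⟨h7, by simp [h9], fun N hN i _ => ?_⟩
    obtain rfl : N = 0 := by omega
    rw [h8]; simp [digit]
  · intro Z hZ s₁ h₁ hI
    obtain ⟨hI₁, hI₂, hI₃⟩ := hI
    refine Exec.block_cons hβ (Exec.setNat (Exec.block_cons hβ (Exec.forLoop (n := 3 * k) hβ hkβ
      (fun i s' => (1 ≤ s'.nat 9 0 0 ↔ B ^ i ∣ Z + 1) ∧
        (∀ N ≤ Z, ∀ i' < 3 * k, s'.nat 8 N i' = digit B N i') ∧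
        ∀ i' < i, s'.nat 8 (Z + 1) i' = digit B (Z + 1) i') rfl ?_ ?_ ?_ ?_)))
    · intro s' h
      simp [NatExp.eval, h.nat 0 rfl, h₁.nat 0 rfl, hk]; omega
    · exact ⟨by simp [NatExp.eval], by simpa using hI₃, by simp⟩
    · intro i hi s₂ h₂ hi₂ hI₄
      obtain ⟨hc, hold, hnew⟩ := hI₄
      have e7 : s₂.nat 7 0 0 = Z := by rw [h₂.nat 7 rfl]; simpa using hI₁
      have e6 : s₂.nat 6 0 0 = B := by rw [h₂.nat 6 rfl]; simp [h₁.nat 6 rfl, hB]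
      have hdig := hold Z le_rfl i hi
      have hps := pow_succ_dvd_iff B Z i hB₀
      have hds := digit_succ B Z i hB₀
      -- the entry written is the new digit
      have hwrite : ∀ (x : ℕ) (T : ℕ → ℕ → ℕ), x = digit B (Z + 1) i →
          T = setEntry (s₂.nat 8) (Z + 1) i x →
          (∀ N ≤ Z, ∀ i' < 3 * k, T N i' = digit B N i') ∧
          ∀ i' < i + 1, T (Z + 1) i' = digit B (Z + 1) i' := by
        rintro x T rfl rfl
        refine ⟨fun N hN i' hi' => ?_, fun i' hi' => ?_⟩
        · rw [setEntry, if_neg (by omega)]; exact hold N hN i' hi'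
        · by_cases h : i' = i
          · rw [setEntry, if_pos ⟨rfl, h⟩, h]
          · rw [setEntry, if_neg (by tauto)]; exact hnew i' (by omega)
      refine Exec.ite hβ (fun hb => Exec.ite hβ (fun hb' => Exec.block_cons hβ (Exec.setNat
        (Exec.block_cons hβ (Exec.setNat (Exec.block_nil ?_))))) fun hb' => Exec.setNat ?_)
        fun hb => Exec.setNat ?_ <;>
      simp only [Test.holds, NatExp.eval] at hb
      · simp only [Test.holds, NatExp.eval, e7, hi₂, hdig, e6] at hb'
        rw [if_pos (hc.1 hb), if_pos hb'] at hds
        refine ⟨by simp [NatExp.eval, hps, hb'], hwrite (digit B Z i + 1) _ hds.symm ?_⟩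
        rw [Mem.setNat_nat_of_ne _ _ _ _ (by decide), Mem.setNat_nat_of_ne _ _ _ _ (by decide),
          Mem.setNat_nat_eq_setEntry]
        simp [NatExp.eval, e7, hi₂, hdig]
      · simp only [Test.holds, NatExp.eval, e7, hi₂, hdig, e6] at hb'
        rw [if_pos (hc.1 hb), if_neg hb'] at hds
        refine ⟨?_, hwrite 0 _ hds.symm ?_⟩
        · rw [Mem.setNat_nat_of_ne _ _ _ _ (by decide), Mem.setNat_nat_of_ne _ _ _ _ (by decide),
            hps]
          exact ⟨fun h => ⟨hc.1 h, hb'⟩, fun h => hb⟩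
        · rw [Mem.setNat_nat_of_ne _ _ _ _ (by decide), Mem.setNat_nat_eq_setEntry]
          simp [NatExp.eval, e7, hi₂]
      · have hnd : ¬ B ^ i ∣ Z + 1 := fun h => hb (hc.2 h)
        rw [if_neg hnd] at hds
        refine ⟨?_, hwrite (digit B Z i) _ hds.symm ?_⟩
        · rw [Mem.setNat_nat_of_ne _ _ _ _ (by decide), Mem.setNat_nat_of_ne _ _ _ _ (by decide),
            hps]
          exact ⟨fun h => absurd h hb, fun h => absurd h.1 hnd⟩
        · rw [Mem.setNat_nat_of_ne _ _ _ _ (by decide), Mem.setNat_nat_eq_setEntry]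
          simp [NatExp.eval, e7, hi₂, hdig]
    · intro s₂ h₂ hI₄
      have e7 : s₂.nat 7 0 0 = Z := by rw [h₂.nat 7 rfl]; simpa using hI₁
      refine Exec.block_cons hβ (Exec.setNat (Exec.block_nil ⟨by simp [NatExp.eval, e7], ?_, ?_⟩))
      · simpa using hI₄.1
      · intro N hN i hi
        rw [Mem.setNat_nat_of_ne _ _ _ _ (by decide)]
        rcases Nat.lt_succ_iff_lt_or_eq.1 (Nat.lt_succ_of_le hN) with h | rfl
        · exact hI₄.2.1 N (Nat.le_of_lt_succ h) i hi
        · exact hI₄.2.2 i hi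

/-- Outputs the stored solution, padded with further facilities until there are `k`. -/
def outputProg : Prog := .block [
  .setNat 15 (.lit 0) (.lit 0) (.lit 0),
  .forLoop 22 kExp (.when (.natLe (.lit 1) (.get 13 (natVar 22) (.lit 0)))
    (.when (.not (.natLe (.lit 1) (.get 3 (.sub (.get 13 (natVar 22) (.lit 0)) (.lit 1)) (.lit 0))))
      (.block [
        .setNat 3 (.sub (.get 13 (natVar 22) (.lit 0)) (.lit 1)) (.lit 0) (.lit 1),
        .setNat 15 (.lit 0) (.lit 0) (.add (natVar 15) (.lit 1))]))),
  .forLoop 20 nExp (.when (.and (.natLe (.lit 1) (.get 2 (natVar 20) (.lit 0)))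
      (.and (.not (.natLe (.lit 1) (.get 3 (natVar 20) (.lit 0))))
        (.not (.natLe kExp (natVar 15)))))
    (.block [
      .setNat 3 (natVar 20) (.lit 0) (.lit 1),
      .setNat 15 (.lit 0) (.lit 0) (.add (natVar 15) (.lit 1))]))]

/-- The approximation algorithm. -/
def mainProg : Prog := .block [clientsProg, baseSizeProg, tableProg, searchProg, outputProg]

/-- The array `3` holds the flags of a set of `r` facilities. -/
def Flags (n : ℕ) (F g : ℕ → ℕ → ℕ) (r : ℕ) : Prop :=
  (∀ x, g x 0 = 0 ∨ g x 0 = 1 ∧ x < n ∧ 1 ≤ F x 0) ∧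
    r = ((Finset.range n).filter fun x => g x 0 = 1).card

theorem Flags.insert {n r f : ℕ} {F g : ℕ → ℕ → ℕ} (h : Flags n F g r) (hf : f < n)
    (hF : 1 ≤ F f 0) (hg : ¬ 1 ≤ g f 0) : Flags n F (setEntry g f 0 1) (r + 1) := by
  refine ⟨fun x => ?_, ?_⟩
  · by_cases hx : x = f
    · subst hx; exact Or.inr ⟨by simp [setEntry], hf, hF⟩
    · simpa [setEntry, hx] using h.1 x
  · have : (Finset.range n).filter (fun x => setEntry g f 0 1 x 0 = 1) =
        Insert.insert f ((Finset.range n).filter fun x => g x 0 = 1) := by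
      ext x
      by_cases hx : x = f
      · simp [setEntry, hx, hf]
      · simp [setEntry, hx]
    rw [this, Finset.card_insert_of_notMem, h.2]
    simp only [Finset.mem_filter, not_and]
    intro _; omega

theorem Flags.eq_one {n r x : ℕ} {F g : ℕ → ℕ → ℕ} (h : Flags n F g r) (hx : 1 ≤ g x 0) :
    g x 0 = 1 := by
  rcases h.1 x with h | h
  · omega
  · exact h.1

theorem outputProg_spec {β n k : ℕ} {s : Mem} (hβ : 1 ≤ β) (hn : s.nat 0 0 0 = n)
    (hk : s.nat 0 0 1 = k) (hnβ : n ≤ β) (hkβ : k ≤ β) (h3 : ∀ x, s.nat 3 x 0 = 0)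
    (hkF : k ≤ ((Finset.range n).filter fun f => 1 ≤ s.nat 2 f 0).card)
    (hbest : ∀ i < k, s.nat 13 i 0 = 0 ∨ ∃ f < n, 1 ≤ s.nat 2 f 0 ∧ s.nat 13 i 0 = f + 1) :
    Exec β outputProg s fun s' => Flags n (s.nat 2) (s'.nat 3) k ∧
      ∀ i < k, s.nat 13 i 0 ≠ 0 → s'.nat 3 (s.nat 13 i 0 - 1) 0 = 1 := by
  refine Exec.block_cons hβ (Exec.setNat (Exec.block_cons hβ (Exec.forLoop hβ hkβ
    (fun c s' => Flags n (s.nat 2) (s'.nat 3) (s'.nat 15 0 0) ∧ s'.nat 15 0 0 ≤ c ∧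
      ∀ i < c, s.nat 13 i 0 ≠ 0 → s'.nat 3 (s.nat 13 i 0 - 1) 0 = 1) rfl ?_ ?_ ?_ ?_)))
  · intro s' h; simp [NatExp.eval, h.nat 0 rfl, hk]
  · refine ⟨⟨fun x => Or.inl (by simp [h3]), ?_⟩, by simp [NatExp.eval], by simp⟩
    simp [NatExp.eval, h3]
  · intro c hc s₁ h₁ hc₁ hI
    obtain ⟨hI₁, hI₂, hI₃⟩ := hI
    have e13 : s₁.nat 13 = s.nat 13 := by simp [h₁.nat 13 rfl]
    have hx : ∀ {s₂ : Mem}, (s₂.setNat 22 0 0 (c + 1)).nat 3 = s₂.nat 3 := by simp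
    have hx' : ∀ {s₂ : Mem}, (s₂.setNat 22 0 0 (c + 1)).nat 15 = s₂.nat 15 := by simp
    refine Exec.when hβ (fun hb => Exec.when hβ (fun hb' => Exec.block_cons hβ (Exec.setNat
      (Exec.block_cons hβ (Exec.setNat (Exec.block_nil ?_))))) fun hb' => ?_) fun hb => ?_ <;>
    simp only [Test.holds, NatExp.eval, e13, hc₁] at hb <;> rw [hx, hx']
    · simp only [Test.holds, NatExp.eval, e13, hc₁] at hb'
      obtain ⟨f, hf, hF, hf'⟩ := (hbest c hc).resolve_left (by omega)
      rw [hf', Nat.add_sub_cancel] at hb'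
      have e3 : ∀ y z : ℕ,
            ((s₁.setNat 3 f 0 1).setNat 15 y z ((s₁.setNat 3 f 0 1).nat 15 0 0 + 1)).nat 3 =
          setEntry (s₁.nat 3) f 0 1 := by
        intro y z
        rw [Mem.setNat_nat_of_ne _ _ _ _ (by decide), Mem.setNat_nat_eq_setEntry]
      simp only [NatExp.eval, e13, hc₁, hf', Nat.add_sub_cancel]
      rw [e3]
      refine ⟨by simpa using hI₁.insert hf hF hb', by simpa using hI₂, fun i hi hi' => ?_⟩
      simp only [setEntry, and_true]
      split_ifs with h
      · rfl
      · rcases Nat.lt_succ_iff_lt_or_eq.1 hi with h' | rfl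
        · exact hI₃ i h' hi'
        · rw [hf', Nat.add_sub_cancel] at h
          exact absurd rfl h
    · simp only [Test.holds, NatExp.eval, e13, hc₁, not_not] at hb'
      refine ⟨hI₁, hI₂.trans (Nat.le_succ c), fun i hi hi' => ?_⟩
      rcases Nat.lt_succ_iff_lt_or_eq.1 hi with h' | rfl
      · exact hI₃ i h' hi'
      · exact hI₁.eq_one hb'
    · refine ⟨hI₁, hI₂.trans (Nat.le_succ c), fun i hi hi' => ?_⟩
      rcases Nat.lt_succ_iff_lt_or_eq.1 hi with h' | rfl
      · exact hI₃ i h' hi'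
      · omega
  · intro s₁ h₁ hI
    obtain ⟨hI₁, hI₂, hI₃⟩ := hI
    have e2 : s₁.nat 2 = s.nat 2 := by simp [h₁.nat 2 rfl]
    have e0 : s₁.nat 0 = s.nat 0 := by simp [h₁.nat 0 rfl]
    refine Exec.block_cons hβ (Exec.forLoop hβ hnβ (fun c s' =>
      Flags n (s.nat 2) (s'.nat 3) (s'.nat 15 0 0) ∧ s'.nat 15 0 0 ≤ k ∧
      (∀ i < k, s.nat 13 i 0 ≠ 0 → s'.nat 3 (s.nat 13 i 0 - 1) 0 = 1) ∧
      (s'.nat 15 0 0 < k → ∀ f < c, 1 ≤ s.nat 2 f 0 → s'.nat 3 f 0 = 1)) rfl ?_ ?_ ?_ ?_)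
    · intro s' h; simp [NatExp.eval, h.nat 0 rfl, e0, hn]
    · exact ⟨by simpa using hI₁, by simpa using hI₂, by simpa using hI₃, by simp⟩
    · intro c hc s₂ h₂ hc₂ hJ
      obtain ⟨hJ₁, hJ₂, hJ₃, hJ₄⟩ := hJ
      have e2' : s₂.nat 2 = s.nat 2 := by simp [h₂.nat 2 rfl, e2]
      have e0' : s₂.nat 0 = s.nat 0 := by simp [h₂.nat 0 rfl, e0]
      have hx : ∀ {s₂ : Mem}, (s₂.setNat 20 0 0 (c + 1)).nat 3 = s₂.nat 3 := by simp
      have hx' : ∀ {s₂ : Mem}, (s₂.setNat 20 0 0 (c + 1)).nat 15 = s₂.nat 15 := by simp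
      refine Exec.when hβ (fun hb => Exec.block_cons hβ (Exec.setNat
        (Exec.block_cons hβ (Exec.setNat (Exec.block_nil ?_))))) fun hb => ?_ <;>
      simp only [Test.holds, NatExp.eval, e2', e0', hc₂, hk] at hb <;> rw [hx, hx']
      · have e3 : ∀ y z : ℕ,
            ((s₂.setNat 3 c 0 1).setNat 15 y z ((s₂.setNat 3 c 0 1).nat 15 0 0 + 1)).nat 3 =
            setEntry (s₂.nat 3) c 0 1 := by
          intro y z
          rw [Mem.setNat_nat_of_ne _ _ _ _ (by decide), Mem.setNat_nat_eq_setEntry]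
        simp only [NatExp.eval, hc₂]
        rw [e3]
        refine ⟨by simpa using hJ₁.insert hc hb.1 hb.2.1, by simp; omega, fun i hi hi' => ?_,
          fun hlt f hf hF => ?_⟩
        · have := hJ₃ i hi hi'
          simp only [setEntry]; split_ifs <;> trivial
        · simp only [Mem.setNat_nat_self, and_self, if_true] at hlt
          rw [Mem.setNat_nat_of_ne _ _ _ _ (by decide)] at hlt
          rcases Nat.lt_succ_iff_lt_or_eq.1 hf with h' | rfl
          · have := hJ₄ (by omega) f h' hF
            simp only [setEntry]; split_ifs <;> trivial
          · simp [setEntry]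
      · refine ⟨hJ₁, hJ₂, hJ₃, fun hlt f hf hF => ?_⟩
        rcases Nat.lt_succ_iff_lt_or_eq.1 hf with h' | rfl
        · exact hJ₄ hlt f h' hF
        · refine hJ₁.eq_one ?_
          by_contra h
          exact hb ⟨hF, h, by omega⟩
    · intro s₂ h₂ hJ
      obtain ⟨hJ₁, hJ₂, hJ₃, hJ₄⟩ := hJ
      have : s₂.nat 15 0 0 = k := by
        by_contra hne
        have hlt : s₂.nat 15 0 0 < k := by omega
        have : ((Finset.range n).filter fun f => 1 ≤ s.nat 2 f 0).card ≤ s₂.nat 15 0 0 := by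
          rw [hJ₁.2]
          refine Finset.card_le_card fun f hf => ?_
          rw [Finset.mem_filter, Finset.mem_range] at hf ⊢
          exact ⟨hf.1, hJ₄ hlt f hf.1 hf.2⟩
        omega
      rw [this] at hJ₁
      exact Exec.block_nil ⟨hJ₁, hJ₃⟩

theorem exists_digit_eq {K B : ℕ} (τ : ℕ → ℕ) (h : ∀ i < K, τ i < B) :
    ∃ G < B ^ K, ∀ i < K, digit B G i = τ i := by
  refine ⟨finFunctionFinEquiv fun i : Fin K => (⟨τ i, h i i.2⟩ : Fin B), Fin.is_lt _,
    fun i hi => ?_⟩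
  have := finFunctionFinEquiv.symm_apply_apply fun i : Fin K => (⟨τ i, h i i.2⟩ : Fin B)
  have := congrArg Fin.val (congrFun this ⟨i, hi⟩)
  simpa [digit, finFunctionFinEquiv] using this

theorem Promising.congr {n k B : ℕ} {F : ℕ → ℕ → ℕ} {d w : ℕ → ℕ → ℝ} {L L' : ℕ → ℕ}
    {R R' : ℕ → ℝ} {x : ℝ} (h : Promising n k B F d w L R x) (hL : ∀ i < k, L' i = L i)
    (hR : ∀ i < k, R' i = R i) : Promising n k B F d w L' R' x := by
  obtain ⟨o, h, u, h₁, h₂, h₃, h₄⟩ := h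
  refine ⟨o, h, u, fun i hi => ?_, h₂, fun j hj => ?_, h₄⟩
  · rw [hL i hi, hR i hi]; exact h₁ i hi
  · obtain ⟨i, hi, hij⟩ := h₃ j hj
    exact ⟨i, hi, by rwa [hL i hi, hR i hi]⟩

/-- What the algorithm achieves: it outputs `k` facilities, and their cost is at most the bound of any
promising guess whose leaders `L` are clients and whose radii are a multiple between `1` and `B` of
`Q / (B w)`, where `w` is the weight of a client and `Q` is the weighted distance of two
points. -/
theorem mainProg_spec {β n k m : ℕ} {s : Mem} (hnβ : n ≤ β)
    (hkβ : 3 * k ≤ β) (hn : s.nat 0 0 0 = n) (hk : s.nat 0 0 1 = k) (hn₀ : 0 < n) (hk₀ : 0 < k)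
    (hm : m = ((Finset.range n).filter fun j => 1 ≤ s.nat 1 j 0).card) (hε : 0 < s.real 0 0 0)
    (hβ' : (m + 1 + ⌈m / s.real 0 0 0⌉₊) ^ (3 * k) ≤ β)
    (hnat : ∀ a, 3 ≤ a → ∀ i j, s.nat a i j = 0)
    (hkF : k ≤ ((Finset.range n).filter fun f => 1 ≤ s.nat 2 f 0).card)
    (hw : ∀ j < n, 0 ≤ s.real 2 j 0)
    (htri : ∀ j < n, ∀ f < n, ∀ l < n, s.real 1 j f ≤ s.real 1 j l + s.real 1 f l) :
    Exec β mainProg s fun s' => Flags n (s.nat 2) (s'.nat 3) k ∧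
      ∃ B : ℕ, m < B ∧ (m : ℝ) ≤ B * s.real 0 0 0 ∧
        ∀ q < n, ∀ q' < n, ∀ L H y : ℕ → ℕ, (∀ i < k, L i < n ∧ 1 ≤ s.nat 1 (L i) 0) →
          (∀ i < k, H i < n ∧ 1 ≤ s.nat 1 (H i) 0) → (∀ i < k, y i < B) → ∀ x : ℝ,
          Promising n k B (s.nat 2) (s.real 1) (s.real 2) L (fun i => ((y i : ℝ) + 1) *
            (s.real 2 q 0 * s.real 1 q q') / (B * s.real 2 (H i) 0)) x →
          ∀ c : ℕ → ℝ, (∀ j < n, ∀ f < n, s'.nat 3 f 0 = 1 → c j ≤ s.real 1 j f) →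
            ∑ j ∈ Finset.range n, s.real 2 j 0 * c j ≤ x := by
  have hβ : 1 ≤ β := le_trans (by omega) hnβ
  have hle : ∀ r, r ≤ m + 1 + ⌈m / s.real 0 0 0⌉₊ → r ^ (3 * k) ≤ β := fun r hr =>
    (Nat.pow_le_pow_left hr _).trans hβ'
  have hle' : ∀ r, r ≤ m + 1 + ⌈m / s.real 0 0 0⌉₊ → r ≤ β := fun r hr =>
    (Nat.le_self_pow (by omega) r).trans (hle r hr)
  refine Exec.block_cons hβ ((clientsProg_spec hβ hn hnβ hn₀ (fun x => hnat 4 (by omega) x 0)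
    (hnat 5 (by omega) 0 0)).mono fun s₁ h₁ hI₁ => ?_)
  obtain ⟨hm₁, hcl, hcl'⟩ := hI₁
  rw [← hm] at hm₁
  have r0 : s₁.real 0 0 0 = s.real 0 0 0 := by rw [h₁.real 0 rfl]
  refine Exec.block_cons hβ ((baseSizeProg_spec hβ hm₁ (by rw [r0]; exact hε)
    (by rw [r0]; exact hle' _ (by omega))).mono fun s₂ h₂ hI₂ => ?_)
  rw [r0] at hI₂
  obtain ⟨B, hB⟩ : ∃ B, s₂.nat 6 0 0 = B := ⟨_, rfl⟩
  rw [hB] at hI₂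
  obtain ⟨hmB, hmB', hBle⟩ := hI₂
  refine Exec.block_cons hβ ((tableProg_spec (k := k) hβ (by rw [h₂.nat 0 rfl, h₁.nat 0 rfl, hk]) hB
    (by omega) hkβ (hle B hBle) (by rw [h₂.nat 7 rfl, h₁.nat 7 rfl, hnat 7 (by omega)])
    (fun i => by rw [h₂.nat 8 rfl, h₁.nat 8 rfl, hnat 8 (by omega)])
    (by rw [h₂.nat 9 rfl, h₁.nat 9 rfl, hnat 9 (by omega)])).mono fun s₃ h₃ hI₃ => ?_)
  have e : ∀ a ∈ [0, 1, 2, 3, 13, 14], s₃.nat a = s.nat a := by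
    intro a ha
    fin_cases ha <;> rw [h₃.nat _ rfl, h₂.nat _ rfl, h₁.nat _ rfl]
  have r : ∀ a ∈ [1, 2], s₃.real a = s.real a := by
    intro a ha
    fin_cases ha <;> rw [h₃.real _ rfl, h₂.real _ rfl, h₁.real _ rfl]
  have e4 : s₃.nat 4 = s₁.nat 4 := by rw [h₃.nat 4 rfl, h₂.nat 4 rfl]
  have hr : Ready n k (3 * k) B s₃ :=
    { n_eq := by rw [e 0 (by simp), hn]
      k_eq := by rw [e 0 (by simp), hk]
      B_eq := by rw [h₃.nat 6 rfl, hB]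
      Z_eq := hI₃.1
      k_pos := hk₀
      B_pos := by omega
      k_le := by omega
      table := hI₃.2
      weight_nonneg := by rw [r 2 (by simp)]; exact hw
      triangle := by rw [r 1 (by simp)]; exact htri
      client_lt := by rw [e4]; exact hcl }
  have hs : Sound n k (s₃.nat 2) (s₃.real 1) (s₃.real 2) s₃ := by
    refine ⟨fun i hi => Or.inl ?_, fun h => ?_⟩
    · rw [e 13 (by simp), hnat 13 (by omega)]
    · rw [e 14 (by simp), hnat 14 (by omega)] at h
      omega
  refine Exec.block_cons hβ ((searchProg_spec hβ hnβ (by omega) (hle' B hBle) (hle B hBle) hr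
    hs).mono fun s₄ h₄ hI₄ => ?_)
  rw [e 2 (by simp), r 1 (by simp), r 2 (by simp)] at hI₄
  obtain ⟨hsound, hgood⟩ := hI₄
  have e2 : s₄.nat 2 = s.nat 2 := by rw [h₄.nat 2 rfl, e 2 (by simp)]
  refine Exec.block_cons hβ ((outputProg_spec (n := n) (k := k) hβ
    (by rw [h₄.nat 0 rfl, e 0 (by simp), hn]) (by rw [h₄.nat 0 rfl, e 0 (by simp), hk]) hnβ
    (by omega) (fun x => by rw [h₄.nat 3 rfl, e 3 (by simp), hnat 3 le_rfl]) (by rwa [e2])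
    (by rw [e2]; exact hsound.1)).mono fun s₅ h₅ hI₅ => Exec.block_nil ?_)
  rw [e2] at hI₅
  refine ⟨hI₅.1, B, hmB, hmB', fun q hq q' hq' L H y hL hH hy x hx c hc => ?_⟩
  -- the row `G` whose digits are the positions of the clients `L i`, of the clients `H i`, and `y i`
  have hidx : ∀ l : ℕ, ∃ z, l < n ∧ 1 ≤ s.nat 1 l 0 → z < B ∧ s₃.nat 4 z 0 = l := by
    intro l
    by_cases hl : l < n ∧ 1 ≤ s.nat 1 l 0
    · obtain ⟨z, hz, hz'⟩ := hcl' l hl.1 hl.2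
      exact ⟨z, fun _ => ⟨by omega, by rw [e4, hz']⟩⟩
    · exact ⟨0, fun h => absurd h hl⟩
  choose idx hidx using hidx
  obtain ⟨G, hG, hdig⟩ := exists_digit_eq (K := 3 * k) (B := B) (fun i => if i < k then idx (L i)
    else if i < 2 * k then idx (H (i - k)) else y (i - 2 * k)) (by
      intro i hi
      split_ifs with h h'
      · exact (hidx _ (hL i h)).1
      · exact (hidx _ (hH (i - k) (by omega))).1
      · exact hy _ (by omega))
  have htab : ∀ i < 3 * k, s₃.nat 8 G i = if i < k then idx (L i)
    else if i < 2 * k then idx (H (i - k)) else y (i - 2 * k) := fun i hi => by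
      rw [hI₃.2 G hG i hi, hdig i hi]
  have hb := hgood q hq q' hq' G hG x (hx.congr (fun i hi => ?_) fun i hi => ?_)
  · obtain ⟨hb₁, hb₂⟩ := hb
    obtain ⟨hne, hcost⟩ := hsound.2 hb₁
    refine (hcost c fun j hj i hi => ?_).trans hb₂
    obtain ⟨f, hf, _, hf'⟩ := (hsound.1 i hi).resolve_left (hne i hi)
    refine hc j hj _ (by omega) (hI₅.2 i hi (hne i hi))
  · rw [guessLeader, htab i (by omega), if_pos hi, (hidx _ (hL i hi)).2]
  · rw [guessRadius, htab (k + (k + i)) (by omega), if_neg (by omega), if_neg (by omega),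
      htab (k + i) (by omega), if_neg (by omega), if_pos (by omega), Nat.add_sub_cancel_left,
      (hidx _ (hH i hi)).2]
    congr 5
    omega

/-! ### Distances to finite sets -/

section DistTo

variable {X : Type u} {d : X → X → ℝ} {x : X} {S : Finset X}

theorem distTo_le {y : X} (hy : y ∈ S) : distTo d x S ≤ d x y :=
  ciInf_le (Set.finite_range _).bddBelow (⟨y, hy⟩ : {y // y ∈ S})

theorem exists_distTo_eq (hS : S.Nonempty) : ∃ y ∈ S, d x y = distTo d x S := by
  have : Nonempty {y // y ∈ S} := hS.to_subtype
  obtain ⟨y, hy⟩ := exists_eq_ciInf_of_finite (f := fun y : {y // y ∈ S} => d x y.1)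
  exact ⟨y.1, y.2, hy⟩

theorem le_distTo_iff (hS : S.Nonempty) {r : ℝ} : r ≤ distTo d x S ↔ ∀ y ∈ S, r ≤ d x y := by
  refine ⟨fun h y hy => h.trans (distTo_le hy), fun h => ?_⟩
  obtain ⟨y, hy, hxy⟩ := exists_distTo_eq (d := d) (x := x) hS
  exact hxy ▸ h y hy

end DistTo

/-! ### A promising guess -/

theorem exists_nat_between {z : ℝ} {B : ℕ} (hB : 0 < B) (hz : 0 ≤ z) (hzB : z ≤ B) :
    ∃ y < B, z ≤ (y : ℝ) + 1 ∧ (y : ℝ) ≤ z := by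
  rcases hz.eq_or_lt with rfl | hz
  · exact ⟨0, hB, by simp, by simp⟩
  · have h₁ : 0 < ⌈z⌉₊ := Nat.ceil_pos.2 hz
    have h₂ : ⌈z⌉₊ ≤ B := Nat.ceil_le.2 hzB
    have h₃ : ((⌈z⌉₊ - 1 : ℕ) : ℝ) = (⌈z⌉₊ : ℝ) - 1 := by rw [Nat.cast_sub h₁, Nat.cast_one]
    refine ⟨⌈z⌉₊ - 1, by omega, ?_, ?_⟩ <;> rw [h₃]
    · linarith [Nat.le_ceil z]
    · linarith [Nat.ceil_lt_add_one hz.le]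

namespace Instance

variable {V : Type u} [MetricSpace V] (I : Instance V)

theorem IsSolution.nonempty {V : Type u} {I : Instance V} {T : Finset V}
    (hT : I.IsSolution T) : T.Nonempty := by
  rw [← Finset.card_pos, hT.2]; exact I.k_pos

theorem distTo_nonneg {T : Finset V} (hT : T.Nonempty) (j : V) : 0 ≤ distTo dist j T :=
  (le_distTo_iff hT).2 fun _ _ => dist_nonneg

theorem cost_nonneg {T : Finset V} (hT : T.Nonempty) : 0 ≤ I.cost T :=
  Finset.sum_nonneg fun j hj => mul_nonneg (I.weight_nonneg j hj) (distTo_nonneg hT j)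

/-- Let `t` be the closest center of the clients in `S`, all of positive weight.  With the client of `S`
that is closest to `t` as the leader, and with the heaviest client of `S`, some multiple of `Q / (B w)`
is a radius `R` for which `t` is admissible and the leader serves all of `S` well. -/
theorem exists_leader {S : Finset V} (hS : S.Nonempty) {Q : ℝ} {B : ℕ} (hB : 0 < B) {t : V}
    (hpos : ∀ j ∈ S, 0 < I.weight j) (hQ : ∀ j ∈ S, I.weight j * dist j t ≤ Q) :
    ∃ l ∈ S, ∃ h ∈ S, ∃ y < B, dist t l ≤ ((y : ℝ) + 1) * Q / (B * I.weight h) ∧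
      ∀ j ∈ S, dist j l + ((y : ℝ) + 1) * Q / (B * I.weight h) ≤
        3 * dist j t + Q / (B * I.weight j) := by
  obtain ⟨l, hl, hlmin⟩ := S.exists_min_image (fun j => dist j t) hS
  obtain ⟨h, hh, hhmax⟩ := S.exists_max_image I.weight hS
  have hB' : (0 : ℝ) < B := by exact_mod_cast hB
  have hw := hpos h hh
  have hBw : 0 < B * I.weight h := mul_pos hB' hw
  have hQ₀ : 0 ≤ Q := (mul_nonneg hw.le dist_nonneg).trans (hQ h hh)
  have hD : I.weight h * dist l t ≤ Q :=
    (mul_le_mul_of_nonneg_left (hlmin h hh) hw.le).trans (hQ h hh)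
  obtain ⟨y, hyB, hy₁, hy₂⟩ : ∃ y < B, dist l t ≤ ((y : ℝ) + 1) * Q / (B * I.weight h) ∧
      (y : ℝ) * Q / (B * I.weight h) ≤ dist l t := by
    rcases hQ₀.eq_or_lt with hQ₀ | hQ₀
    · refine ⟨0, hB, ?_, ?_⟩
      · rw [← hQ₀] at hD ⊢
        have : dist l t ≤ 0 := nonpos_of_mul_nonpos_right hD hw
        simpa using this
      · simp [← hQ₀]
    · obtain ⟨y, hyB, hy₁, hy₂⟩ := exists_nat_between (z := dist l t * (B * I.weight h) / Q) hB
        (by positivity) (by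
          rw [div_le_iff₀ hQ₀]
          nlinarith)
      refine ⟨y, hyB, ?_, ?_⟩
      · rwa [le_div_iff₀ hBw, ← div_le_iff₀ hQ₀]
      · rwa [div_le_iff₀ hBw, ← le_div_iff₀ hQ₀]
  refine ⟨l, hl, h, hh, y, hyB, by rwa [dist_comm], fun j hj => ?_⟩
  have h₁ : Q / (B * I.weight h) ≤ Q / (B * I.weight j) :=
    div_le_div_of_nonneg_left hQ₀ (mul_pos hB' (hpos j hj))
      (mul_le_mul_of_nonneg_left (hhmax j hj) hB'.le)
  have h₂ := hlmin j hj
  have h₃ := dist_triangle_right j l t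
  rw [add_mul, one_mul, add_div]
  linarith

/-- For every solution `T` some guess leads to the facilities of `T`.  Only the clients `P` of positive
weight matter; a center without such clients receives the guess of another one. -/
theorem exists_guess {T P : Finset V} (hT : I.IsSolution T) (hP : P.Nonempty)
    (hPC : ∀ j ∈ P, j ∈ I.clients ∧ 0 < I.weight j) {B : ℕ} (hB : 0 < B) :
    ∃ q ∈ P, ∃ q' ∈ T, I.weight q * dist q q' ≤ I.cost T ∧
      ∃ (L H o : ℕ → V) (y : ℕ → ℕ), ∀ R : ℕ → ℝ,
        (∀ i, R i = ((y i : ℝ) + 1) * (I.weight q * dist q q') / (B * I.weight (H i))) →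
        (∀ i, L i ∈ P ∧ H i ∈ P ∧ o i ∈ T ∧ y i < B ∧ dist (o i) (L i) ≤ R i) ∧
        ∀ j ∈ P, ∃ i < I.k, dist j (o i) ≤ distTo dist j T ∧
          dist j (L i) + R i ≤
            3 * distTo dist j T + I.weight q * dist q q' / (B * I.weight j) := by
  classical
  choose near hnear hdist using
    fun j : V => exists_distTo_eq (d := dist) (x := j) hT.nonempty
  obtain ⟨q, hq, hqmax⟩ := P.exists_max_image (fun j => I.weight j * distTo dist j T) hP
  refine ⟨q, hq, near q, hnear q, ?_, ?_⟩
  · rw [hdist]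
    exact Finset.single_le_sum (f := fun j => I.weight j * distTo dist j T)
      (fun j hj => mul_nonneg (I.weight_nonneg j hj) (distTo_nonneg hT.nonempty j)) (hPC q hq).1
  -- `rep t` is `t` if `t` is the closest center of a client in `P`, and another such center if not
  have key : ∀ t : V, ∃ t' ∈ T, (∃ j ∈ P, near j = t') ∧ ((∃ j ∈ P, near j = t) → t' = t) := by
    intro t
    by_cases h : ∃ j ∈ P, near j = t
    · obtain ⟨j, hj, rfl⟩ := h
      exact ⟨near j, hnear j, ⟨j, hj, rfl⟩, fun _ => rfl⟩
    · exact ⟨near q, hnear q, ⟨q, hq, rfl⟩, fun h' => absurd h' h⟩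
  choose rep hrepT hrep hrep' using key
  have hlead := fun t => I.exists_leader (S := P.filter fun j => near j = rep t)
    (Q := I.weight q * dist q (near q)) (t := rep t) (by
      obtain ⟨j, hj, hj'⟩ := hrep t
      exact ⟨j, Finset.mem_filter.2 ⟨hj, hj'⟩⟩) hB
    (fun j hj => (hPC j (Finset.mem_filter.1 hj).1).2) (fun j hj => by
      rw [← (Finset.mem_filter.1 hj).2, hdist, hdist]
      exact hqmax j (Finset.mem_filter.1 hj).1)
  choose l hl h hh y hy hR₁ hR₂ using hlead
  obtain ⟨c, hc⟩ : ∃ c : ℕ → V, ∀ t ∈ T, ∃ i < I.k, c i = t := by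
    obtain ⟨q₀, hq₀⟩ := hT.nonempty
    refine ⟨fun i => if h : i < I.k then ((T.equivFinOfCardEq hT.2).symm ⟨i, h⟩ : V) else q₀,
      fun t ht => ⟨T.equivFinOfCardEq hT.2 ⟨t, ht⟩, Fin.is_lt _, ?_⟩⟩
    simp
  refine ⟨fun i => l (c i), fun i => h (c i), fun i => rep (c i), fun i => y (c i),
    fun R hR => ⟨fun i => ⟨(Finset.mem_filter.1 (hl _)).1, (Finset.mem_filter.1 (hh _)).1, hrepT _,
      hy _, by rw [hR]; exact hR₁ (c i)⟩, fun j hj => ?_⟩⟩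
  obtain ⟨i, hi, hci⟩ := hc (near j) (hnear j)
  have ht : rep (c i) = near j := by rw [hci]; exact hrep' _ ⟨j, hj, rfl⟩
  refine ⟨i, hi, by simp only [ht]; exact (hdist j).le, ?_⟩
  have := hR₂ (c i) j (Finset.mem_filter.2 ⟨hj, ht.symm⟩)
  rw [ht] at this
  rw [hR, ← hdist j]
  exact this

end Instance

/-! ### The approximation ratio and the running time -/

theorem exp_one_le_one_add_inv_pow {B : ℕ} (hB : 0 < B) :
    Real.exp 1 ≤ (1 + 1 / (B : ℝ)) ^ (B + 1) := by
  have hB' : (0 : ℝ) < B := by exact_mod_cast hB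
  have h₁ : (B : ℝ) / (B + 1) ≤ Real.exp (-(1 / ((B : ℝ) + 1))) := by
    have := Real.add_one_le_exp (-(1 / ((B : ℝ) + 1)))
    refine le_trans (le_of_eq ?_) this
    field_simp
    ring
  have h₂ := pow_le_pow_left₀ (by positivity) h₁ (B + 1)
  rw [← Real.exp_nat_mul] at h₂
  have h₃ : ((B + 1 : ℕ) : ℝ) * -(1 / ((B : ℝ) + 1)) = -1 := by
    push_cast
    field_simp
  rw [h₃, Real.exp_neg] at h₂
  have h₄ : (1 + 1 / (B : ℝ)) ^ (B + 1) = (((B : ℝ) / (B + 1)) ^ (B + 1))⁻¹ := by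
    rw [← inv_pow, inv_div]
    congr 1
    field_simp
  rw [h₄]
  exact (le_inv_comm₀ (by positivity) (Real.exp_pos 1)).1 h₂

/-- The greedy guarantee with the bound `(3 + m / B) x` for the initial cost, for `B` rounds. -/
theorem ratio_le {B m : ℕ} {ε x U : ℝ} (hm : 0 < m) (hmB : m < B) (hε : (m : ℝ) ≤ B * ε)
    (hx : 0 ≤ x) (hU : U ≤ 3 * x + m * (x / B)) :
    x + (U - x) / (1 + 1 / (B : ℝ)) ^ B ≤ (1 + 2 / Real.exp 1 + 2 * ε) * x := by
  have hB : 0 < B := by omega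
  have hB' : (0 : ℝ) < B := by exact_mod_cast hB
  have hB₁ : (1 : ℝ) ≤ B := by exact_mod_cast hB
  have hm' : (1 : ℝ) ≤ m := by exact_mod_cast hm
  have he : (2 : ℝ) ≤ Real.exp 1 := by linarith [Real.add_one_le_exp (1 : ℝ)]
  set r := 1 / (B : ℝ) with hr
  have hr₀ : 0 < r := by positivity
  have hr₁ : r ≤ 1 := by rw [hr, div_le_one hB']; exact hB₁
  have hs : m * r ≤ ε := by rw [hr, mul_one_div, div_le_iff₀ hB']; linarith
  have hrε : r ≤ ε := le_trans (by nlinarith) hs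
  have hq : 0 < (1 + r) ^ B := by positivity
  have h₁ : (U - x) / (1 + r) ^ B ≤ (2 + m * r) * x * (1 + r) / Real.exp 1 := by
    rw [div_le_div_iff₀ hq (Real.exp_pos 1)]
    have h₂ : U - x ≤ (2 + m * r) * x := by
      have : x / B = r * x := by rw [hr]; ring
      rw [this] at hU
      linarith
    have h₃ := exp_one_le_one_add_inv_pow hB
    rw [← hr, pow_succ] at h₃
    have h₄ : 0 ≤ (2 + m * r) * x := by positivity
    calc (U - x) * Real.exp 1 ≤ (2 + m * r) * x * Real.exp 1 := by gcongr
      _ ≤ (2 + m * r) * x * ((1 + r) ^ B * (1 + r)) := by gcongr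
      _ = _ := by ring
  have h₅ : (2 + m * r) * (1 + r) ≤ 2 + 4 * ε := by nlinarith
  have h₆ : (2 + m * r) * x * (1 + r) / Real.exp 1 ≤ (2 + 4 * ε) / Real.exp 1 * x := by
    rw [div_mul_eq_mul_div]
    gcongr ?_ / _
    nlinarith
  have h₇ : (2 + 4 * ε) / Real.exp 1 ≤ 2 / Real.exp 1 + 2 * ε := by
    rw [add_div]
    gcongr
    rw [div_le_iff₀ (Real.exp_pos 1)]
    nlinarith
  nlinarith [mul_le_mul_of_nonneg_right h₇ hx]

/-- Powers of a logarithm are absorbed by one factor `n`: this is why guessing a bounded number of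
clients and radii is affordable. -/
theorem one_add_log_pow_le {n : ℕ} (hn : 0 < n) (p : ℕ) :
    (1 + Real.log n) ^ p ≤ p.factorial * Real.exp 1 * n := by
  have hn' : (0 : ℝ) < n := by exact_mod_cast hn
  have hlog : 0 ≤ Real.log n := Real.log_natCast_nonneg n
  have h := Real.pow_div_factorial_le_exp (1 + Real.log n) (by linarith) p
  rw [div_le_iff₀ (by positivity), Real.exp_add, Real.exp_log hn'] at h
  linarith

/-- The factor in the bound for the number of rounds of the loops. -/
noncomputable def roundsFactor (A : ℝ) (k : ℕ) (ε : ℝ) : ℝ :=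
  1 + 3 * k + (2 + |A| * ε⁻¹ ^ 2 * k * (1 + ε⁻¹)) ^ (3 * k) * ((3 * k).factorial * Real.exp 1)

theorem rounds_le {A ε : ℝ} {n k m : ℕ} (hε : 0 < ε) (hn : 0 < n)
    (hm : (m : ℝ) ≤ A * ε⁻¹ ^ 2 * k * Real.log n) :
    ((n + 3 * k + (m + 1 + ⌈m / ε⌉₊) ^ (3 * k) : ℕ) : ℝ) ≤ roundsFactor A k ε * n := by
  have hn₁ : (1 : ℝ) ≤ n := by exact_mod_cast hn
  have hlog : 0 ≤ Real.log n := Real.log_natCast_nonneg n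
  have hε' : 0 < ε⁻¹ := inv_pos.2 hε
  set a := |A| * ε⁻¹ ^ 2 * k with ha
  have ha₀ : 0 ≤ a := by positivity
  have hm' : (m : ℝ) ≤ a * Real.log n := by
    refine hm.trans ?_
    rw [ha]
    gcongr
    exact le_abs_self A
  have h₁ : ((m + 1 + ⌈m / ε⌉₊ : ℕ) : ℝ) ≤ (2 + a * (1 + ε⁻¹)) * (1 + Real.log n) := by
    have h₂ := (Nat.ceil_lt_add_one (a := (m : ℝ) / ε) (by positivity)).le
    have h₃ : (m : ℝ) / ε ≤ a * Real.log n * ε⁻¹ := by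
      rw [div_eq_mul_inv]
      gcongr
    push_cast
    have h₄ : 0 ≤ a * (1 + ε⁻¹) := by positivity
    nlinarith
  have h₂ : ((m + 1 + ⌈m / ε⌉₊ : ℕ) : ℝ) ^ (3 * k) ≤
      (2 + a * (1 + ε⁻¹)) ^ (3 * k) * ((3 * k).factorial * Real.exp 1) * n := by
    calc ((m + 1 + ⌈m / ε⌉₊ : ℕ) : ℝ) ^ (3 * k)
        ≤ ((2 + a * (1 + ε⁻¹)) * (1 + Real.log n)) ^ (3 * k) := by gcongr
      _ ≤ (2 + a * (1 + ε⁻¹)) ^ (3 * k) * ((3 * k).factorial * Real.exp 1 * n) := by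
        rw [mul_pow]
        gcongr
        exact one_add_log_pow_le hn _
      _ = _ := by ring
  have h₃ : (3 * k : ℝ) ≤ 3 * k * n := le_mul_of_one_le_right (by positivity) hn₁
  rw [Nat.cast_add, Nat.cast_add, Nat.cast_pow, roundsFactor, ← ha]
  push_cast at h₂ ⊢
  linarith

/-! ### Fictitious facilities -/

theorem le_roundUp {ε a : ℝ} (hε : 0 < ε) (ha : 0 ≤ a) : a ≤ roundUp ε a := by
  unfold roundUp
  split_ifs with h
  · exact h.le
  · have ha' : 0 < a := lt_of_le_of_ne ha (Ne.symm h)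
    calc a = (1 + ε) ^ Real.logb (1 + ε) a :=
          (Real.rpow_logb (by linarith) (by linarith) ha').symm
      _ ≤ (1 + ε) ^ ((⌈Real.logb (1 + ε) a⌉ : ℤ) : ℝ) :=
          Real.rpow_le_rpow_of_exponent_le (by linarith) (Int.le_ceil _)
      _ = _ := Real.rpow_intCast _ _

theorem roundUp_le {ε a : ℝ} (hε : 0 < ε) (ha : 0 ≤ a) : roundUp ε a ≤ (1 + ε) * a := by
  unfold roundUp
  split_ifs with h
  · rw [h, mul_zero]
  · have ha' : 0 < a := lt_of_le_of_ne ha (Ne.symm h)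
    calc (1 + ε) ^ ⌈Real.logb (1 + ε) a⌉
        = (1 + ε) ^ ((⌈Real.logb (1 + ε) a⌉ : ℤ) : ℝ) := (Real.rpow_intCast _ _).symm
      _ ≤ (1 + ε) ^ (1 + Real.logb (1 + ε) a) :=
          Real.rpow_le_rpow_of_exponent_le (by linarith)
            (by linarith [Int.ceil_lt_add_one (Real.logb (1 + ε) a)])
      _ = (1 + ε) * a := by
          rw [Real.rpow_add (by linarith), Real.rpow_one,
            Real.rpow_logb (by linarith) (by linarith) ha']

namespace Instance

variable {V : Type u} [MetricSpace V] (I : Instance V) {ε : ℝ} {ℓ : Fin I.k → V}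
  {R : Fin I.k → ℝ}

theorem dist_le_of_mem_candidates (hε : 0 < ε) {i : Fin I.k} {f : V}
    (hf : f ∈ I.candidates ε ℓ R i) : dist f (ℓ i) ≤ R i := by
  have := (Finset.mem_filter.1 hf).2
  rw [← this]
  exact le_roundUp hε dist_nonneg

theorem ciInf_add_candidates (hne : ∀ i, (I.candidates ε ℓ R i).Nonempty) (i : Fin I.k) (r : ℝ)
    (g : V → ℝ) :
    ⨅ f : {f // f ∈ I.candidates ε ℓ R i}, (r + g f.1) =
      r + ⨅ f : {f // f ∈ I.candidates ε ℓ R i}, g f.1 := by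
  have : Nonempty {f // f ∈ I.candidates ε ℓ R i} := (hne i).to_subtype
  exact ((OrderIso.addLeft r).map_ciInf (Set.finite_range _).bddBelow).symm

theorem fictDist_eq (hne : ∀ i, (I.candidates ε ℓ R i).Nonempty) (i : Fin I.k) (v : V) :
    I.fictDist ε ℓ R i v = 2 * R i + distTo dist v (I.candidates ε ℓ R i) := by
  unfold fictDist
  split_ifs with h
  · have h₁ : distTo dist v (I.candidates ε ℓ R i) ≤ dist v v := distTo_le h
    have h₂ := distTo_nonneg (hne i) v
    rw [dist_self] at h₁
    linarith
  · rw [I.ciInf_add_candidates hne i _ fun f => dist f v]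
    simp only [distTo, dist_comm v]

/-- The points of `V` from which a path to `x` starts: `v` itself for a point `v` of `V`, and the
candidates of `i` for the fictitious facility `i`. -/
noncomputable def gate (ε : ℝ) (ℓ : Fin I.k → V) (R : Fin I.k → ℝ) : V ⊕ Fin I.k → Finset V
  | Sum.inl v => {v}
  | Sum.inr i => I.candidates ε ℓ R i

/-- The distance of a point of `V ∪ F'` to each point of its gate. -/
def height {V : Type u} (I : Instance V) (R : Fin I.k → ℝ) : V ⊕ Fin I.k → ℝ
  | Sum.inl _ => 0
  | Sum.inr i => 2 * R i

theorem gate_nonempty (hne : ∀ i, (I.candidates ε ℓ R i).Nonempty) (x : V ⊕ Fin I.k) :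
    (I.gate ε ℓ R x).Nonempty := by
  cases x with
  | inl v => exact Finset.singleton_nonempty v
  | inr i => exact hne i

theorem dist_le_height (hε : 0 < ε) {x : V ⊕ Fin I.k} {p q : V} (hp : p ∈ I.gate ε ℓ R x)
    (hq : q ∈ I.gate ε ℓ R x) : dist p q ≤ I.height R x := by
  cases x with
  | inl v =>
    rw [gate, Finset.mem_singleton] at hp hq
    rw [hp, hq, dist_self]
    exact le_rfl
  | inr i =>
    have h₁ := I.dist_le_of_mem_candidates hε hp
    have h₂ := I.dist_le_of_mem_candidates hε hq
    have h₃ := dist_triangle_right p q (ℓ i)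
    simp only [height]
    linarith

/-- The extended distance of two different points is the length of a shortest path through their
gates. -/
theorem extDist_spec (hne : ∀ i, (I.candidates ε ℓ R i).Nonempty) {x y : V ⊕ Fin I.k}
    (hxy : x ≠ y) :
    (∀ p ∈ I.gate ε ℓ R x, ∀ q ∈ I.gate ε ℓ R y,
      I.extDist ε ℓ R x y ≤ I.height R x + dist p q + I.height R y) ∧
    ∃ p ∈ I.gate ε ℓ R x, ∃ q ∈ I.gate ε ℓ R y,
      I.extDist ε ℓ R x y = I.height R x + dist p q + I.height R y := by
  have hfict : ∀ (v : V) (i : Fin I.k),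
      (∀ q ∈ I.candidates ε ℓ R i, I.fictDist ε ℓ R i v ≤ dist v q + 2 * R i) ∧
      ∃ q ∈ I.candidates ε ℓ R i, I.fictDist ε ℓ R i v = dist v q + 2 * R i := by
    intro v i
    rw [I.fictDist_eq hne]
    refine ⟨fun q hq => by linarith [distTo_le (d := dist) (x := v) hq], ?_⟩
    obtain ⟨q, hq, hvq⟩ := exists_distTo_eq (d := dist) (x := v) (hne i)
    exact ⟨q, hq, by rw [hvq]; ring⟩
  have hfict₂ : ∀ i j : Fin I.k,
      (∀ p ∈ I.candidates ε ℓ R i, ∀ q ∈ I.candidates ε ℓ R j,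
        ⨅ f : {f // f ∈ I.candidates ε ℓ R i}, (2 * R i + I.fictDist ε ℓ R j f.1) ≤
          2 * R i + dist p q + 2 * R j) ∧
      ∃ p ∈ I.candidates ε ℓ R i, ∃ q ∈ I.candidates ε ℓ R j,
        ⨅ f : {f // f ∈ I.candidates ε ℓ R i}, (2 * R i + I.fictDist ε ℓ R j f.1) =
          2 * R i + dist p q + 2 * R j := by
    intro i j
    constructor
    · intro p hp q hq
      refine (ciInf_le (Set.finite_range _).bddBelow ⟨p, hp⟩).trans ?_
      linarith [(hfict p j).1 q hq]
    · have : Nonempty {f // f ∈ I.candidates ε ℓ R i} := (hne i).to_subtype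
      obtain ⟨p, hp⟩ := exists_eq_ciInf_of_finite
        (f := fun f : {f // f ∈ I.candidates ε ℓ R i} => 2 * R i + I.fictDist ε ℓ R j f.1)
      obtain ⟨q, hq, hpq⟩ := (hfict p.1 j).2
      exact ⟨p.1, p.2, q, hq, by rw [← hp, hpq]; ring⟩
  cases x with
  | inl u =>
    cases y with
    | inl v => simp [gate, extDist, height]
    | inr i =>
      obtain ⟨h₁, q, hq, h₂⟩ := hfict u i
      simp only [gate, extDist, height, Finset.mem_singleton, forall_eq, exists_eq_left, zero_add]
      exact ⟨h₁, q, hq, h₂⟩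
  | inr i =>
    cases y with
    | inl v =>
      obtain ⟨h₁, q, hq, h₂⟩ := hfict v i
      simp only [gate, extDist, height, Finset.mem_singleton, forall_eq, exists_eq_left, add_zero]
      refine ⟨fun p hp => ?_, q, hq, ?_⟩
      · rw [add_comm, dist_comm]; exact h₁ p hp
      · rw [add_comm (2 * R i), dist_comm]; exact h₂
    | inr j =>
      have hij : i ≠ j := fun h => hxy (congrArg _ h)
      simp only [gate, extDist, height, if_neg hij]
      split_ifs
      · exact hfict₂ i j
      · obtain ⟨h₁, q, hq, p, hp, h₂⟩ := hfict₂ j i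
        refine ⟨fun p hp q hq => (h₁ q hq p hp).trans (le_of_eq ?_), p, hp, q, hq, h₂.trans ?_⟩
        · rw [dist_comm]; ring
        · rw [dist_comm]; ring

theorem extDist_self (x : V ⊕ Fin I.k) : I.extDist ε ℓ R x x = 0 := by
  cases x <;> simp [extDist]

theorem extDist_comm (x y : V ⊕ Fin I.k) : I.extDist ε ℓ R x y = I.extDist ε ℓ R y x := by
  cases x with
  | inl u => cases y <;> simp [extDist, dist_comm]
  | inr i =>
    cases y with
    | inl v => simp [extDist]
    | inr j =>
      rcases lt_trichotomy i j with h | rfl | h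
      · simp [extDist, h, h.ne, h.ne', not_lt.2 h.le]
      · rfl
      · simp [extDist, h, h.ne, h.ne', not_lt.2 h.le]

/-- The detour through `y` costs at least the distance of two points in the gate of `y`, because the
radius of a set of candidates is at most half of its height. -/
theorem extDist_triangle (hε : 0 < ε) (hne : ∀ i, (I.candidates ε ℓ R i).Nonempty)
    (x y z : V ⊕ Fin I.k) :
    I.extDist ε ℓ R x z ≤ I.extDist ε ℓ R x y + I.extDist ε ℓ R y z := by
  have hheight : ∀ x, 0 ≤ I.height R x := fun x => by
    obtain ⟨p, hp⟩ := I.gate_nonempty hne x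
    exact dist_nonneg.trans (I.dist_le_height hε hp hp)
  by_cases hxy : x = y
  · rw [hxy, extDist_self, zero_add]
  by_cases hyz : y = z
  · rw [hyz, extDist_self, add_zero]
  obtain ⟨p, hp, q, hq, h₁⟩ := (I.extDist_spec hne hxy).2
  obtain ⟨q', hq', r, hr, h₂⟩ := (I.extDist_spec hne hyz).2
  have hqq := I.dist_le_height hε hq hq'
  have hx := hheight x
  have hy := hheight y
  have hz := hheight z
  by_cases hxz : x = z
  · have h₀ : I.extDist ε ℓ R x z = 0 := by rw [hxz, extDist_self]
    rw [h₀, h₁, h₂]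
    have := dist_nonneg (x := p) (y := q)
    have := dist_nonneg (x := q') (y := r)
    linarith
  · have h₃ := (I.extDist_spec hne hxz).1 p hp r hr
    have h₄ := dist_triangle4 p q q' r
    linarith

theorem eq_of_extDist_eq_zero (hne : ∀ i, (I.candidates ε ℓ R i).Nonempty) (hR : ∀ i, 0 < R i)
    {x y : V ⊕ Fin I.k} (h : I.extDist ε ℓ R x y = 0) : x = y := by
  by_contra hxy
  obtain ⟨p, hp, q, hq, h₁⟩ := (I.extDist_spec hne hxy).2
  have h₂ := dist_nonneg (x := p) (y := q)
  cases x with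
  | inl u =>
    cases y with
    | inl v => exact hxy (congrArg _ (dist_eq_zero.1 h))
    | inr i => simp only [height] at h₁; linarith [hR i]
  | inr i =>
    cases y with
    | inl v => simp only [height] at h₁; linarith [hR i]
    | inr j => simp only [height] at h₁; linarith [hR i, hR j]

/-- The extended distance function as a pseudometric. -/
noncomputable abbrev extPseudoMetric (hε : 0 < ε) (hne : ∀ i, (I.candidates ε ℓ R i).Nonempty) :
    PseudoMetricSpace (V ⊕ Fin I.k) where
  dist := I.extDist ε ℓ R
  dist_self := I.extDist_self
  dist_comm := I.extDist_comm
  dist_triangle := I.extDist_triangle hε hne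

section Improv

variable (ε ℓ R)

/-- The distance of the client `j` to `S ∪ F'`. -/
noncomputable def extDistTo (S : Finset V) (j : V) : ℝ :=
  distTo (I.extDist ε ℓ R) (Sum.inl j) (S.disjSum (Finset.univ : Finset (Fin I.k)))

variable {ε ℓ R}

theorem disjSum_univ_nonempty {V : Type u} (I : Instance V) (S : Finset V) :
    (S.disjSum (Finset.univ : Finset (Fin I.k))).Nonempty :=
  ⟨Sum.inr ⟨0, I.k_pos⟩, Finset.inr_mem_disjSum.2 (Finset.mem_univ _)⟩

theorem extDistTo_mono {S T : Finset V} (h : S ⊆ T) (j : V) :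
    I.extDistTo ε ℓ R T j ≤ I.extDistTo ε ℓ R S j := by
  refine (le_distTo_iff (I.disjSum_univ_nonempty S)).2 fun y hy => distTo_le ?_
  exact Finset.disjSum_mono h subset_rfl hy

open Classical in
theorem extDistTo_insert (S : Finset V) (f j : V) :
    I.extDistTo ε ℓ R (insert f S) j = min (I.extDistTo ε ℓ R S j) (dist j f) := by
  refine eq_of_forall_le_iff fun r => ?_
  rw [le_min_iff, extDistTo, extDistTo, le_distTo_iff (I.disjSum_univ_nonempty _),
    le_distTo_iff (I.disjSum_univ_nonempty _)]
  refine ⟨fun h => ⟨fun y hy => h y ?_, ?_⟩, fun h y hy => ?_⟩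
  · exact Finset.disjSum_mono (Finset.subset_insert f S) subset_rfl hy
  · exact h (Sum.inl f) (by simp)
  · cases y with
    | inl v =>
      rcases Finset.mem_insert.1 (Finset.inl_mem_disjSum.1 hy) with rfl | hv
      · exact h.2
      · exact h.1 _ (Finset.inl_mem_disjSum.2 hv)
    | inr i => exact h.1 _ (by simp)

theorem extCost_mono {S T : Finset V} (h : S ⊆ T) :
    I.extCost ε ℓ R T ≤ I.extCost ε ℓ R S :=
  Finset.sum_le_sum fun j hj =>
    mul_le_mul_of_nonneg_left (I.extDistTo_mono h j) (I.weight_nonneg j hj)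

theorem improv_submodular (U : Finset V) : SubmodularOnSubsets U (I.improv ε ℓ R) := by
  classical
  intro S T hST _ f _
  have key : ∀ S, I.improv ε ℓ R (insert f S) - I.improv ε ℓ R S =
      ∑ j ∈ I.clients, I.weight j *
        (I.extDistTo ε ℓ R S j - min (I.extDistTo ε ℓ R S j) (dist j f)) := by
    intro S
    simp only [← extDistTo_insert, mul_sub, Finset.sum_sub_distrib]
    unfold improv extCost extDistTo
    ring
  have key' := key S
  have key'' := key T
  refine le_trans (le_of_eq ?_) (le_trans (Finset.sum_le_sum (f := fun j => I.weight j *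
        (I.extDistTo ε ℓ R T j - min (I.extDistTo ε ℓ R T j) (dist j f)))
        (g := fun j => I.weight j *
        (I.extDistTo ε ℓ R S j - min (I.extDistTo ε ℓ R S j) (dist j f))) fun j hj =>
          mul_le_mul_of_nonneg_left ?_ (I.weight_nonneg j hj)) (le_of_eq ?_))
  · rw [← key'']
  · have := I.extDistTo_mono (ε := ε) (ℓ := ℓ) (R := R) hST j
    rcases le_total (I.extDistTo ε ℓ R T j) (dist j f) with h | h
    · rw [min_eq_left h, sub_self, sub_nonneg]; exact min_le_left _ _
    · rw [min_eq_right h, min_eq_right (h.trans this)]; linarith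
  · rw [← key']

end Improv

/-- A client `j` in the cluster of `c i` is at distance at most `2 R_i + d(j, c i)` from the
fictitious facility `i`, and `R_i ≤ (1 + ε) d(j, c i)` as the leader is closest to `c i`. -/
theorem extCost_le (hε : 0 < ε) (c : Fin I.k ↪ V) (hne : ∀ i, c i ∈ I.candidates ε ℓ R i)
    (hℓ : ∀ i, I.IsLeader c ℓ i) (hR : ∀ i, R i = roundUp ε (dist (ℓ i) (c i))) :
    I.extCost ε ℓ R ∅ ≤ (3 + 2 * ε) * I.cost (Finset.univ.map c) := by
  rw [extCost, cost, Finset.mul_sum]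
  refine Finset.sum_le_sum fun j hj => ?_
  rw [mul_left_comm]
  refine mul_le_mul_of_nonneg_left ?_ (I.weight_nonneg j hj)
  have hmap : (Finset.univ.map c).Nonempty := ⟨c ⟨0, I.k_pos⟩, by simp⟩
  obtain ⟨y, hy, hjy⟩ := exists_distTo_eq (d := dist) (x := j) hmap
  obtain ⟨i, _, rfl⟩ := Finset.mem_map.1 hy
  have hcl : j ∈ I.cluster c i := Finset.mem_filter.2 ⟨hj, hjy⟩
  have h₁ := (hℓ i ⟨j, hcl⟩).2 j hcl
  have h₂ : R i ≤ (1 + ε) * dist (ℓ i) (c i) := by rw [hR]; exact roundUp_le hε dist_nonneg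
  have h₃ : distTo (I.extDist ε ℓ R) (Sum.inl j) ((∅ : Finset V).disjSum Finset.univ) ≤
      I.fictDist ε ℓ R i j := distTo_le (Finset.inr_mem_disjSum.2 (Finset.mem_univ i))
  rw [I.fictDist_eq fun i => ⟨_, hne i⟩] at h₃
  have h₄ : distTo dist j (I.candidates ε ℓ R i) ≤ dist j (c i) := distTo_le (hne i)
  rw [← hjy]
  nlinarith

end Instance

/-! ### The input memory -/

theorem card_filter_range {V : Type u} {n : ℕ} (e : Fin n ≃ V) (p : V → Prop) (q : ℕ → Prop)
    [DecidablePred q]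
    (h : ∀ j : Fin n, q j ↔ p (e j)) (S : Finset V) (hS : ∀ v, v ∈ S ↔ p v) :
    ((Finset.range n).filter q).card = S.card := by
  refine (Finset.card_bij (fun v _ => (e.symm v : ℕ)) (fun v hv => ?_) (fun v _ v' _ hvv => ?_)
    fun j hj => ?_).symm
  · rw [Finset.mem_filter, Finset.mem_range, h, e.apply_symm_apply]
    exact ⟨Fin.is_lt _, (hS v).1 hv⟩
  · exact e.symm.injective (Fin.ext hvv)
  · rw [Finset.mem_filter, Finset.mem_range] at hj
    refine ⟨e ⟨j, hj.1⟩, (hS _).2 ((h ⟨j, hj.1⟩).1 hj.2), by simp⟩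

namespace Instance

variable {V : Type u} [MetricSpace V] (I : Instance V) {n : ℕ} (e : Fin n ≃ V) (ε : ℝ)

theorem input_n : (I.input e ε).nat 0 0 0 = n := by simp [input]

theorem input_k : (I.input e ε).nat 0 0 1 = I.k := by simp [input]

theorem input_epsilon : (I.input e ε).real 0 0 0 = ε := by simp [input]

open Classical in
theorem input_client (j : Fin n) :
    (I.input e ε).nat 1 j 0 = if e j ∈ I.clients then 1 else 0 := by
  simp [input]

open Classical in
theorem input_facility (j : Fin n) :
    (I.input e ε).nat 2 j 0 = if e j ∈ I.facilities then 1 else 0 := by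
  simp [input]

theorem input_nat_of_le {a : ℕ} (ha : 3 ≤ a) (i j : ℕ) : (I.input e ε).nat a i j = 0 := by
  have h₀ : a ≠ 0 := by omega
  have h₁ : a ≠ 1 := by omega
  have h₂ : a ≠ 2 := by omega
  simp [input, h₀, h₁, h₂]

theorem input_dist (i j : Fin n) : (I.input e ε).real 1 i j = dist (e i) (e j) := by
  simp [input]

open Classical in
theorem input_weight (j : Fin n) :
    (I.input e ε).real 2 j 0 = if e j ∈ I.clients then I.weight (e j) else 0 := by
  simp [input]

theorem input_weight_nonneg (j : Fin n) : 0 ≤ (I.input e ε).real 2 j 0 := by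
  rw [input_weight]
  split_ifs with h
  · exact I.weight_nonneg _ h
  · exact le_rfl

/-- The cost of a solution in terms of the input memory. -/
theorem sum_input_weight (g : V → ℝ) (c : ℕ → ℝ) (hc : ∀ j : Fin n, c j = g (e j)) :
    ∑ j ∈ Finset.range n, (I.input e ε).real 2 j 0 * c j =
      ∑ v ∈ I.clients, I.weight v * g v := by
  classical
  have : Fintype V := Fintype.ofEquiv _ e
  rw [Finset.sum_range]
  simp only [input_weight, hc, ite_mul, zero_mul]
  rw [e.sum_comp fun v => if v ∈ I.clients then I.weight v * g v else 0, Finset.sum_ite_mem,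
    Finset.univ_inter]

/-- The program `mainProg` computes a `(1 + 2/e + 2ε)`-approximate solution. -/
theorem mainProg_isApprox (hε : 0 < ε) : Exec
    (n + 3 * I.k + (I.clients.card + 1 + ⌈I.clients.card / ε⌉₊) ^ (3 * I.k)) mainProg (I.input e ε)
    fun s => I.IsApprox (1 + 2 / Real.exp 1 + 2 * ε) (output e s) := by
  classical
  have hn : 0 < n := by
    have : I.facilities.Nonempty := by
      rw [← Finset.card_pos]; exact I.k_pos.trans_le I.k_le
    obtain ⟨f, _⟩ := this
    exact (Nat.zero_le _).trans_lt (e.symm f).2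
  have hm : I.clients.card =
      ((Finset.range n).filter fun j => 1 ≤ (I.input e ε).nat 1 j 0).card :=
    (card_filter_range e (· ∈ I.clients) _ (fun j => by rw [input_client]; split_ifs <;> simpa)
      I.clients fun _ => Iff.rfl).symm
  have hF : ∀ j : Fin n, 1 ≤ (I.input e ε).nat 2 j 0 ↔ e j ∈ I.facilities := fun j => by
    rw [input_facility]; split_ifs <;> simpa
  have hkF : I.k ≤ ((Finset.range n).filter fun j => 1 ≤ (I.input e ε).nat 2 j 0).card := by
    rw [card_filter_range e (· ∈ I.facilities) _ hF I.facilities fun _ => Iff.rfl]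
    exact I.k_le
  refine (mainProg_spec (n := n) (k := I.k) (m := I.clients.card) (by omega) (by omega)
    (I.input_n e ε) (I.input_k e ε) hn I.k_pos hm (by rwa [input_epsilon])
    (by rw [input_epsilon]; omega) (fun a ha => I.input_nat_of_le e ε ha) hkF
    (fun j hj => I.input_weight_nonneg e ε ⟨j, hj⟩) (fun j hj f hf l hl => ?_)).mono
      fun s _ hs => ?_
  · have := dist_triangle_right (e ⟨j, hj⟩) (e ⟨f, hf⟩) (e ⟨l, hl⟩)
    simpa only [← I.input_dist e ε] using this
  obtain ⟨hflags, B, hmB, hmε, hB⟩ := hs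
  rw [input_epsilon] at hmε
  have hout : ∀ j : Fin n, e j ∈ output e s ↔ s.nat 3 j 0 = 1 := fun j => by simp [output]
  have hsol : I.IsSolution (output e s) := by
    refine ⟨fun v hv => ?_, ?_⟩
    · obtain ⟨j, rfl⟩ := e.surjective v
      rw [hout] at hv
      rcases hflags.1 j with h | h
      · omega
      · exact (hF j).1 h.2.2
    · rw [hflags.2]
      exact (card_filter_range e (· ∈ output e s) _ (fun j => (hout j).symm) _
        fun _ => Iff.rfl).symm
  refine ⟨hsol, fun T hT => ?_⟩
  set P := I.clients.filter fun v => 0 < I.weight v with hPdef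
  have hPC : ∀ j ∈ P, j ∈ I.clients ∧ 0 < I.weight j := fun j hj => Finset.mem_filter.1 hj
  have hzero : ∀ j ∈ I.clients, j ∉ P → I.weight j = 0 := fun j hj hjP =>
    le_antisymm (not_lt.1 fun h => hjP (Finset.mem_filter.2 ⟨hj, h⟩)) (I.weight_nonneg j hj)
  have hT₀ := I.cost_nonneg hT.nonempty
  rcases P.eq_empty_or_nonempty with hP | hP
  · -- without clients of positive weight every solution has cost zero
    have : I.cost (output e s) = 0 := Finset.sum_eq_zero fun j hj => by
      rw [hzero j hj (by simp [hP]), zero_mul]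
    rw [this]
    positivity
  have hm₀ : 0 < I.clients.card := by
    obtain ⟨j, hj⟩ := hP
    exact Finset.card_pos.2 ⟨j, (hPC j hj).1⟩
  obtain ⟨q, hqP, q', hq'T, hQ, L, H, o, y, hguess⟩ := I.exists_guess hT hP hPC (B := B) (by omega)
  set Q := I.weight q * dist q q' with hQdef
  set R : ℕ → ℝ := fun i => ((y i : ℝ) + 1) * Q / (B * I.weight (H i)) with hR
  obtain ⟨hguess₁, hguess₂⟩ := hguess R fun i => rfl
  have hwt : ∀ v ∈ P, (I.input e ε).real 2 (e.symm v) 0 = I.weight v := fun v hv => by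
    rw [input_weight, e.apply_symm_apply, if_pos (hPC v hv).1]
  have hdist : ∀ v v' : V, (I.input e ε).real 1 (e.symm v) (e.symm v') = dist v v' := fun v v' => by
    rw [input_dist, e.apply_symm_apply, e.apply_symm_apply]
  have hclient : ∀ v ∈ P, (e.symm v : ℕ) < n ∧ 1 ≤ (I.input e ε).nat 1 (e.symm v) 0 :=
    fun v hv => ⟨Fin.is_lt _, by
      rw [input_client, e.apply_symm_apply, if_pos (hPC v hv).1]⟩
  -- functions on `V` as functions of the numbers of the points
  set lift : (V → ℝ) → ℕ → ℝ := fun g j => if h : j < n then g (e ⟨j, h⟩) else 0 with hlift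
  have hlift' : ∀ g (j : Fin n), lift g j = g (e j) := fun g j => by simp [hlift]
  have hlift'' : ∀ g v, lift g (e.symm v) = g v := fun g v => by rw [hlift', e.apply_symm_apply]
  have hnum : ∀ j < n, ∃ v, j = e.symm v := fun j hj => ⟨e ⟨j, hj⟩, by simp⟩
  -- clients outside of `P` have weight zero, so any bound for what they pay will do
  set g : V → ℝ := fun v => if v ∈ P then distTo dist v T else dist v (o 0) with hg
  set u : V → ℝ := fun v =>
    if v ∈ P then 3 * distTo dist v T + Q / (B * I.weight v) else dist v (L 0) + R 0 with hu
  have hgsum : ∑ v ∈ I.clients, I.weight v * g v = I.cost T := by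
    refine Finset.sum_congr rfl fun v hv => ?_
    by_cases hvP : v ∈ P
    · simp only [hg, if_pos hvP]
    · rw [hzero v hv hvP, zero_mul, zero_mul]
  have hQ₀ : 0 ≤ Q := mul_nonneg (hPC q hqP).2.le dist_nonneg
  have husum : ∑ v ∈ I.clients, I.weight v * u v ≤
      3 * I.cost T + I.clients.card * (I.cost T / B) := by
    calc ∑ v ∈ I.clients, I.weight v * u v
        ≤ ∑ v ∈ I.clients, (3 * (I.weight v * distTo dist v T) + I.cost T / B) := by
          refine Finset.sum_le_sum fun v hv => ?_
          by_cases hvP : v ∈ P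
          · have hw := (hPC v hvP).2
            simp only [hu, if_pos hvP]
            have h₁ : I.weight v * (Q / (B * I.weight v)) = Q / B := by
              field_simp
            have h₂ : Q / B ≤ I.cost T / B := by gcongr
            rw [mul_add, h₁]
            linarith
          · rw [hzero v hv hvP]
            simp only [zero_mul, mul_zero, zero_add]
            positivity
      _ = _ := by
          rw [Finset.sum_add_distrib, ← Finset.mul_sum, Finset.sum_const, nsmul_eq_mul]
          rfl
  have hcost := hB (e.symm q) (Fin.is_lt _) (e.symm q') (Fin.is_lt _) (fun i => e.symm (L i))
    (fun i => e.symm (H i)) y (fun i _ => hclient _ (hguess₁ i).1)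
    (fun i _ => hclient _ (hguess₁ i).2.1) (fun i _ => (hguess₁ i).2.2.2.1)
    ((1 + 2 / Real.exp 1 + 2 * ε) * I.cost T) ?_ (lift fun v => distTo dist v (output e s)) ?_
  · rw [I.sum_input_weight e ε (fun v => distTo dist v (output e s)) _
      (hlift' fun v => distTo dist v (output e s))] at hcost
    exact hcost
  · have hR' : ∀ i, ((y i : ℝ) + 1) * ((I.input e ε).real 2 (e.symm q) 0 *
        (I.input e ε).real 1 (e.symm q) (e.symm q')) /
        (B * (I.input e ε).real 2 (e.symm (H i)) 0) = R i := fun i => by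
      rw [hwt q hqP, hdist, hwt _ (hguess₁ i).2.1]
    refine ⟨fun i => e.symm (o i), lift g, lift u, fun i hi => ⟨Fin.is_lt _, ?_, ?_⟩,
      fun j hj => ?_, fun j hj => ?_, ?_⟩
    · rw [hF, e.apply_symm_apply]
      exact hT.1 (hguess₁ i).2.2.1
    · rw [hdist]
      exact ((hguess₁ i).2.2.2.2).trans (hR' i).ge
    · obtain ⟨v, rfl⟩ := hnum j hj
      by_cases hv : v ∈ P
      · obtain ⟨i, hi, h, _⟩ := hguess₂ v hv
        refine ⟨i, hi, ?_⟩
        simpa only [hlift'', hdist, hg, if_pos hv] using h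
      · exact ⟨0, I.k_pos, by simp only [hlift'', hdist, hg, if_neg hv]; exact le_rfl⟩
    · obtain ⟨v, rfl⟩ := hnum j hj
      by_cases hv : v ∈ P
      · obtain ⟨i, hi, _, h⟩ := hguess₂ v hv
        refine ⟨i, hi, ?_⟩
        simp only [hR']
        simpa only [hlift'', hdist, hu, if_pos hv] using h
      · refine ⟨0, I.k_pos, ?_⟩
        simp only [hR']
        simp only [hlift'', hdist, hu, if_neg hv]
        exact le_rfl
    · rw [I.sum_input_weight e ε g _ (hlift' g), I.sum_input_weight e ε u _ (hlift' u), hgsum]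
      exact ratio_le hm₀ hmB hmε hT₀ husum
  · intro j hj f hf hflag
    simp only [hlift, dif_pos hj]
    rw [I.input_dist e ε ⟨j, hj⟩ ⟨f, hf⟩]
    exact distTo_le ((hout ⟨f, hf⟩).2 hflag)

end Instance

end KMedian

theorem mainTheorem6 :
    -- the approximation algorithm
    (∃ (P : KMedian.Prog) (c : ℝ) (m : ℕ), ∀ A : ℝ, ∃ f : ℕ → ℝ → ℝ,
      ∀ (V : Type u) [MetricSpace V] (n : ℕ) (e : Fin n ≃ V) (I : KMedian.Instance V) (ε : ℝ),
        0 < ε →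
        (I.clients.card : ℝ) ≤ A * ε⁻¹ ^ 2 * I.k * Real.log n →
        ∃ (s : KMedian.Mem) (t : ℕ), KMedian.Run P (I.input e ε) s t ∧
          (t : ℝ) ≤ f I.k ε * (n : ℝ) ^ m ∧
          I.IsApprox (1 + 2 / Real.exp 1 + c * ε) (KMedian.output e s)) ∧
    -- the extended metric and the improvement function, for every guess of leaders and radii
    (∀ (V : Type u) [MetricSpace V] [Finite V] (I : KMedian.Instance V) (ε : ℝ)
      (ℓ : Fin I.k → V) (R : Fin I.k → ℝ),
        0 < ε →
        (∀ i, (I.candidates ε ℓ R i).Nonempty) →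
        ((∃ M : PseudoMetricSpace (V ⊕ Fin I.k), ∀ x y, M.dist x y = I.extDist ε ℓ R x y) ∧
          ((∀ i, 0 < R i) →
            ∃ M : MetricSpace (V ⊕ Fin I.k), ∀ x y, M.dist x y = I.extDist ε ℓ R x y)) ∧
        (I.improv ε ℓ R ∅ = 0 ∧
          KMedian.MonotoneOnSubsets I.facilities (I.improv ε ℓ R) ∧
          KMedian.SubmodularOnSubsets I.facilities (I.improv ε ℓ R))) ∧
    -- the cost bound, for the leaders and radii of an optimal solution
    (∀ (V : Type u) [MetricSpace V] [Finite V] (I : KMedian.Instance V) (ε : ℝ)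
      (c : Fin I.k ↪ V) (ℓ : Fin I.k → V) (R : Fin I.k → ℝ),
        0 < ε →
        I.IsOptimal (Finset.univ.map c) →
        (∀ i, I.IsLeader c ℓ i) →
        (∀ i, R i = KMedian.roundUp ε (dist (ℓ i) (c i))) →
        (∀ i, c i ∈ I.candidates ε ℓ R i) ∧
          I.extCost ε ℓ R ∅ ≤ (3 + 2 * ε) * I.cost (Finset.univ.map c)) := by
  refine ⟨⟨KMedian.mainProg, 2, KMedian.mainProg.depth, fun A => ⟨fun k ε =>
    KMedian.mainProg.coeff * KMedian.roundsFactor A k ε ^ KMedian.mainProg.depth, ?_⟩⟩, ?_, ?_⟩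
  · intro V _ n e I ε hε hC
    obtain ⟨s, t, hrun, ht, happrox⟩ := I.mainProg_isApprox e ε hε
    refine ⟨s, t, hrun, ?_, happrox⟩
    have hn : 0 < n := by
      obtain ⟨v, _⟩ := happrox.1.nonempty
      exact (Nat.zero_le _).trans_lt (e.symm v).2
    calc (t : ℝ) ≤ KMedian.mainProg.coeff * ((n + 3 * I.k +
          (I.clients.card + 1 + ⌈I.clients.card / ε⌉₊) ^ (3 * I.k) : ℕ) : ℝ) ^
            KMedian.mainProg.depth := by exact_mod_cast ht
      _ ≤ KMedian.mainProg.coeff * (KMedian.roundsFactor A I.k ε * n) ^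
            KMedian.mainProg.depth := by
          exact mul_le_mul_of_nonneg_left (pow_le_pow_left₀ (Nat.cast_nonneg _)
            (KMedian.rounds_le hε hn hC) _) (Nat.cast_nonneg _)
      _ = _ := by rw [mul_pow, mul_assoc]
  · intro V _ _ I ε ℓ R hε hne
    refine ⟨⟨⟨I.extPseudoMetric hε hne, fun _ _ => rfl⟩, fun hR =>
      ⟨{ I.extPseudoMetric hε hne with
          eq_of_dist_eq_zero := fun h => I.eq_of_extDist_eq_zero hne hR h }, fun _ _ => rfl⟩⟩,
      sub_self _, fun S T hST _ => sub_le_sub_left (I.extCost_mono hST) _, I.improv_submodular _⟩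
  · intro V _ _ I ε c ℓ R hε hopt hℓ hR
    have hcand : ∀ i, c i ∈ I.candidates ε ℓ R i := fun i => Finset.mem_filter.2
      ⟨hopt.1.1 (Finset.mem_map_of_mem c (Finset.mem_univ i)), by rw [dist_comm, hR]⟩
    exact ⟨hcand, I.extCost_le hε c hcand hℓ hR⟩
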